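/- Notation. Let $n\ge 1$ and $m\ge 2$. For $a<b$ let $W_2^n[a,b]$ be the space of functions $f:[a,b]\to\mathbb C$ such that $f,f',\dots,f^{(n-1)}$ are absolutely continuous on $[a,b]$ and $f^{(n)}\in L_2(a,b)$, with the norm $\|f\|_{W_2^n[a,b]}=\big(\sum_{k=0}^n\|f^{(k)}\|_{L_2(a,b)}^2\big)^{1/2}$, and let $W_1^1[a,b]$ be the space of absolutely continuous functions on $[a,b]$. Let $\Gamma_m$ be the star graph with one edge $e_1$ entering the internal vertex $v_1$ and the edges $e_2,\dots,e_m$ leaving it, the edge $e_j$ being parametrized by $t\in[0,T_j]$ so that $v_1$ corresponds to $t=T_1$ on $e_1$ and to $t=0$ on $e_j$, $j\ge2$. Let $0<\tau<T_j$ for $j=1,\dots,m$, and let complex-valued functions $b_{k,j},c_{k,j}$ on $(0,T_j)$, $0\le k\le n$, $1\le j\le m$, satisfy $$b_{n,j},\ \frac1{b_{n,j}},\ c_{n,j}\in L_\infty(0,T_j),\qquad b_{k,j},\,c_{k,j}\in L_2(0,T_j),\quad 0\le k\le n-1.$$ For $y=[y_1,\dots,y_m]$ with $y_1\in W_2^n[-\tau,T_1]$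 and $y_j\in W_2^n[0,T_j]$, $j\ge 2$, put $$\ell_jy(t)=\sum_{k=0}^n\big(b_{k,j}(t)y_j^{(k)}(t)+c_{k,j}(t)y_j^{(k)}(t-\tau)\big),\quad 0<t<T_j,$$ where for $j\ge2$ the function $y_j$ is extended to $(-\tau,0)$ by $y_j(t)=y_1(t+T_1)$. Further, for $0\le k\le n$ put $$\ell_{k,j}y(t)=\overline{b_{k,j}(t)}\,\ell_jy(t)+\overline{c_{k,j}(t+\tau)}\,\ell_jy(t+\tau),\quad 0<t<T_j-\tau,\ 1\le j\le m,$$ $$\ell_{k,1}y(t)=\overline{b_{k,1}(t)}\,\ell_1y(t)+\sum_{\nu=2}^m\overline{c_{k,\nu}(t+\tau-T_1)}\,\ell_\nu y(t+\tau-T_1),\quad T_1-\tau<t<T_1,$$ and define the quasi-derivatives $$y_j^{\langle n\rangle}=\ell_{n,j}y,\qquad y_j^{\langle n+l\rangle}=\ell_{n-l,j}y-\big(y_j^{\langle n+l-1\rangle}\big)',\quad 1\le l\le n.$$ They are understood up to equality almost everywhere, so that an absolutely continuous quasi-derivative is identified with its absolutely continuous representative. Put $l_1=T_1$ and $l_j=T_j-\tau$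 for $j\ge2$. Given $\varphi\in W_2^n[-\tau,0]$, the boundary value problem $\mathcal B$ consists of the equations $$y_j^{\langle 2n\rangle}(t)=0\quad\text{for a.e. } t\in(0,l_j),\quad 1\le j\le m,$$ and the conditions $$y_1(t)=\varphi(t)\ \ (-\tau<t<0),\qquad y_1^{(k)}(0)=\varphi^{(k)}(0)\ \ (0\le k\le n-1),$$ $$y_j^{(k)}(0)=y_1^{(k)}(T_1)\ \ (0\le k\le n-1,\ 2\le j\le m),\qquad y_j(t)=0\ \ (T_j-\tau\le t\le T_j,\ 2\le j\le m),$$ $$y_1^{\langle k\rangle}(T_1)=\sum_{\nu=2}^m y_\nu^{\langle k\rangle}(0)\ \ (n\le k\le 2n-1).$$ Theorem 4. For every $\varphi\in W_2^n[-\tau,0]$ the problem $\mathcal B$ has a unique solution $y_1\in W_2^n[-\tau,T_1]$, $y_j\in W_2^n[0,T_j]$, $j=2,\dots,m$, satisfying $$y_j^{\langle k\rangle}\in W_1^1[0,l_j],\qquad n\le k\le 2n-1,\quad 1\le j\le m.$$ Moreover, there is a constant $C$ independent of $\varphi$ such that this solution satisfies $$\|y_1\|_{W_2^n[-\tau,T_1]}+\sum_{j=2}^m\|y_j\|_{W_2^n[0,T_j-\tau]}\le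 C\,\|\varphi\|_{W_2^n[-\tau,0]}.$$ -/

import Mathlib

open MeasureTheory Set
open scoped ComplexConjugate

noncomputable section

/-- `f ∈ W₁¹[a,b]`, i.e. `f` is absolutely continuous on `[a,b]`. -/
def MemW11 (f : ℝ → ℂ) (a b : ℝ) : Prop :=
  AbsolutelyContinuousOnInterval f a b

/-- The `k`-th derivative of `f` on `[a,b]`, one-sided at the end points. -/
def derivOn (k : ℕ) (f : ℝ → ℂ) (a b : ℝ) : ℝ → ℂ :=
  iteratedDerivWithin k f (Icc a b)

/-- `f ∈ W₂ⁿ[a,b]`: the derivatives of `f` of orders `0, …, n - 1` are absolutely continuous on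
`[a,b]`, and the derivative of order `n` (which then exists almost everywhere if `n ≥ 1`) is
in `L₂(a,b)`. Only the values of `f` on `[a,b]` matter. -/
def MemW2 (n : ℕ) (f : ℝ → ℂ) (a b : ℝ) : Prop :=
  (∀ k < n, AbsolutelyContinuousOnInterval (derivOn k f a b) a b) ∧
    MemLp (derivOn n f a b) 2 (volume.restrict (Ioo a b))

/-- The norm of `W₂ⁿ[a,b]`. -/
def normW2 (n : ℕ) (f : ℝ → ℂ) (a b : ℝ) : ℝ :=
  Real.sqrt (∑ k ∈ Finset.range (n + 1), ∫ t in Ioo a b, ‖derivOn k f a b t‖ ^ 2)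

/-! The star graph with `m = r + 1` edges: index `0` is the edge `e₁` that enters the internal
vertex, the indices `ν.succ` with `ν : Fin r` are the edges `e₂, …, e_m` that leave it. The edge `j`
is parametrized by `[0, T j]`, and the edge `0` is extended by the prehistory `[-τ, 0]`. -/

/-- The interval on which the component `y j` lives begins at `-τ` for the edge `e₁`
and at `0` for the others. -/
def edgeStart {r : ℕ} (τ : ℝ) (j : Fin (r + 1)) : ℝ :=
  if j = 0 then -τ else 0

/-- The derivative `y_j^{(k)}(t)` for `t ∈ (-τ, T j)`. For an outgoing edge and `t < 0` the passage
of the delay through the internal vertex is applied: `y_j(t) = y₁(t + T₁)`, `t ∈ (-τ, 0)`. -/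
def edgeDeriv {r : ℕ} (τ : ℝ) (T : Fin (r + 1) → ℝ) (y : Fin (r + 1) → ℝ → ℂ)
    (j : Fin (r + 1)) (k : ℕ) (t : ℝ) : ℂ :=
  if j ≠ 0 ∧ t < 0 then derivOn k (y 0) (-τ) (T 0) (t + T 0)
  else derivOn k (y j) (edgeStart τ j) (T j) t

/-- `ℓ_j y(t) = ∑_{k=0}^n (b_{k,j}(t) y_j^{(k)}(t) + c_{k,j}(t) y_j^{(k)}(t - τ))`,
where `b j k` stands for `b_{k,j}` and `c j k` for `c_{k,j}`. -/
def ell {r : ℕ} (n : ℕ) (τ : ℝ) (T : Fin (r + 1) → ℝ) (b c : Fin (r + 1) → ℕ → ℝ → ℂ)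
    (y : Fin (r + 1) → ℝ → ℂ) (j : Fin (r + 1)) (t : ℝ) : ℂ :=
  ∑ k ∈ Finset.range (n + 1),
    (b j k t * edgeDeriv τ T y j k t + c j k t * edgeDeriv τ T y j k (t - τ))

/-- `ℓ_{k,j} y(t)`: the second term is `conj c_{k,j}(t+τ) ℓ_j y(t+τ)` for `t < T_j - τ`, and on
`e₁` after `T₁ - τ` it is the sum of `conj c_{k,ν}(t+τ-T₁) ℓ_ν y(t+τ-T₁)` over the outgoing edges
(for the outgoing edges only `t < T_j - τ` is used). -/
def ellAdj {r : ℕ} (n : ℕ) (τ : ℝ) (T : Fin (r + 1) → ℝ) (b c : Fin (r + 1) → ℕ → ℝ → ℂ)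
    (y : Fin (r + 1) → ℝ → ℂ) (k : ℕ) (j : Fin (r + 1)) (t : ℝ) : ℂ :=
  conj (b j k t) * ell n τ T b c y j t +
    if j = 0 ∧ T 0 - τ < t then
      ∑ ν : Fin r, conj (c ν.succ k (t + τ - T 0)) * ell n τ T b c y ν.succ (t + τ - T 0)
    else conj (c j k (t + τ)) * ell n τ T b c y j (t + τ)

/-- The right end of the interval on which the equation on the edge `j` is posed:
`T₁` on `e₁` and `T_j - τ` on the other edges. -/
def eqEnd {r : ℕ} (τ : ℝ) (T : Fin (r + 1) → ℝ) (j : Fin (r + 1)) : ℝ :=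
  if j = 0 then T 0 else T j - τ

/-- `q j l` is the quasi-derivative `y_j^{⟨n+l⟩}`, `l = 0, …, n`, where the ones of orders
`n, …, 2n-1` are absolutely continuous on `[0, eqEnd τ T j]`. Quasi-derivatives are classes of
functions modulo equality almost everywhere; for `l < n` the absolutely continuous
representative, which is unique on the closed interval, is the one meant. -/
structure IsQuasiDeriv {r : ℕ} (n : ℕ) (τ : ℝ) (T : Fin (r + 1) → ℝ)
    (b c : Fin (r + 1) → ℕ → ℝ → ℂ) (y : Fin (r + 1) → ℝ → ℂ)
    (q : Fin (r + 1) → ℕ → ℝ → ℂ) : Prop where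
  first : ∀ j, ∀ᵐ t ∂volume.restrict (Ioo 0 (eqEnd τ T j)),
    q j 0 t = ellAdj n τ T b c y n j t
  next : ∀ j, ∀ l < n, ∀ᵐ t ∂volume.restrict (Ioo 0 (eqEnd τ T j)),
    q j (l + 1) t = ellAdj n τ T b c y (n - (l + 1)) j t - deriv (q j l) t
  absCont : ∀ j, ∀ l < n, MemW11 (q j l) 0 (eqEnd τ T j)

/-- `y = [y₁, …, y_m]`, with `y₁ ∈ W₂ⁿ[-τ,T₁]` and `y_j ∈ W₂ⁿ[0,T_j]`, is a solution of the boundary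
value problem with absolutely continuous quasi-derivatives of orders `n, …, 2n-1`. -/
structure IsSolution {r : ℕ} (n : ℕ) (τ : ℝ) (T : Fin (r + 1) → ℝ)
    (b c : Fin (r + 1) → ℕ → ℝ → ℂ) (φ : ℝ → ℂ) (y : Fin (r + 1) → ℝ → ℂ) : Prop where
  memW2 : ∀ j, MemW2 n (y j) (edgeStart τ j) (T j)
  prehistory : ∀ t ∈ Ioo (-τ) 0, y 0 t = φ t
  initial : ∀ k < n, derivOn k (y 0) (-τ) (T 0) 0 = derivOn k φ (-τ) 0 0
  continuity : ∀ ν : Fin r, ∀ k < n,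
    derivOn k (y ν.succ) 0 (T ν.succ) 0 = derivOn k (y 0) (-τ) (T 0) (T 0)
  equilibrium : ∀ ν : Fin r, ∀ t ∈ Icc (T ν.succ - τ) (T ν.succ), y ν.succ t = 0
  /-- The quasi-derivatives of orders `n, …, 2n-1` are absolutely continuous, the ones of order
  `2n` vanish on the edges, and the Kirchhoff-type conditions hold at the internal vertex. -/
  equation : ∃ q : Fin (r + 1) → ℕ → ℝ → ℂ, IsQuasiDeriv n τ T b c y q ∧
    (∀ j, ∀ᵐ t ∂volume.restrict (Ioo 0 (eqEnd τ T j)), q j n t = 0) ∧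
    ∀ l < n, q 0 l (T 0) = ∑ ν : Fin r, q ν.succ l 0

end

/-! ### Absolutely continuous complex-valued functions of a real variable -/

section AbsolutelyContinuous

open Filter Topology

variable {a b : ℝ}

/-! The entering edge and one outgoing edge form a path in a time starting at `-τ`; along a path the
delay through the vertex is an ordinary delay. A function on a path is a jet, a chain of primitives
`F 0, …, F n` indexed by codegree: `F 0` is the derivative of order `n` and `F n` is the function.
It is determined by `F 0` and by its values at `-τ`. Hence the unknown is a pair of a prehistory `ξ`
(`n` numbers and an `L²` function) and a control `u` (the derivatives of order `n` on the edges up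
to the tips). For zero prehistory, `A u` collects the expressions `ℓ_j` and `E u` the derivatives of
orders below `n` at the tips of the outgoing edges.

The boundary value problem is the Euler–Lagrange system for minimizing the sum of the `‖ℓ_j y‖²`
under these terminal constraints: with `a ξ` and `e ξ` the contributions of the prehistory, it says
that `E u + e ξ = 0` and that `a ξ + A u` is orthogonal to `A (ker E)`. If `‖u‖ ≤ K ‖A u‖` and `E`
is onto a finite-dimensional space, projection onto the closed subspace `A (ker E)` gives a unique
`u`, bounded by `ξ` (`leastSquares_exists`, `leastSquares_unique`).

Coercivity (`A_coercive`): in `L²` with an exponential weight of rate `λ`, the undelayed term of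
order `n` controls `u` because `1 / b_n` is bounded, the lower-order terms are `O(λ^(-1/2))`, and
the delayed term of order `n` is `O(exp(-λτ))`. For large `λ` the last two are absorbed.

Orthogonality and quasi-derivatives: integration by parts along a chain of quasi-derivatives leaves
boundary terms only at the tips, where admissible variations vanish (`Rep.orthogonal`). Conversely,
a functional that vanishes on `ker E` is a combination of the coordinates of `E`. The multipliers
serve as terminal values of a chain obtained by integrating backwards, and a du Bois-Reymond
argument shows that this chain consists of the quasi-derivatives (`IsChain.ae_eq_zero`,
`exists_chain_of_orthogonal`). The same argument with zero right-hand side gives surjectivity of `E`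
(`E_surjective`).

The dictionary between functions on the graph and the data `(ξ, u)` is `rep_comp` and `exists_rep`.
-/

theorem AbsolutelyContinuousOnInterval.of_dist_le {X Y : Type*} [PseudoMetricSpace X]
    [PseudoMetricSpace Y] {f : ℝ → X} {g : ℝ → Y} (hf : AbsolutelyContinuousOnInterval f a b)
    (h : ∀ s ∈ uIcc a b, ∀ t ∈ uIcc a b, dist (g s) (g t) ≤ dist (f s) (f t)) :
    AbsolutelyContinuousOnInterval g a b := by
  rw [absolutelyContinuousOnInterval_iff] at hf ⊢
  intro ε hε
  obtain ⟨δ, hδ, H⟩ := hf ε hε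
  refine ⟨δ, hδ, fun E hE hlt => lt_of_le_of_lt ?_ (H E hE hlt)⟩
  exact Finset.sum_le_sum fun i hi => h _ (hE.1 i hi).1 _ (hE.1 i hi).2

theorem AbsolutelyContinuousOnInterval.congr {X : Type*} [PseudoMetricSpace X]
    {f g : ℝ → X} (hf : AbsolutelyContinuousOnInterval f a b) (h : EqOn g f (uIcc a b)) :
    AbsolutelyContinuousOnInterval g a b :=
  hf.of_dist_le fun s hs t ht => by rw [h hs, h ht]

theorem AbsolutelyContinuousOnInterval.complex_re {f : ℝ → ℂ}
    (hf : AbsolutelyContinuousOnInterval f a b) :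
    AbsolutelyContinuousOnInterval (fun t => (f t).re) a b :=
  hf.of_dist_le fun s _ t _ => by
    rw [Real.dist_eq, Complex.dist_eq, ← Complex.sub_re]; exact Complex.abs_re_le_norm _

theorem AbsolutelyContinuousOnInterval.complex_im {f : ℝ → ℂ}
    (hf : AbsolutelyContinuousOnInterval f a b) :
    AbsolutelyContinuousOnInterval (fun t => (f t).im) a b :=
  hf.of_dist_le fun s _ t _ => by
    rw [Real.dist_eq, Complex.dist_eq, ← Complex.sub_im]; exact Complex.abs_im_le_norm _

theorem AbsolutelyContinuousOnInterval.ofReal {f : ℝ → ℝ}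
    (hf : AbsolutelyContinuousOnInterval f a b) :
    AbsolutelyContinuousOnInterval (fun t => (f t : ℂ)) a b :=
  hf.of_dist_le fun s _ t _ => by
    rw [Real.dist_eq, Complex.dist_eq, ← Complex.ofReal_sub, Complex.norm_real, Real.norm_eq_abs]

/-- The real and imaginary parts of the primitive are real primitives, for which the claim is known;
they are recombined linearly. -/
theorem IntervalIntegrable.absolutelyContinuousOnInterval_complex {f : ℝ → ℂ} {c : ℝ}
    (h : IntervalIntegrable f volume a b) (hc : c ∈ uIcc a b) :
    AbsolutelyContinuousOnInterval (fun t => ∫ s in c..t, f s) a b := by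
  have h1 : IntervalIntegrable (fun t => (f t).re) volume a b :=
    ⟨h.1.re, h.2.re⟩
  have h2 : IntervalIntegrable (fun t => (f t).im) volume a b :=
    ⟨h.1.im, h.2.im⟩
  have A := (h1.absolutelyContinuousOnInterval_intervalIntegral hc).ofReal.fun_add
    ((h2.absolutelyContinuousOnInterval_intervalIntegral hc).ofReal.const_smul Complex.I)
  refine A.congr fun t ht => ?_
  have hi : IntervalIntegrable f volume c t := h.mono_set (uIcc_subset_uIcc hc ht)
  have e1 := Complex.reCLM.intervalIntegral_comp_comm hi
  have e2 := Complex.imCLM.intervalIntegral_comp_comm hi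
  simp only [Complex.reCLM_apply, Complex.imCLM_apply] at e1 e2
  beta_reduce
  rw [e1, e2, smul_eq_mul, mul_comm]
  exact (Complex.re_add_im _).symm

theorem AbsolutelyContinuousOnInterval.ae_differentiableAt_complex {f : ℝ → ℂ}
    (hf : AbsolutelyContinuousOnInterval f a b) :
    ∀ᵐ x : ℝ, x ∈ uIcc a b → DifferentiableAt ℝ f x :=
  hf.boundedVariationOn.ae_differentiableAt_of_mem_uIcc

theorem AbsolutelyContinuousOnInterval.intervalIntegrable_deriv_complex {f : ℝ → ℂ}
    (hf : AbsolutelyContinuousOnInterval f a b) :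
    IntervalIntegrable (deriv f) volume a b := by
  have h1 := hf.complex_re.intervalIntegrable_deriv
  have h2 := hf.complex_im.intervalIntegrable_deriv
  have h : IntervalIntegrable (fun t => ((deriv (fun t => (f t).re) t : ℝ) : ℂ) +
      ((deriv (fun t => (f t).im) t : ℝ) : ℂ) * Complex.I) volume a b :=
    ⟨h1.1.ofReal.add (h2.1.ofReal.mul_const _), h1.2.ofReal.add (h2.2.ofReal.mul_const _)⟩
  refine h.congr_ae ?_
  rw [EventuallyEq, ae_restrict_iff' measurableSet_uIoc]
  filter_upwards [hf.ae_differentiableAt_complex] with x hx hxm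
  have hd := (hx (uIoc_subset_uIcc hxm)).hasDerivAt
  have e1 := Complex.reCLM.hasFDerivAt.comp_hasDerivAt x hd
  have e2 := Complex.imCLM.hasFDerivAt.comp_hasDerivAt x hd
  have e1' : deriv (fun t => (f t).re) x = (deriv f x).re := e1.deriv
  have e2' : deriv (fun t => (f t).im) x = (deriv f x).im := e2.deriv
  rw [e1', e2']
  exact Complex.re_add_im _

/-- The difference of `f` and a primitive of `deriv f` is absolutely continuous with derivative zero
almost everywhere, hence constant. -/
theorem AbsolutelyContinuousOnInterval.integral_deriv_complex {f : ℝ → ℂ}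
    (hf : AbsolutelyContinuousOnInterval f a b) :
    ∫ x in a..b, deriv f x = f b - f a := by
  have hi := hf.intervalIntegrable_deriv_complex
  have g_ac := hf.fun_sub (hi.absolutelyContinuousOnInterval_complex (c := a) (by simp))
  obtain ⟨C, hC⟩ := g_ac.const_of_ae_hasDerivAt_zero (by
    filter_upwards [hf.ae_differentiableAt_complex, hi.ae_hasDerivAt_integral]
      with x hx₁ hx₂ hx₃
    simpa using! (hx₁ hx₃).hasDerivAt.sub (hx₂ hx₃ a (by simp)))
  have h1 := hC a (by simp)
  have h2 := hC b (by simp)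
  simp only [intervalIntegral.integral_same, sub_zero] at h1
  rw [← h1] at h2
  linear_combination -h2

theorem AbsolutelyContinuousOnInterval.integral_deriv_mul_complex {f g : ℝ → ℂ}
    (hf : AbsolutelyContinuousOnInterval f a b) (hg : AbsolutelyContinuousOnInterval g a b) :
    ∫ x in a..b, (deriv f x * g x + f x * deriv g x) = f b * g b - f a * g a := by
  have h := (hf.fun_smul hg).integral_deriv_complex
  simp only [smul_eq_mul] at h
  rw [← h]
  apply intervalIntegral.integral_congr_ae
  filter_upwards [hf.ae_differentiableAt_complex, hg.ae_differentiableAt_complex]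
    with x hx₁ hx₂ hx₃
  have hx₄ : x ∈ uIcc a b := uIoc_subset_uIcc hx₃
  exact ((hx₁ hx₄).hasDerivAt.mul (hx₂ hx₄).hasDerivAt).deriv.symm

end AbsolutelyContinuous

/-! ### Jets: chains of successive primitives -/

/-- `F 0` is integrable on `[a,b]` and `F (i + 1)` is a primitive of `F i` on `[a,b]`, `i < n`. -/
structure IsJet (n : ℕ) (F : ℕ → ℝ → ℂ) (a b : ℝ) : Prop where
  integrable : IntervalIntegrable (F 0) volume a b
  primitive : ∀ i < n, ∀ t ∈ Icc a b, F (i + 1) t = F (i + 1) a + ∫ s in a..t, F i s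

namespace IsJet

open Filter Topology

variable {n : ℕ} {F G : ℕ → ℝ → ℂ} {a b : ℝ}

theorem intervalIntegrable (h : IsJet n F a b) (hab : a ≤ b) :
    ∀ i ≤ n, IntervalIntegrable (F i) volume a b := by
  intro i
  induction i with
  | zero => exact fun _ => h.integrable
  | succ i ih =>
    intro hi
    have hc : ContinuousOn (fun t => F (i + 1) a + ∫ s in a..t, F i s) (uIcc a b) :=
      continuousOn_const.add
        (intervalIntegral.continuousOn_primitive_interval' (ih (by omega)) left_mem_uIcc)
    refine (hc.congr fun t ht => ?_).intervalIntegrable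
    exact h.primitive i hi t (by rwa [uIcc_of_le hab] at ht)

theorem absCont (h : IsJet n F a b) (hab : a ≤ b) {i : ℕ} (hi : i < n) :
    AbsolutelyContinuousOnInterval (F (i + 1)) a b := by
  have h1 := (h.intervalIntegrable hab i hi.le).absolutelyContinuousOnInterval_complex
    (left_mem_uIcc)
  refine h1.of_dist_le fun s hs t ht => ?_
  rw [uIcc_of_le hab] at hs ht
  rw [h.primitive i hi s hs, h.primitive i hi t ht, dist_add_left]

theorem continuousOn (h : IsJet n F a b) (hab : a ≤ b) {i : ℕ} (hi : i < n) :
    ContinuousOn (F (i + 1)) (Icc a b) := by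
  have := (h.absCont hab hi).continuousOn
  rwa [uIcc_of_le hab] at this

theorem ae_hasDerivAt (h : IsJet n F a b) (hab : a ≤ b) {i : ℕ} (hi : i < n) :
    ∀ᵐ t : ℝ, t ∈ Ioo a b → HasDerivAt (F (i + 1)) (F i t) t := by
  filter_upwards [(h.intervalIntegrable hab i hi.le).ae_hasDerivAt_integral] with t ht hmem
  have h1 := (ht (by rw [uIcc_of_le hab]; exact Ioo_subset_Icc_self hmem) a
    left_mem_uIcc).const_add (F (i + 1) a)
  refine h1.congr_of_eventuallyEq ?_
  filter_upwards [Ioo_mem_nhds hmem.1 hmem.2] with s hs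
  exact h.primitive i hi s (Ioo_subset_Icc_self hs)

/-- From the second primitive on, the integrand is continuous, so the derivative exists at every
point, one-sided at the ends. For `F 1` this is available only almost everywhere. -/
theorem hasDerivWithinAt (h : IsJet n F a b) (hab : a ≤ b) {i : ℕ} (hi : i + 1 < n) {t : ℝ}
    (ht : t ∈ Icc a b) : HasDerivWithinAt (F (i + 2)) (F (i + 1) t) (Icc a b) t := by
  have hc := h.continuousOn hab (i := i) (by omega)
  have : Fact (t ∈ Icc a b) := ⟨ht⟩
  have h1 : HasDerivWithinAt (fun t => F (i + 2) a + ∫ s in a..t, F (i + 1) s)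
      (F (i + 1) t) (Icc a b) t :=
    (intervalIntegral.integral_hasDerivWithinAt_right
      ((h.intervalIntegrable hab (i + 1) (by omega)).mono_set
        (by rw [uIcc_of_le hab, uIcc_of_le ht.1]; exact Icc_subset_Icc_right ht.2))
      (hc.stronglyMeasurableAtFilter_nhdsWithin measurableSet_Icc t)
      (hc t ht)).const_add _
  exact h1.congr (fun s hs => h.primitive (i + 1) hi s hs) (h.primitive (i + 1) hi t ht)

/-- The order `k` corresponds to the codegree `n - k`. Below order `n` each differentiation undoes a
primitive of a continuous function, so the agreement is pointwise on the closed interval. -/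
theorem derivOn_eq (h : IsJet n F a b) (hab : a < b) {f : ℝ → ℂ} (hf : EqOn f (F n) (Icc a b))
    {k : ℕ} (hk : k < n) : EqOn (derivOn k f a b) (F (n - k)) (Icc a b) := by
  induction k with
  | zero => intro t ht; simpa [derivOn] using hf ht
  | succ k ih =>
    intro t ht
    have ih' := ih (by omega)
    obtain ⟨i, hi⟩ : ∃ i, n - k = i + 2 := ⟨n - k - 2, by omega⟩
    rw [hi] at ih'
    rw [show n - (k + 1) = i + 1 by omega]
    unfold derivOn at ih' ⊢
    rw [iteratedDerivWithin_succ, derivWithin_congr ih' (ih' ht)]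
    exact (h.hasDerivWithinAt hab.le (by omega) ht).derivWithin (uniqueDiffOn_Icc hab t ht)

theorem derivOn_top_ae (h : IsJet n F a b) (hab : a < b) {f : ℝ → ℂ}
    (hf : EqOn f (F n) (Icc a b)) : ∀ᵐ t : ℝ, t ∈ Ioo a b → derivOn n f a b t = F 0 t := by
  rcases Nat.eq_zero_or_pos n with rfl | hn
  · exact ae_of_all _ fun t ht => by simpa [derivOn] using hf (Ioo_subset_Icc_self ht)
  · obtain ⟨m, rfl⟩ : ∃ m, n = m + 1 := ⟨n - 1, by omega⟩
    have e := h.derivOn_eq hab hf (k := m) (by omega)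
    filter_upwards [h.ae_hasDerivAt hab.le (i := 0) hn] with t ht hmem
    have hm := Ioo_subset_Icc_self hmem
    rw [show m + 1 - m = 0 + 1 by omega] at e
    unfold derivOn at e ⊢
    rw [iteratedDerivWithin_succ, derivWithin_congr e (e hm)]
    exact (ht hmem).hasDerivWithinAt.derivWithin (uniqueDiffOn_Icc hab t hm)

theorem memW2 (h : IsJet n F a b) (hab : a < b) {f : ℝ → ℂ} (hf : EqOn f (F n) (Icc a b))
    (hF : MemLp (F 0) 2 (volume.restrict (Ioo a b))) : MemW2 n f a b := by
  refine ⟨fun k hk => ?_, ?_⟩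
  · obtain ⟨i, hi⟩ : ∃ i, n - k = i + 1 := ⟨n - k - 1, by omega⟩
    refine (h.absCont hab.le (i := i) (by omega)).congr ?_
    rw [uIcc_of_le hab.le, ← hi]
    exact h.derivOn_eq hab hf hk
  · refine hF.ae_eq ?_
    rw [EventuallyEq, ae_restrict_iff' measurableSet_Ioo]
    filter_upwards [h.derivOn_top_ae hab hf] with t ht hm using (ht hm).symm

/-- Each derivative of order below `n` is the integral of its derivative, and in the interior the
one-sided derivative is the ordinary one. With `memW2` this replaces Sobolev membership by integral
identities. -/
theorem of_memW2 {f : ℝ → ℂ} (hf : MemW2 n f a b) (hab : a < b) :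
    IsJet n (fun i => derivOn (n - i) f a b) a b where
  integrable := by
    rw [intervalIntegrable_iff_integrableOn_Ioo_of_le hab.le]
    exact hf.2.integrable one_le_two
  primitive := by
    intro i hi t ht
    have hac := (hf.1 (n - (i + 1)) (by omega)).mono (c := a) (d := t) (by
      rw [uIcc_of_le hab.le, uIcc_of_le ht.1]; exact Icc_subset_Icc_right ht.2)
    have h1 := hac.integral_deriv_complex
    have h2 : ∫ s in a..t, derivOn (n - i) f a b s
        = ∫ s in a..t, deriv (derivOn (n - (i + 1)) f a b) s := by
      rw [intervalIntegral.integral_of_le ht.1, intervalIntegral.integral_of_le ht.1,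
        integral_Ioc_eq_integral_Ioo, integral_Ioc_eq_integral_Ioo]
      refine setIntegral_congr_fun measurableSet_Ioo fun s hs => ?_
      rw [show n - i = n - (i + 1) + 1 by omega]
      unfold derivOn
      rw [iteratedDerivWithin_succ]
      exact derivWithin_of_mem_nhds (Icc_mem_nhds hs.1 (hs.2.trans_le ht.2))
    rw [h2, h1]; ring

theorem mono_right (h : IsJet n F a b) {c : ℝ} (hac : a ≤ c) (hcb : c ≤ b) : IsJet n F a c where
  integrable := h.integrable.mono_set (by
    rw [uIcc_of_le hac, uIcc_of_le (hac.trans hcb)]; exact Icc_subset_Icc_right hcb)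
  primitive i hi t ht := h.primitive i hi t ⟨ht.1, ht.2.trans hcb⟩

theorem mono_left (h : IsJet n F a b) {c : ℝ} (hac : a ≤ c) (hcb : c ≤ b) : IsJet n F c b where
  integrable := h.integrable.mono_set (by
    rw [uIcc_of_le hcb, uIcc_of_le (hac.trans hcb)]; exact Icc_subset_Icc_left hac)
  primitive i hi t ht := by
    have hi' := h.intervalIntegrable (hac.trans hcb) i hi.le
    rw [h.primitive i hi t ⟨hac.trans ht.1, ht.2⟩, h.primitive i hi c ⟨hac, hcb⟩, add_assoc,
      intervalIntegral.integral_add_adjacent_intervals]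
    · exact hi'.mono_set (by
        rw [uIcc_of_le hac, uIcc_of_le (hac.trans hcb)]; exact Icc_subset_Icc_right hcb)
    · exact hi'.mono_set (by
        rw [uIcc_of_le ht.1, uIcc_of_le (hac.trans hcb)]; exact Icc_subset_Icc hac ht.2)

/-- Both jets use the same value `F (i + 1) c`, so the constants of integration match. On the graph
this is where continuity at the vertex enters. -/
theorem glue {c : ℝ} (h1 : IsJet n F a c) (h2 : IsJet n F c b) (hac : a ≤ c) (hcb : c ≤ b) :
    IsJet n F a b where
  integrable := h1.integrable.trans h2.integrable
  primitive i hi t ht := by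
    rcases le_total t c with htc | hct
    · exact h1.primitive i hi t ⟨ht.1, htc⟩
    · rw [h2.primitive i hi t ⟨hct, ht.2⟩, h1.primitive i hi c ⟨hac, le_rfl⟩, add_assoc,
        intervalIntegral.integral_add_adjacent_intervals (h1.intervalIntegrable hac i hi.le)]
      exact (h2.intervalIntegrable hcb i hi.le).mono_set (by
        rw [uIcc_of_le hct, uIcc_of_le hcb]; exact Icc_subset_Icc_right ht.2)

/-- The jet property is stable under changes of `F 0` on null sets and of nothing else. -/
theorem congr (h : IsJet n F a b) (hab : a ≤ b) (h0 : ∀ᵐ t : ℝ, t ∈ Ioo a b → G 0 t = F 0 t)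
    (hs : ∀ i < n, EqOn (G (i + 1)) (F (i + 1)) (Icc a b)) : IsJet n G a b := by
  have h0' : G 0 =ᵐ[volume.restrict (Ioo a b)] F 0 := by
    rwa [EventuallyEq, ae_restrict_iff' measurableSet_Ioo]
  refine ⟨?_, fun i hi t ht => ?_⟩
  · have := h.integrable
    rw [intervalIntegrable_iff_integrableOn_Ioo_of_le hab] at this ⊢
    exact Integrable.congr this h0'.symm
  · rw [hs i hi ht, hs i hi (left_mem_Icc.2 hab), h.primitive i hi t ht]
    congr 1
    rw [intervalIntegral.integral_of_le ht.1, intervalIntegral.integral_of_le ht.1,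
        integral_Ioc_eq_integral_Ioo, integral_Ioc_eq_integral_Ioo]
    refine setIntegral_congr_ae measurableSet_Ioo ?_
    rcases i with _ | i
    · filter_upwards [h0] with s hs' hm using (hs' ⟨hm.1, hm.2.trans_le ht.2⟩).symm
    · exact ae_of_all _ fun s hm => (hs i (by omega) ⟨hm.1.le, hm.2.le.trans ht.2⟩).symm

/-- Integrating upwards from `F 0`, a jet is determined by `F 0` almost everywhere and by its values
at the left end. Most identifications of functions below rest on this uniqueness. -/
theorem eqOn (h : IsJet n F a b) (h' : IsJet n G a b)
    (h0 : ∀ᵐ t : ℝ, t ∈ Ioo a b → G 0 t = F 0 t)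
    (hs : ∀ i < n, G (i + 1) a = F (i + 1) a) {i : ℕ} (hi : i < n) :
    EqOn (G (i + 1)) (F (i + 1)) (Icc a b) := by
  induction i with
  | zero =>
    intro t ht
    rw [h.primitive 0 hi t ht, h'.primitive 0 hi t ht, hs 0 hi]
    congr 1
    rw [intervalIntegral.integral_of_le ht.1, intervalIntegral.integral_of_le ht.1,
        integral_Ioc_eq_integral_Ioo, integral_Ioc_eq_integral_Ioo]
    refine setIntegral_congr_ae measurableSet_Ioo ?_
    filter_upwards [h0] with s hs' hm using hs' ⟨hm.1, hm.2.trans_le ht.2⟩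
  | succ i ih =>
    intro t ht
    rw [h.primitive _ hi t ht, h'.primitive _ hi t ht, hs _ hi]
    congr 1
    refine intervalIntegral.integral_congr fun s hs' => ?_
    rw [uIcc_of_le ht.1] at hs'
    exact ih (by omega) ⟨hs'.1, hs'.2.trans ht.2⟩

theorem comp_add (h : IsJet n F a b) (d : ℝ) :
    IsJet n (fun i t => F i (t + d)) (a - d) (b - d) where
  integrable := h.integrable.comp_add_right d
  primitive i hi t ht := by
    rw [intervalIntegral.integral_comp_add_right (fun s => F i s)]
    simp only [sub_add_cancel]
    exact h.primitive i hi _ ⟨by linarith [ht.1], by linarith [ht.2]⟩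

theorem conjugate (h : IsJet n F a b) : IsJet n (fun i t => conj (F i t)) a b where
  integrable := ⟨Complex.conjCLE.toContinuousLinearMap.integrable_comp h.integrable.1,
    Complex.conjCLE.toContinuousLinearMap.integrable_comp h.integrable.2⟩
  primitive i hi t ht := by
    rw [h.primitive i hi t ht, map_add, intervalIntegral, intervalIntegral, map_sub,
      integral_conj, integral_conj]

/-- Integration by parts in a chain of quasi-derivatives. -/
theorem integral_sum_mul (h : IsJet n F a b) (hab : a ≤ b) {g q : ℕ → ℝ → ℂ}
    (hq : ∀ l < n, AbsolutelyContinuousOnInterval (q l) a b)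
    (h0 : ∀ᵐ t : ℝ, t ∈ Ioo a b → g 0 t = q 0 t)
    (hs : ∀ l < n, ∀ᵐ t : ℝ, t ∈ Ioo a b → g (l + 1) t = q (l + 1) t + deriv (q l) t)
    (hn : ∀ᵐ t : ℝ, t ∈ Ioo a b → q n t = 0) :
    ∫ t in a..b, ∑ l ∈ Finset.range (n + 1), g l t * F l t =
      ∑ l ∈ Finset.range n, (q l b * F (l + 1) b - q l a * F (l + 1) a) := by
  -- Since `g (l + 1) = q (l + 1) + (q l)'` and `F l = (F (l + 1))'`, the sum telescopes to that of
  -- the derivatives of `q l * F (l + 1)`; the leftover term `q n * F n` is zero.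
  have e1 : ∫ t in a..b, ∑ l ∈ Finset.range (n + 1), g l t * F l t =
      ∫ t in a..b, ∑ l ∈ Finset.range n,
        (deriv (q l) t * F (l + 1) t + q l t * deriv (F (l + 1)) t) := by
    rw [intervalIntegral.integral_of_le hab, intervalIntegral.integral_of_le hab,
        integral_Ioc_eq_integral_Ioo, integral_Ioc_eq_integral_Ioo]
    refine setIntegral_congr_ae measurableSet_Ioo ?_
    have hs' : ∀ᵐ t : ℝ, ∀ l < n, t ∈ Ioo a b → g (l + 1) t = q (l + 1) t + deriv (q l) t := by
      rw [ae_all_iff]; intro l; rw [ae_all_iff]; exact hs l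
    have hd : ∀ᵐ t : ℝ, ∀ l < n, t ∈ Ioo a b → HasDerivAt (F (l + 1)) (F l t) t := by
      rw [ae_all_iff]; intro l; rw [ae_all_iff]; exact fun hl => h.ae_hasDerivAt hab hl
    filter_upwards [h0, hs', hd, hn] with t h0 hs hd hn hm
    rw [Finset.sum_range_succ']
    have e2 : ∑ l ∈ Finset.range n, g (l + 1) t * F (l + 1) t =
        ∑ l ∈ Finset.range n, (q (l + 1) t * F (l + 1) t) +
          ∑ l ∈ Finset.range n, deriv (q l) t * F (l + 1) t := by
      rw [← Finset.sum_add_distrib]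
      refine Finset.sum_congr rfl fun l hl => ?_
      rw [hs l (Finset.mem_range.1 hl) hm]; ring
    have e3 : ∑ l ∈ Finset.range n, q l t * deriv (F (l + 1)) t =
        ∑ l ∈ Finset.range n, q l t * F l t :=
      Finset.sum_congr rfl fun l hl => by rw [(hd l (Finset.mem_range.1 hl) hm).deriv]
    have e4 := Finset.sum_range_succ' (fun l => q l t * F l t) n
    rw [Finset.sum_range_succ, hn hm, zero_mul, add_zero] at e4
    rw [e2, Finset.sum_add_distrib, e3, e4, h0 hm]
    ring
  rw [e1, intervalIntegral.integral_finsetSum]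
  · refine Finset.sum_congr rfl fun l hl => ?_
    exact (hq l (Finset.mem_range.1 hl)).integral_deriv_mul_complex
      (h.absCont hab (Finset.mem_range.1 hl))
  · intro l hl
    have A := hq l (Finset.mem_range.1 hl)
    have B := h.absCont hab (Finset.mem_range.1 hl)
    exact (A.intervalIntegrable_deriv_complex.mul_continuousOn B.continuousOn).add
      (B.intervalIntegrable_deriv_complex.continuousOn_mul A.continuousOn)

end IsJet

/-- The chain of successive primitives of `V` with the values `x i` at the point `a`. -/
noncomputable def jet (a : ℝ) (x : ℕ → ℂ) (V : ℝ → ℂ) : ℕ → ℝ → ℂ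
  | 0 => V
  | i + 1 => fun t => x i + ∫ s in a..t, jet a x V i s

@[simp] theorem jet_zero (a : ℝ) (x : ℕ → ℂ) (V : ℝ → ℂ) : jet a x V 0 = V := rfl

theorem jet_succ (a : ℝ) (x : ℕ → ℂ) (V : ℝ → ℂ) (i : ℕ) (t : ℝ) :
    jet a x V (i + 1) t = x i + ∫ s in a..t, jet a x V i s := rfl

@[simp] theorem jet_succ_self (a : ℝ) (x : ℕ → ℂ) (V : ℝ → ℂ) (i : ℕ) :
    jet a x V (i + 1) a = x i := by simp [jet_succ]

theorem isJet_jet {a b : ℝ} {x : ℕ → ℂ} {V : ℝ → ℂ} (hV : IntervalIntegrable V volume a b)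
    (n : ℕ) : IsJet n (jet a x V) a b :=
  ⟨hV, fun i _ t _ => by rw [jet_succ_self, jet_succ]⟩

/-! ### Linearity and weighted bounds for jets -/

section JetBounds

open Filter Topology

variable {a : ℝ} {x x' : ℕ → ℂ} {V V' : ℝ → ℂ}

theorem jet_intervalIntegrable (hV : LocallyIntegrable V) (a : ℝ) (x : ℕ → ℂ) (i : ℕ) :
    ∀ s t, IntervalIntegrable (jet a x V i) volume s t := by
  induction i with
  | zero => exact fun s t => (hV.integrableOn_isCompact isCompact_uIcc).intervalIntegrable
  | succ i ih =>
    exact fun s t => (continuous_const.add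
      (intervalIntegral.continuous_primitive ih a)).intervalIntegrable s t

theorem continuous_jet_succ (hV : LocallyIntegrable V) (a : ℝ) (x : ℕ → ℂ) (i : ℕ) :
    Continuous (jet a x V (i + 1)) :=
  continuous_const.add
    (intervalIntegral.continuous_primitive (jet_intervalIntegrable hV a x i) a)

theorem jet_add (hV : LocallyIntegrable V) (hV' : LocallyIntegrable V') (i : ℕ) :
    jet a (x + x') (V + V') i = jet a x V i + jet a x' V' i := by
  induction i with
  | zero => rfl
  | succ i ih =>
    funext t
    rw [jet_succ, ih, Pi.add_apply, Pi.add_apply, jet_succ, jet_succ]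
    rw [show (fun s => (jet a x V i + jet a x' V' i) s)
      = fun s => jet a x V i s + jet a x' V' i s from rfl,
      intervalIntegral.integral_add (jet_intervalIntegrable hV a x i a t)
      (jet_intervalIntegrable hV' a x' i a t)]
    ring

theorem jet_smul (c : ℂ) (i : ℕ) : jet a (c • x) (c • V) i = c • jet a x V i := by
  induction i with
  | zero => rfl
  | succ i ih =>
    funext t
    rw [jet_succ, ih, Pi.smul_apply, Pi.smul_apply, jet_succ]
    simp only [Pi.smul_apply, smul_eq_mul, intervalIntegral.integral_const_mul]
    ring

theorem jet_congr_ae (h : V =ᵐ[volume] V') (i : ℕ) :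
    jet a x V (i + 1) = jet a x V' (i + 1) := by
  induction i with
  | zero =>
    funext t
    rw [jet_succ, jet_succ]
    congr 1
    exact intervalIntegral.integral_congr_ae (h.mono fun s hs _ => hs)
  | succ i ih =>
    funext t
    rw [jet_succ, ih, jet_succ]

theorem jet_ae_eq (h : V =ᵐ[volume] V') (i : ℕ) :
    jet a x V i =ᵐ[volume] jet a x V' i := by
  cases i with
  | zero => exact h
  | succ i => rw [jet_congr_ae h]

/-- The exponential weight, normalized at the point `a`. -/
noncomputable def expWeight (lam a s : ℝ) : ℝ := Real.exp (-(lam * (s - a)))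

theorem expWeight_pos (lam a s : ℝ) : 0 < expWeight lam a s := Real.exp_pos _

theorem continuous_expWeight (lam a : ℝ) : Continuous (expWeight lam a) := by
  unfold expWeight; fun_prop

theorem expWeight_le_one {lam a s : ℝ} (hl : 0 ≤ lam) (hs : a ≤ s) : expWeight lam a s ≤ 1 := by
  unfold expWeight
  rw [Real.exp_le_one_iff, neg_nonpos]
  exact mul_nonneg hl (sub_nonneg.2 hs)

theorem expWeight_sub (lam a s d : ℝ) :
    expWeight lam a s = Real.exp (-(lam * d)) * expWeight lam a (s - d) := by
  unfold expWeight
  rw [← Real.exp_add]; congr 1; ring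

theorem integral_exp_le {lam t : ℝ} (hl : 0 < lam) :
    ∫ s in a..t, Real.exp (-(lam * (t - s))) ≤ 1 / lam := by
  have h : ∫ s in a..t, Real.exp (-(lam * (t - s))) =
      1 / lam - Real.exp (-(lam * (t - a))) / lam := by
    have hd : ∀ s ∈ uIcc a t, HasDerivAt (fun s => Real.exp (-(lam * (t - s))) / lam)
        (Real.exp (-(lam * (t - s)))) s := by
      intro s _
      have h1 : HasDerivAt (fun s => -(lam * (t - s))) lam s := by
        have := (((hasDerivAt_id s).const_sub t).const_mul lam).neg
        simpa using! this
      have := h1.exp.div_const lam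
      rwa [mul_div_assoc, div_self hl.ne', mul_one] at this
    rw [intervalIntegral.integral_eq_sub_of_hasDerivAt hd]
    · simp
    · exact (Continuous.intervalIntegrable (by fun_prop) _ _)
  rw [h]
  have := (Real.exp_pos (-(lam * (t - a)))).le
  have : 0 ≤ Real.exp (-(lam * (t - a))) / lam := by positivity
  linarith

/-- A weighted supremum bound for a primitive by a weighted supremum bound of the function. -/
theorem expWeight_mul_norm_integral_le {lam t B : ℝ} (hl : 1 ≤ lam) (hat : a ≤ t) (hB : 0 ≤ B)
    {f : ℝ → ℂ} (hf : IntervalIntegrable f volume a t)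
    (h : ∀ s ∈ Icc a t, expWeight lam a s * ‖f s‖ ≤ B) :
    expWeight lam a t * ‖∫ s in a..t, f s‖ ≤ B := by
  have hlp : 0 < lam := by linarith
  have e : ∀ s, expWeight lam a t = Real.exp (-(lam * (t - s))) * expWeight lam a s := by
    intro s; unfold expWeight; rw [← Real.exp_add]; congr 1; ring
  calc expWeight lam a t * ‖∫ s in a..t, f s‖
      ≤ expWeight lam a t * ∫ s in a..t, ‖f s‖ := by
        gcongr
        · exact (expWeight_pos _ _ _).le
        · exact intervalIntegral.norm_integral_le_integral_norm hat
    _ = ∫ s in a..t, expWeight lam a t * ‖f s‖ := by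
        rw [intervalIntegral.integral_const_mul]
    _ ≤ ∫ s in a..t, Real.exp (-(lam * (t - s))) * B := by
        refine intervalIntegral.integral_mono_on hat (hf.norm.const_mul _)
          (Continuous.intervalIntegrable (by fun_prop) _ _) fun s hs => ?_
        rw [e s, mul_assoc]
        exact mul_le_mul_of_nonneg_left (h s hs) (Real.exp_pos _).le
    _ = (∫ s in a..t, Real.exp (-(lam * (t - s)))) * B := by
        rw [intervalIntegral.integral_mul_const]
    _ ≤ (1 / lam) * B := by gcongr; exact integral_exp_le hlp
    _ ≤ 1 * B := by
        gcongr
        rw [div_le_one hlp]; exact hl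
    _ = B := one_mul B

/-- A weighted supremum bound for a primitive by a weighted `L²` bound of the function. -/
theorem expWeight_mul_norm_integral_le_L2 {lam t N : ℝ} (hl : 0 < lam) (hat : a ≤ t) (hN : 0 ≤ N)
    {f : ℝ → ℂ} (hf : MemLp f 2 (volume.restrict (Ioc a t)))
    (h : ∫ s in a..t, (expWeight lam a s * ‖f s‖) ^ 2 ≤ N ^ 2) :
    expWeight lam a t * ‖∫ s in a..t, f s‖ ≤ N / Real.sqrt lam := by
  have e : ∀ s, expWeight lam a t = Real.exp (-(lam * (t - s))) * expWeight lam a s := by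
    intro s; unfold expWeight; rw [← Real.exp_add]; congr 1; ring
  have hfi : IntervalIntegrable f volume a t := by
    rw [intervalIntegrable_iff_integrableOn_Ioc_of_le hat]
    exact hf.integrable one_le_two
  have hwc := continuous_expWeight lam a
  have hw1 : MemLp (fun s => Real.exp (-(lam * (t - s)))) 2 (volume.restrict (Ioc a t)) := by
    refine (memLp_two_iff_integrable_sq (by fun_prop)).2 ?_
    exact (Continuous.integrableOn_Icc (by fun_prop)).mono_set Ioc_subset_Icc_self
  have hw2 : MemLp (fun s => expWeight lam a s * ‖f s‖) 2 (volume.restrict (Ioc a t)) := by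
    refine hf.norm.of_le ?_ ?_
    · exact hwc.aestronglyMeasurable.mul hf.norm.1
    · filter_upwards [ae_restrict_mem measurableSet_Ioc] with s hs
      rw [norm_mul, Real.norm_of_nonneg (expWeight_pos _ _ _).le]
      exact mul_le_of_le_one_left (norm_nonneg _) (expWeight_le_one hl.le hs.1.le)
  -- Cauchy–Schwarz against the kernel `exp(-λ(t - s))`, whose square has integral at most `1 / λ`.
  -- The resulting factor `λ^(-1/2)` is the smallness used for the lower-order terms.
  have hCS := integral_mul_le_Lp_mul_Lq_of_nonneg (μ := volume.restrict (Ioc a t))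
    (p := 2) (q := 2) Real.HolderConjugate.two_two
    (f := fun s => Real.exp (-(lam * (t - s)))) (g := fun s => expWeight lam a s * ‖f s‖)
    (ae_of_all _ fun s => (Real.exp_pos _).le)
    (ae_of_all _ fun s => mul_nonneg (expWeight_pos _ _ _).le (norm_nonneg _))
    (by simpa using hw1) (by simpa using hw2)
  have h1 : ∫ s in Ioc a t, Real.exp (-(lam * (t - s))) ^ (2 : ℝ) ≤ 1 / lam := by
    have := integral_exp_le (a := a) (t := t) (lam := 2 * lam) (by positivity)
    rw [intervalIntegral.integral_of_le hat] at this
    have e2 : ∀ s, Real.exp (-(lam * (t - s))) ^ (2 : ℝ) = Real.exp (-(2 * lam * (t - s))) := by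
      intro s; rw [← Real.exp_mul]; congr 1; ring
    simp only [e2]
    refine this.trans ?_
    gcongr; linarith
  have h2 : ∫ s in Ioc a t, (expWeight lam a s * ‖f s‖) ^ (2 : ℝ) ≤ N ^ 2 := by
    rw [intervalIntegral.integral_of_le hat] at h
    simpa using h
  have i1 : 0 ≤ ∫ s in Ioc a t, Real.exp (-(lam * (t - s))) ^ (2 : ℝ) :=
    setIntegral_nonneg measurableSet_Ioc fun s _ => Real.rpow_nonneg (Real.exp_pos _).le _
  have i2 : 0 ≤ ∫ s in Ioc a t, (expWeight lam a s * ‖f s‖) ^ (2 : ℝ) :=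
    setIntegral_nonneg measurableSet_Ioc fun s _ =>
      Real.rpow_nonneg (mul_nonneg (expWeight_pos _ _ _).le (norm_nonneg _)) _
  calc expWeight lam a t * ‖∫ s in a..t, f s‖
      ≤ expWeight lam a t * ∫ s in a..t, ‖f s‖ := by
        gcongr
        · exact (expWeight_pos _ _ _).le
        · exact intervalIntegral.norm_integral_le_integral_norm hat
    _ = ∫ s in Ioc a t, Real.exp (-(lam * (t - s))) * (expWeight lam a s * ‖f s‖) := by
        rw [intervalIntegral.integral_of_le hat, ← integral_const_mul]
        congr 1; funext s; rw [e s]; ring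
    _ ≤ _ := hCS
    _ ≤ (1 / lam) ^ (1 / 2 : ℝ) * (N ^ 2) ^ (1 / 2 : ℝ) := by
        exact mul_le_mul (Real.rpow_le_rpow i1 h1 (by norm_num))
          (Real.rpow_le_rpow i2 h2 (by norm_num)) (Real.rpow_nonneg i2 _)
          (Real.rpow_nonneg (by positivity) _)
    _ = N / Real.sqrt lam := by
        rw [← Real.sqrt_eq_rpow, ← Real.sqrt_eq_rpow, Real.sqrt_sq hN, Real.sqrt_div zero_le_one,
          Real.sqrt_one]
        ring

/-- The first primitive is estimated from `L²` to sup and gains `λ^(-1/2)`; every further primitive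
preserves the weighted sup bound because `λ ≥ 1`. Each constant of integration adds at most `X`, so
for zero initial values the whole bound is small for large `λ`. -/
theorem expWeight_mul_norm_jet_le {lam t N X : ℝ} (hl : 1 ≤ lam) (hN : 0 ≤ N) (hX : 0 ≤ X)
    (hV : LocallyIntegrable V) (hV2 : MemLp V 2 (volume.restrict (Ioc a t)))
    (h : ∫ s in a..t, (expWeight lam a s * ‖V s‖) ^ 2 ≤ N ^ 2) (i : ℕ)
    (hx : ∀ k ≤ i, ‖x k‖ ≤ X) :
    ∀ s ∈ Icc a t, expWeight lam a s * ‖jet a x V (i + 1) s‖ ≤ (i + 1) * X + N / Real.sqrt lam := by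
  have hlp : 0 < lam := by linarith
  have key : ∀ s ∈ Icc a t, ∀ k, ‖x k‖ ≤ X → ∀ B,
      expWeight lam a s * ‖∫ r in a..s, jet a x V k r‖ ≤ B →
      expWeight lam a s * ‖jet a x V (k + 1) s‖ ≤ X + B := by
    intro s hs k hk B hB
    rw [jet_succ]
    calc _ ≤ expWeight lam a s * (‖x k‖ + ‖∫ r in a..s, jet a x V k r‖) := by
          gcongr
          · exact (expWeight_pos _ _ _).le
          · exact norm_add_le _ _
      _ = expWeight lam a s * ‖x k‖ + expWeight lam a s * ‖∫ r in a..s, jet a x V k r‖ := by ring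
      _ ≤ X + B := by
          gcongr
          exact (mul_le_of_le_one_left (norm_nonneg _) (expWeight_le_one hlp.le hs.1)).trans hk
  induction i with
  | zero =>
    intro s hs
    have hsub : Ioc a s ⊆ Ioc a t := Ioc_subset_Ioc_right hs.2
    have hV2' := hV2.mono_measure (Measure.restrict_mono hsub le_rfl)
    have := key s hs 0 (hx 0 le_rfl) _
      (expWeight_mul_norm_integral_le_L2 hlp hs.1 hN hV2' (le_trans ?_ h))
    · simpa using this
    · have hw2 : MemLp (fun s => expWeight lam a s * ‖V s‖) 2 (volume.restrict (Ioc a t)) := by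
        refine hV2.norm.of_le ?_ ?_
        · exact (continuous_expWeight lam a).aestronglyMeasurable.mul hV2.norm.1
        · filter_upwards [ae_restrict_mem measurableSet_Ioc] with s hs
          rw [norm_mul, Real.norm_of_nonneg (expWeight_pos _ _ _).le]
          exact mul_le_of_le_one_left (norm_nonneg _) (expWeight_le_one hlp.le hs.1.le)
      rw [intervalIntegral.integral_of_le hs.1, intervalIntegral.integral_of_le (hs.1.trans hs.2)]
      exact setIntegral_mono_set hw2.integrable_sq (ae_of_all _ fun s => sq_nonneg _)
        hsub.eventuallyLE
  | succ i ih =>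
    intro s hs
    have ih' := ih (fun k hk => hx k (by omega))
    have := key s hs (i + 1) (hx _ le_rfl) _
      (expWeight_mul_norm_integral_le (B := (i + 1) * X + N / Real.sqrt lam) hl hs.1 (by positivity)
        (jet_intervalIntegrable hV a x _ a s) fun r hr => ih' r ⟨hr.1, hr.2.trans hs.2⟩)
    push_cast
    linarith

end JetBounds

/-! ### `L²` norms on sets, and the delay expression along a path -/

section L2Norm

variable {S S' : Set ℝ} {f g : ℝ → ℂ}

/-- The norm of `f` in `L₂(S)`. -/
noncomputable def l2Norm (S : Set ℝ) (f : ℝ → ℂ) : ℝ :=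
  (eLpNorm f 2 (volume.restrict S)).toReal

theorem l2Norm_nonneg (S : Set ℝ) (f : ℝ → ℂ) : 0 ≤ l2Norm S f := ENNReal.toReal_nonneg

theorem MeasureTheory.MemLp.sq_toReal_eLpNorm {μ : Measure ℝ} (hf : MemLp f 2 μ) :
    (eLpNorm f 2 μ).toReal ^ 2 = ∫ s, ‖f s‖ ^ 2 ∂μ := by
  rw [hf.eLpNorm_eq_integral_rpow_norm two_ne_zero ENNReal.ofNat_ne_top]
  have : 0 ≤ ∫ s, ‖f s‖ ^ 2 ∂μ := integral_nonneg fun s => by positivity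
  simp only [ENNReal.toReal_ofNat, Real.rpow_ofNat]
  rw [ENNReal.toReal_ofReal (by positivity), show (2 : ℝ)⁻¹ = 1 / 2 by norm_num,
    ← Real.sqrt_eq_rpow, Real.sq_sqrt this]

theorem l2Norm_sq (hf : MemLp f 2 (volume.restrict S)) :
    l2Norm S f ^ 2 = ∫ s in S, ‖f s‖ ^ 2 := hf.sq_toReal_eLpNorm

theorem l2Norm_add_le (hf : MemLp f 2 (volume.restrict S)) (hg : MemLp g 2 (volume.restrict S)) :
    l2Norm S (fun s => f s + g s) ≤ l2Norm S f + l2Norm S g := by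
  unfold l2Norm
  rw [← ENNReal.toReal_add hf.2.ne hg.2.ne]
  exact ENNReal.toReal_mono (ENNReal.add_ne_top.2 ⟨hf.2.ne, hg.2.ne⟩)
    (eLpNorm_add_le hf.1 hg.1 one_le_two)

theorem l2Norm_sum_le {ι : Type*} {s : Finset ι} {F : ι → ℝ → ℂ}
    (hF : ∀ i ∈ s, MemLp (F i) 2 (volume.restrict S)) :
    l2Norm S (fun t => ∑ i ∈ s, F i t) ≤ ∑ i ∈ s, l2Norm S (F i) := by
  unfold l2Norm
  rw [← ENNReal.toReal_sum fun i hi => (hF i hi).2.ne,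
    show (fun t => ∑ i ∈ s, F i t) = ∑ i ∈ s, F i from by funext t; simp]
  exact ENNReal.toReal_mono (ENNReal.sum_ne_top.2 fun i hi => (hF i hi).2.ne)
    (eLpNorm_sum_le (fun i hi => (hF i hi).1) one_le_two)

theorem l2Norm_le_mul {c : ℝ} (hc : 0 ≤ c) (hg : MemLp g 2 (volume.restrict S))
    (h : ∀ᵐ s ∂volume.restrict S, ‖f s‖ ≤ c * ‖g s‖) : l2Norm S f ≤ c * l2Norm S g := by
  unfold l2Norm
  rw [← ENNReal.toReal_ofReal_mul _ _ hc]
  exact ENNReal.toReal_mono (ENNReal.mul_ne_top ENNReal.ofReal_ne_top hg.2.ne)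
    (eLpNorm_le_mul_eLpNorm_of_ae_le_mul h 2)

theorem l2Norm_mono_set (hSS : S ⊆ S') (hf : MemLp f 2 (volume.restrict S')) :
    l2Norm S f ≤ l2Norm S' f :=
  ENNReal.toReal_mono hf.2.ne (eLpNorm_mono_measure _ (Measure.restrict_mono hSS le_rfl))

theorem l2Norm_congr (h : f =ᵐ[volume.restrict S] g) : l2Norm S f = l2Norm S g := by
  unfold l2Norm; rw [eLpNorm_congr_ae h]

theorem MeasureTheory.MemLp.ae_norm_le_of_top {κ : ℝ → ℂ} {μ : Measure ℝ} (h : MemLp κ ⊤ μ) :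
    ∀ᵐ s ∂μ, ‖κ s‖ ≤ (eLpNorm κ ⊤ μ).toReal := by
  have hfin := h.2.ne
  filter_upwards [ae_le_eLpNormEssSup (f := κ) (μ := μ)] with s hs
  rw [eLpNorm_exponent_top] at hfin ⊢
  have := ENNReal.toReal_mono hfin hs
  simpa using this

end L2Norm

/-! ### Weighted estimates for the differential expression along a path -/

section PathEll

variable {a e lam σ τ X : ℝ} {x : ℕ → ℂ} {V κ : ℝ → ℂ} {S : Set ℝ} {n : ℕ}

theorem memLp_expWeight_smul (hl : 0 ≤ lam) {f : ℝ → ℂ} (hS : MeasurableSet S)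
    (hSa : S ⊆ Ici a) (hf : MemLp f 2 (volume.restrict S)) :
    MemLp (fun s => expWeight lam a s • f s) 2 (volume.restrict S) := by
  refine hf.of_le ((continuous_expWeight lam a).aestronglyMeasurable.smul hf.1) ?_
  filter_upwards [ae_restrict_mem hS] with s hs
  rw [norm_smul, Real.norm_of_nonneg (expWeight_pos _ _ _).le]
  exact mul_le_of_le_one_left (norm_nonneg _) (expWeight_le_one hl (hSa hs))

theorem norm_weighted_jet_succ_le (hl : 1 ≤ lam) (hX : 0 ≤ X) (hV : MemLp V 2 volume) (i : ℕ)
    (hx : ∀ k ≤ i, ‖x k‖ ≤ X) {t : ℝ} (ht : a ≤ t) :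
    expWeight lam a t * ‖jet a x V (i + 1) t‖ ≤
      (i + 1) * X + l2Norm (Ioi a) (fun s => expWeight lam a s • V s) / Real.sqrt lam := by
  refine expWeight_mul_norm_jet_le hl (l2Norm_nonneg _ _) hX (hV.locallyIntegrable one_le_two)
    (hV.mono_measure Measure.restrict_le_self) ?_ i hx t ⟨ht, le_rfl⟩
  have hm := memLp_expWeight_smul (lam := lam) (a := a) (by linarith) measurableSet_Ioi
    Ioi_subset_Ici_self (hV.mono_measure (Measure.restrict_le_self (s := Ioi a)))
  rw [l2Norm_sq hm, intervalIntegral.integral_of_le ht]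
  have e : ∀ s, ‖expWeight lam a s • V s‖ ^ 2 = (expWeight lam a s * ‖V s‖) ^ 2 := fun s => by
    rw [norm_smul, Real.norm_of_nonneg (expWeight_pos _ _ _).le]
  simp only [← e]
  exact setIntegral_mono_set (hm.integrable_norm_pow two_ne_zero)
    (ae_of_all _ fun s => by positivity) (Ioc_subset_Ioi_self).eventuallyLE

/-- One term of the delay expression along a path. -/
noncomputable def delayTerm (κ : ℝ → ℂ) (e σ : ℝ) (f : ℝ → ℂ) (s : ℝ) : ℂ :=
  κ s * (Iio e).indicator f (s - σ)

theorem aestronglyMeasurable_delayTerm {f : ℝ → ℂ} (hf : AEStronglyMeasurable f)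
    (hκ : AEStronglyMeasurable κ (volume.restrict S)) :
    AEStronglyMeasurable (delayTerm κ e σ f) (volume.restrict S) := by
  refine hκ.mul ?_
  have h1 : AEStronglyMeasurable ((Iio e).indicator f) := hf.indicator measurableSet_Iio
  exact (h1.comp_measurePreserving (measurePreserving_sub_right volume σ)).mono_measure
    Measure.restrict_le_self

theorem norm_delayTerm_jet_succ_le (hl : 1 ≤ lam) (hσ : 0 ≤ σ) (hX : 0 ≤ X)
    (hV : MemLp V 2 volume) (i : ℕ) (hx : ∀ k ≤ i, ‖x k‖ ≤ X) {s : ℝ} (hs : a ≤ s - σ) :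
    ‖expWeight lam a s • delayTerm κ e σ (jet a x V (i + 1)) s‖ ≤
      ((i + 1) * X + l2Norm (Ioi a) (fun s => expWeight lam a s • V s) / Real.sqrt lam) *
        ‖κ s‖ := by
  have h := norm_weighted_jet_succ_le hl hX hV i hx hs
  have h0 := (expWeight_pos lam a (s - σ)).le
  rw [norm_smul, Real.norm_of_nonneg (expWeight_pos _ _ _).le, delayTerm, norm_mul]
  have h1 : expWeight lam a s ≤ expWeight lam a (s - σ) := by
    rw [expWeight_sub lam a s σ]
    refine mul_le_of_le_one_left h0 (Real.exp_le_one_iff.2 ?_)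
    nlinarith
  calc expWeight lam a s * (‖κ s‖ * ‖(Iio e).indicator (jet a x V (i + 1)) (s - σ)‖)
      ≤ expWeight lam a (s - σ) * (‖κ s‖ * ‖jet a x V (i + 1) (s - σ)‖) := by
        gcongr
        exact norm_indicator_le_norm_self _ _
    _ = (expWeight lam a (s - σ) * ‖jet a x V (i + 1) (s - σ)‖) * ‖κ s‖ := by ring
    _ ≤ _ := by gcongr

theorem memLp_delayTerm_jet_succ_weighted (hl : 1 ≤ lam) (hσ : 0 ≤ σ)
    (hS : MeasurableSet S) (hSa : ∀ s ∈ S, a ≤ s - σ) (hκ : MemLp κ 2 (volume.restrict S))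
    (hX : 0 ≤ X) (hV : MemLp V 2 volume) (i : ℕ) (hx : ∀ k ≤ i, ‖x k‖ ≤ X) :
    MemLp (fun s => expWeight lam a s • delayTerm κ e σ (jet a x V (i + 1)) s) 2
      (volume.restrict S) ∧
    l2Norm S (fun s => expWeight lam a s • delayTerm κ e σ (jet a x V (i + 1)) s) ≤
      ((i + 1) * X + l2Norm (Ioi a) (fun s => expWeight lam a s • V s) / Real.sqrt lam) *
        l2Norm S κ := by
  have hb : ∀ᵐ s ∂volume.restrict S,
      ‖expWeight lam a s • delayTerm κ e σ (jet a x V (i + 1)) s‖ ≤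
      ((i + 1) * X + l2Norm (Ioi a) (fun s => expWeight lam a s • V s) / Real.sqrt lam) *
        ‖κ s‖ := by
    filter_upwards [ae_restrict_mem hS] with s hs
    exact norm_delayTerm_jet_succ_le hl hσ hX hV i hx (hSa s hs)
  refine ⟨hκ.of_le_mul ?_ hb, l2Norm_le_mul ?_ hκ hb⟩
  · exact (continuous_expWeight lam a).aestronglyMeasurable.smul (aestronglyMeasurable_delayTerm
      (continuous_jet_succ (hV.locallyIntegrable one_le_two) a x i).aestronglyMeasurable hκ.1)
  · have := l2Norm_nonneg (Ioi a) (fun s => expWeight lam a s • V s)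
    positivity

/-- Moving the weight from `s` to `s - σ` produces the factor `exp(-λσ)`. The delayed term is of
full order `n`, so a positive delay is the only source of its smallness. -/
theorem memLp_delayTerm_weighted (hl : 0 ≤ lam) (hSa : ∀ s ∈ S, a < s - σ) (hκ : MemLp κ ⊤ (volume.restrict S))
    (hV : MemLp V 2 volume) :
    MemLp (fun s => expWeight lam a s • delayTerm κ e σ V s) 2 (volume.restrict S) ∧
    l2Norm S (fun s => expWeight lam a s • delayTerm κ e σ V s) ≤
      ((eLpNorm κ ⊤ (volume.restrict S)).toReal * Real.exp (-(lam * σ))) *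
        l2Norm (Ioi a) (fun s => expWeight lam a s • V s) := by
  set g : ℝ → ℂ := fun s => expWeight lam a s • V s
  have hm : MemLp g 2 (volume.restrict (Ioi a)) := memLp_expWeight_smul hl measurableSet_Ioi
    Ioi_subset_Ici_self (hV.mono_measure Measure.restrict_le_self)
  have hmp := (measurePreserving_sub_right volume σ).restrict_preimage
    (measurableSet_Ioi (a := a))
  have hsub : S ⊆ (fun s => s - σ) ⁻¹' Ioi a := fun s hs => hSa s hs
  have hm' : MemLp (fun s => g (s - σ)) 2 (volume.restrict ((fun s => s - σ) ⁻¹' Ioi a)) :=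
    hm.comp_measurePreserving hmp
  have hmS := hm'.mono_measure (Measure.restrict_mono hsub le_rfl)
  have hnorm : l2Norm S (fun s => g (s - σ)) ≤ l2Norm (Ioi a) g := by
    refine (l2Norm_mono_set hsub hm').trans_eq ?_
    unfold l2Norm
    rw [← eLpNorm_comp_measurePreserving hm.1 hmp]; rfl
  have hb : ∀ᵐ s ∂volume.restrict S, ‖expWeight lam a s • delayTerm κ e σ V s‖ ≤
      ((eLpNorm κ ⊤ (volume.restrict S)).toReal * Real.exp (-(lam * σ))) * ‖g (s - σ)‖ := by
    filter_upwards [hκ.ae_norm_le_of_top] with s hs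
    rw [norm_smul, norm_smul, Real.norm_of_nonneg (expWeight_pos _ _ _).le,
      Real.norm_of_nonneg (expWeight_pos _ _ _).le, delayTerm, norm_mul, expWeight_sub lam a s σ]
    have h0 := (expWeight_pos lam a (s - σ)).le
    calc _ ≤ Real.exp (-(lam * σ)) * expWeight lam a (s - σ) *
          ((eLpNorm κ ⊤ (volume.restrict S)).toReal * ‖V (s - σ)‖) := by
          gcongr
          exact norm_indicator_le_norm_self _ _
      _ = _ := by ring
  have h0 : 0 ≤ (eLpNorm κ ⊤ (volume.restrict S)).toReal * Real.exp (-(lam * σ)) := by positivity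
  refine ⟨hmS.of_le_mul ?_ hb, (l2Norm_le_mul h0 hmS hb).trans
    (mul_le_mul_of_nonneg_left hnorm h0)⟩
  exact (continuous_expWeight lam a).aestronglyMeasurable.smul
    (aestronglyMeasurable_delayTerm hV.1 hκ.1)

/-- The coefficients are in `L₂(S)`, the one of order `0` is in `L_∞(S)`. -/
structure IsCoeff (n : ℕ) (κ : ℕ → ℝ → ℂ) (S : Set ℝ) : Prop where
  top : MemLp (κ 0) ⊤ (volume.restrict S)
  two : ∀ l < n, MemLp (κ (l + 1)) 2 (volume.restrict S)

theorem IsCoeff.mono {κ : ℕ → ℝ → ℂ} {S' : Set ℝ} (h : IsCoeff n κ S) (hS : S' ⊆ S) :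
    IsCoeff n κ S' :=
  ⟨h.top.mono_measure (Measure.restrict_mono hS le_rfl),
    fun l hl => (h.two l hl).mono_measure (Measure.restrict_mono hS le_rfl)⟩

/-- The part of the delay expression with the delay `σ`. -/
noncomputable def delaySum (n : ℕ) (κ : ℕ → ℝ → ℂ) (e σ : ℝ) (F : ℕ → ℝ → ℂ) (s : ℝ) : ℂ :=
  ∑ l ∈ Finset.range n, delayTerm (κ (l + 1)) e σ (F (l + 1)) s

/-- The lower-order coefficients are only in `L²`, so the lower derivatives are measured in the
weighted sup norm. For `X = 0` a factor `λ^(-1/2)` remains. -/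
theorem delaySum_jet_weighted {κ : ℕ → ℝ → ℂ} (hl : 1 ≤ lam) (hσ : 0 ≤ σ)
    (hS : MeasurableSet S) (hSa : ∀ s ∈ S, a < s - σ) (hκ : IsCoeff n κ S)
    (hX : 0 ≤ X) (hV : MemLp V 2 volume) (hx : ∀ k < n, ‖x k‖ ≤ X) :
    MemLp (fun s => expWeight lam a s • delaySum n κ e σ (jet a x V) s) 2
      (volume.restrict S) ∧
    l2Norm S (fun s => expWeight lam a s • delaySum n κ e σ (jet a x V) s) ≤
      (n * X + l2Norm (Ioi a) (fun s => expWeight lam a s • V s) / Real.sqrt lam) *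
        ∑ l ∈ Finset.range n, l2Norm S (κ (l + 1)) := by
  have hN := l2Norm_nonneg (Ioi a) (fun s => expWeight lam a s • V s)
  have H := fun l (hln : l < n) => memLp_delayTerm_jet_succ_weighted (e := e) hl hσ hS
    (fun s hs => (hSa s hs).le) (hκ.two l hln) hX hV l (fun k hk => hx k (by omega))
  have e1 : (fun s => expWeight lam a s • delaySum n κ e σ (jet a x V) s) = fun s =>
      ∑ l ∈ Finset.range n,
        expWeight lam a s • delayTerm (κ (l + 1)) e σ (jet a x V (l + 1)) s := by
    funext s; rw [delaySum, Finset.smul_sum]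
  rw [e1]
  refine ⟨memLp_finsetSum _ fun l hl => (H l (Finset.mem_range.1 hl)).1,
    (l2Norm_sum_le fun l hl => (H l (Finset.mem_range.1 hl)).1).trans ?_⟩
  rw [Finset.mul_sum]
  refine Finset.sum_le_sum fun l hl => (H l (Finset.mem_range.1 hl)).2.trans ?_
  have : (l : ℝ) + 1 ≤ n := by exact_mod_cast Finset.mem_range.1 hl
  have := l2Norm_nonneg S (κ (l + 1))
  gcongr

/-- The differential expression with delay along a path, in terms of the chain of derivatives cut
off at the point `e`. -/
noncomputable def pathEll (n : ℕ) (τ : ℝ) (β γ : ℕ → ℝ → ℂ) (e : ℝ) (F : ℕ → ℝ → ℂ) (s : ℝ) : ℂ :=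
  ∑ l ∈ Finset.range (n + 1), (delayTerm (β l) e 0 (F l) s + delayTerm (γ l) e τ (F l) s)

theorem pathEll_eq (n : ℕ) (τ : ℝ) (β γ : ℕ → ℝ → ℂ) (e : ℝ) (F : ℕ → ℝ → ℂ) (s : ℝ) :
    pathEll n τ β γ e F s = delayTerm (β 0) e 0 (F 0) s + (delaySum n β e 0 F s +
      (delayTerm (γ 0) e τ (F 0) s + delaySum n γ e τ F s)) := by
  rw [pathEll, Finset.sum_range_succ', Finset.sum_add_distrib, delaySum, delaySum]; ring

theorem pathEll_jet_weighted {β γ : ℕ → ℝ → ℂ} (hτ : 0 ≤ τ) (hS : MeasurableSet S)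
    (hSa : ∀ s ∈ S, a < s - τ) (hβ : IsCoeff n β S) (hγ : IsCoeff n γ S) :
    ∃ K, 0 ≤ K ∧ ∀ (x : ℕ → ℂ) (V : ℝ → ℂ) (X : ℝ), 0 ≤ X → MemLp V 2 volume →
      (∀ k < n, ‖x k‖ ≤ X) →
      MemLp (fun s => expWeight 1 a s • pathEll n τ β γ e (jet a x V) s) 2
        (volume.restrict S) ∧
      l2Norm S (fun s => expWeight 1 a s • pathEll n τ β γ e (jet a x V) s) ≤
        K * (X + l2Norm (Ioi a) (fun s => expWeight 1 a s • V s)) := by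
  have hSa0 : ∀ s ∈ S, a < s - 0 := fun s hs => by linarith [hSa s hs]
  set B := ∑ l ∈ Finset.range n, l2Norm S (β (l + 1))
  set C := ∑ l ∈ Finset.range n, l2Norm S (γ (l + 1))
  have hB : 0 ≤ B := Finset.sum_nonneg fun _ _ => l2Norm_nonneg _ _
  have hC : 0 ≤ C := Finset.sum_nonneg fun _ _ => l2Norm_nonneg _ _
  set b0 := (eLpNorm (β 0) ⊤ (volume.restrict S)).toReal * Real.exp (-(1 * 0))
  set c0 := (eLpNorm (γ 0) ⊤ (volume.restrict S)).toReal * Real.exp (-(1 * τ))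
  have hb0 : 0 ≤ b0 := by positivity
  have hc0 : 0 ≤ c0 := by positivity
  -- The factor `n + 1` dominates both coefficients in `n * X + N`. No smallness is needed for
  -- boundedness, so the weight has rate `1`.
  refine ⟨b0 + c0 + (n + 1) * (B + C), by positivity, fun x V X hX hV hx => ?_⟩
  have h1 := memLp_delayTerm_weighted (e := e) (lam := 1) zero_le_one hSa0 hβ.top hV
  have h2 := delaySum_jet_weighted (e := e) (lam := 1) le_rfl le_rfl hS hSa0 hβ hX hV hx
  have h3 := memLp_delayTerm_weighted (e := e) (lam := 1) zero_le_one hSa hγ.top hV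
  have h4 := delaySum_jet_weighted (e := e) (lam := 1) le_rfl hτ hS hSa hγ hX hV hx
  have hN := l2Norm_nonneg (Ioi a) (fun s => expWeight 1 a s • V s)
  rw [Real.sqrt_one, div_one] at h2 h4
  set N := l2Norm (Ioi a) (fun s => expWeight 1 a s • V s)
  set g1 := fun s => expWeight 1 a s • delayTerm (β 0) e 0 V s
  set g2 := fun s => expWeight 1 a s • delaySum n β e 0 (jet a x V) s
  set g3 := fun s => expWeight 1 a s • delayTerm (γ 0) e τ V s
  set g4 := fun s => expWeight 1 a s • delaySum n γ e τ (jet a x V) s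
  have hf : (fun s => expWeight 1 a s • pathEll n τ β γ e (jet a x V) s) =
      fun s => g1 s + (g2 s + (g3 s + g4 s)) := by
    funext s; simp only [g1, g2, g3, g4, pathEll_eq, smul_add, jet_zero]
  rw [hf]
  refine ⟨h1.1.add (h2.1.add (h3.1.add h4.1)), ?_⟩
  have e1 : l2Norm S (fun s => g1 s + (g2 s + (g3 s + g4 s))) ≤
      l2Norm S g1 + l2Norm S (fun s => g2 s + (g3 s + g4 s)) :=
    l2Norm_add_le h1.1 (h2.1.add (h3.1.add h4.1))
  have e2 : l2Norm S (fun s => g2 s + (g3 s + g4 s)) ≤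
      l2Norm S g2 + l2Norm S (fun s => g3 s + g4 s) := l2Norm_add_le h2.1 (h3.1.add h4.1)
  have e3 : l2Norm S (fun s => g3 s + g4 s) ≤ l2Norm S g3 + l2Norm S g4 :=
    l2Norm_add_le h3.1 h4.1
  have d1 : l2Norm S g1 ≤ b0 * N := h1.2
  have d2 : l2Norm S g2 ≤ (n * X + N) * B := h2.2
  have d3 : l2Norm S g3 ≤ c0 * N := h3.2
  have d4 : l2Norm S g4 ≤ (n * X + N) * C := h4.2
  clear_value b0 c0 B C N g1 g2 g3 g4
  have hn : (0 : ℝ) ≤ n := Nat.cast_nonneg n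
  have p1 : 0 ≤ (b0 + c0) * X := by positivity
  have p2 : 0 ≤ (B + C) * X := by positivity
  have p3 : 0 ≤ n * ((B + C) * N) := by positivity
  have e5 : (b0 + c0 + (n + 1) * (B + C)) * (X + N) =
      b0 * N + ((n * X + N) * B + (c0 * N + (n * X + N) * C)) + (b0 + c0) * X + (B + C) * X +
        n * ((B + C) * N) := by ring
  rw [e5]
  linarith

theorem delayTerm_zero_inv {f : ℝ → ℂ} {s : ℝ} (hs : s < e) (hκ : κ s ≠ 0) :
    f s = (1 / κ s) * delayTerm κ e 0 f s := by
  rw [delayTerm, sub_zero, indicator_of_mem (show s ∈ Iio e from hs)]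
  field_simp

/-- The highest derivative is controlled by the delay expression, up to a part which is small in
norms with rapidly decaying weights. -/
theorem pathEll_jet_coercive {β γ : ℕ → ℝ → ℂ} (hτ : 0 < τ) (hS : MeasurableSet S)
    (hSe : S ⊆ Iio e)
    (hSa : ∀ s ∈ S, a < s - τ) (hβ : IsCoeff n β S) (hγ : IsCoeff n γ S)
    (hβ0 : ∀ᵐ s ∂volume.restrict S, β 0 s ≠ 0)
    (hβi : MemLp (fun s => 1 / β 0 s) ⊤ (volume.restrict S)) :
    ∃ K, 0 ≤ K ∧ ∀ ε > 0, ∀ᶠ lam : ℝ in Filter.atTop, ∀ V : ℝ → ℂ, MemLp V 2 volume →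
      l2Norm S (fun s => expWeight lam a s • V s) ≤
        K * l2Norm S (fun s => expWeight lam a s • pathEll n τ β γ e (jet a 0 V) s) +
        ε * l2Norm (Ioi a) (fun s => expWeight lam a s • V s) := by
  have hSa0 : ∀ s ∈ S, a < s - 0 := fun s hs => by linarith [hSa s hs]
  set B := ∑ l ∈ Finset.range n, l2Norm S (β (l + 1))
  set C := ∑ l ∈ Finset.range n, l2Norm S (γ (l + 1))
  have hB : 0 ≤ B := Finset.sum_nonneg fun _ _ => l2Norm_nonneg _ _
  have hC : 0 ≤ C := Finset.sum_nonneg fun _ _ => l2Norm_nonneg _ _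
  set c0 := (eLpNorm (γ 0) ⊤ (volume.restrict S)).toReal
  set K := (eLpNorm (fun s => 1 / β 0 s) ⊤ (volume.restrict S)).toReal
  have hc0 : 0 ≤ c0 := ENNReal.toReal_nonneg
  have hK : 0 ≤ K := ENNReal.toReal_nonneg
  refine ⟨K, hK, fun ε hε => ?_⟩
  -- This is `K` times the total coefficient of all terms other than the undelayed one of order `n`.
  have hlim : Filter.Tendsto (fun lam : ℝ => K * ((B + C) / Real.sqrt lam +
      c0 * Real.exp (-(lam * τ)))) Filter.atTop (nhds (K * (0 + c0 * 0))) := by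
    refine Filter.Tendsto.const_mul _ (Filter.Tendsto.add ?_ (Filter.Tendsto.const_mul _ ?_))
    · exact Filter.Tendsto.div_atTop tendsto_const_nhds Real.tendsto_sqrt_atTop
    · exact Real.tendsto_exp_neg_atTop_nhds_zero.comp
        (Filter.tendsto_id.atTop_mul_const hτ)
  have hev := hlim.eventually (gt_mem_nhds (show K * (0 + c0 * 0) < ε by simpa using hε))
  filter_upwards [hev, Filter.eventually_ge_atTop 1] with lam hlam hl1 V hV
  have hl0 : 0 ≤ lam := by linarith
  have h1 := memLp_delayTerm_weighted (e := e) hl0 hSa0 hβ.top hV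
  have h2 := delaySum_jet_weighted (e := e) (x := 0) (X := 0) hl1 le_rfl hS hSa0 hβ le_rfl hV
    (by simp)
  have h3 := memLp_delayTerm_weighted (e := e) hl0 hSa hγ.top hV
  have h4 := delaySum_jet_weighted (e := e) (x := 0) (X := 0) hl1 hτ.le hS hSa hγ le_rfl hV
    (by simp)
  set g1 := fun s => expWeight lam a s • delayTerm (β 0) e 0 V s
  set g2 := fun s => expWeight lam a s • delaySum n β e 0 (jet a 0 V) s
  set g3 := fun s => expWeight lam a s • delayTerm (γ 0) e τ V s
  set g4 := fun s => expWeight lam a s • delaySum n γ e τ (jet a 0 V) s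
  set f := fun s => expWeight lam a s • pathEll n τ β γ e (jet a 0 V) s
  have hf : f = fun s => g1 s + (g2 s + (g3 s + g4 s)) := by
    funext s; simp only [f, g1, g2, g3, g4, pathEll_eq, smul_add, jet_zero]
  have hfm : MemLp f 2 (volume.restrict S) := hf ▸ h1.1.add (h2.1.add (h3.1.add h4.1))
  -- The expression is solved for its undelayed term of order `n`.
  have hg1 : g1 = fun s => f s + ((-g2) s + ((-g3) s + (-g4) s)) := by
    funext s; rw [hf]; simp only [Pi.neg_apply]; ring
  have hneg : ∀ g : ℝ → ℂ, l2Norm S (-g) = l2Norm S g := fun g => by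
    unfold l2Norm; rw [eLpNorm_neg]
  have hN := l2Norm_nonneg (Ioi a) (fun s => expWeight lam a s • V s)
  set N := l2Norm (Ioi a) (fun s => expWeight lam a s • V s)
  have hg1n : l2Norm S g1 ≤ l2Norm S f + ((B + C) / Real.sqrt lam +
      c0 * Real.exp (-(lam * τ))) * N := by
    have e1 : l2Norm S g1 ≤ l2Norm S f + (l2Norm S g2 + (l2Norm S g3 + l2Norm S g4)) := by
      rw [← hneg g2, ← hneg g3, ← hneg g4]
      conv_lhs => rw [hg1]
      refine (l2Norm_add_le hfm (h2.1.neg.add (h3.1.neg.add h4.1.neg))).trans ?_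
      gcongr
      refine (l2Norm_add_le h2.1.neg (h3.1.neg.add h4.1.neg)).trans ?_
      gcongr
      exact l2Norm_add_le h3.1.neg h4.1.neg
    have e2 := h2.2
    have e4 := h4.2
    rw [mul_zero, zero_add] at e2 e4
    refine e1.trans ?_
    have : ((B + C) / Real.sqrt lam + c0 * Real.exp (-(lam * τ))) * N =
        N / Real.sqrt lam * B + (c0 * Real.exp (-(lam * τ)) * N + N / Real.sqrt lam * C) := by
      ring
    rw [this]
    exact add_le_add le_rfl (add_le_add e2 (add_le_add h3.2 e4))
  -- Dividing by the leading coefficient costs its inverse bound `K`, independent of `λ` and `ε`. On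
  -- `S` the cut-off at `e` has no effect.
  have hVg : l2Norm S (fun s => expWeight lam a s • V s) ≤ K * l2Norm S g1 := by
    refine l2Norm_le_mul hK h1.1 ?_
    filter_upwards [hβ0, hβi.ae_norm_le_of_top, ae_restrict_mem hS] with s h0 hi hs
    simp only [g1, norm_smul]
    conv_lhs => rw [delayTerm_zero_inv (f := V) (hSe hs) h0, norm_mul]
    have := norm_nonneg (delayTerm (β 0) e 0 V s)
    have := norm_nonneg (expWeight lam a s)
    calc _ ≤ ‖expWeight lam a s‖ * (K * ‖delayTerm (β 0) e 0 V s‖) := by gcongr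
      _ = _ := by ring
  calc _ ≤ K * l2Norm S g1 := hVg
    _ ≤ K * (l2Norm S f + ((B + C) / Real.sqrt lam + c0 * Real.exp (-(lam * τ))) * N) := by
        gcongr
    _ = K * l2Norm S f + K * ((B + C) / Real.sqrt lam + c0 * Real.exp (-(lam * τ))) * N := by ring
    _ ≤ _ := by gcongr

end PathEll

/-! ### An abstract least squares problem with finitely many constraints -/

section LeastSquares

variable {X H Z F : Type*} [NormedAddCommGroup X] [NormedSpace ℂ X]
  [NormedAddCommGroup H] [NormedSpace ℂ H]
  [NormedAddCommGroup Z] [InnerProductSpace ℂ Z]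
  [NormedAddCommGroup F] [NormedSpace ℂ F]

/-- The difference of two solutions lies in `ker E`, so its image under `A` is orthogonal to itself;
coercivity concludes. -/
theorem leastSquares_unique {A : H →L[ℂ] Z} {K : ℝ} (hA : ∀ u, ‖u‖ ≤ K * ‖A u‖)
    {E : H →L[ℂ] F} {z : Z} {f : F} {u v : H}
    (hu : E u + f = 0) (hu' : ∀ w, E w = 0 → inner ℂ (z + A u) (A w) = 0)
    (hv : E v + f = 0) (hv' : ∀ w, E w = 0 → inner ℂ (z + A v) (A w) = 0) : u = v := by
  have h0 : E (u - v) = 0 := by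
    rw [map_sub, sub_eq_zero]; exact add_right_cancel (hu.trans hv.symm)
  have h1 : inner ℂ (A (u - v)) (A (u - v)) = 0 := by
    have e : A (u - v) = (z + A u) - (z + A v) := by rw [map_sub]; abel
    conv_lhs => rw [show inner ℂ (A (u - v)) (A (u - v)) =
      inner ℂ ((z + A u) - (z + A v)) (A (u - v)) by rw [← e]]
    rw [inner_sub_left, hu' _ h0, hv' _ h0, sub_zero]
  have h2 := hA (u - v)
  rw [inner_self_eq_zero.1 h1, norm_zero, mul_zero] at h2
  exact sub_eq_zero.1 (norm_le_zero_iff.1 h2)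

/-- A linear right inverse of `E`, continuous because `F` is finite-dimensional, reduces the
constraint to a homogeneous one. The lower bound on `A` makes `A (ker E)` complete, so the remaining
residual can be projected onto it. -/
theorem leastSquares_exists [CompleteSpace H] [FiniteDimensional ℂ F]
    (A : H →L[ℂ] Z) {K : ℝ} (hK : 0 ≤ K) (hA : ∀ u, ‖u‖ ≤ K * ‖A u‖)
    (E : H →L[ℂ] F) (hE : Function.Surjective E) (a : X →L[ℂ] Z) (e : X →L[ℂ] F) :
    ∃ C, 0 ≤ C ∧ ∀ ξ, ∃ u, E u + e ξ = 0 ∧ (∀ w, E w = 0 → inner ℂ (a ξ + A u) (A w) = 0) ∧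
      ‖u‖ ≤ C * ‖ξ‖ := by
  obtain ⟨R, hR⟩ := LinearMap.exists_rightInverse_of_surjective (E : H →ₗ[ℂ] F)
    (LinearMap.range_eq_top.2 hE)
  have hR' : ∀ f, E (R f) = f := fun f => LinearMap.congr_fun hR f
  set Rc : F →L[ℂ] H := LinearMap.toContinuousLinearMap R
  have hRc : ∀ f, Rc f = R f := fun f => rfl
  set Q : Submodule ℂ Z := (LinearMap.ker (E : H →ₗ[ℂ] F)).map (A : H →ₗ[ℂ] Z)
  have hanti : AntilipschitzWith ⟨K, hK⟩ A :=
    A.antilipschitz_of_bound fun u => hA u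
  have hclosed : IsClosed (LinearMap.ker (E : H →ₗ[ℂ] F) : Set H) := E.isClosed_ker
  have hQc : IsComplete (Q : Set Z) := by
    have h1 : IsComplete (LinearMap.ker (E : H →ₗ[ℂ] F) : Set H) := hclosed.isComplete
    have := (hanti.isUniformInducing A.uniformContinuous).isComplete_iff.2 h1
    simpa [Q] using this
  have : CompleteSpace Q := hQc.completeSpace_coe
  set z0 : X →L[ℂ] Z := a - (A.comp Rc).comp e
  refine ⟨‖Rc‖ * ‖e‖ + K * ‖z0‖, by positivity, fun ξ => ?_⟩
  obtain ⟨w0, hw0, hw0'⟩ : ∃ w, E w = 0 ∧ A w = Q.starProjection (z0 ξ) := by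
    have := Q.starProjection_apply_mem (z0 ξ)
    obtain ⟨w, hw, h⟩ := Submodule.mem_map.1 this
    exact ⟨w, hw, h⟩
  -- The first term satisfies the constraint; subtracting `w0 ∈ ker E` removes the component of the
  -- residual in `A (ker E)`.
  refine ⟨-Rc (e ξ) - w0, ?_, fun w hw => ?_, ?_⟩
  · rw [map_sub, map_neg, hRc, hR', hw0]; simp
  · have e1 : a ξ + A (-Rc (e ξ) - w0) = z0 ξ - Q.starProjection (z0 ξ) := by
      rw [map_sub, map_neg, hw0']
      simp only [z0, sub_apply, ContinuousLinearMap.comp_apply]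
      abel
    rw [e1]
    exact Submodule.inner_left_of_mem_orthogonal (Submodule.mem_map_of_mem (f := (A : H →ₗ[ℂ] Z))
      (show w ∈ LinearMap.ker (E : H →ₗ[ℂ] F) from hw)) (Q.sub_starProjection_mem_orthogonal _)
  · have h1 : ‖w0‖ ≤ K * (‖z0‖ * ‖ξ‖) := by
      refine (hA w0).trans (mul_le_mul_of_nonneg_left ?_ hK)
      rw [hw0']
      exact (Q.norm_starProjection_apply_le _).trans (z0.le_opNorm ξ)
    have h2 : ‖Rc (e ξ)‖ ≤ ‖Rc‖ * (‖e‖ * ‖ξ‖) :=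
      (Rc.le_opNorm _).trans (mul_le_mul_of_nonneg_left (e.le_opNorm ξ) (norm_nonneg _))
    calc ‖-Rc (e ξ) - w0‖ ≤ ‖Rc (e ξ)‖ + ‖w0‖ := by
          simpa using norm_sub_le (-Rc (e ξ)) w0
      _ ≤ ‖Rc‖ * (‖e‖ * ‖ξ‖) + K * (‖z0‖ * ‖ξ‖) := add_le_add h2 h1
      _ = _ := by ring

end LeastSquares

/-! ### Linearity of the delay expression -/

section PathEllLinear

variable {n : ℕ} {τ e : ℝ} {β γ : ℕ → ℝ → ℂ}

theorem pathEll_add (F G : ℕ → ℝ → ℂ) :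
    pathEll n τ β γ e (F + G) = pathEll n τ β γ e F + pathEll n τ β γ e G := by
  funext s
  simp only [pathEll, delayTerm, Pi.add_apply, indicator_add', ← Finset.sum_add_distrib]
  refine Finset.sum_congr rfl fun l _ => ?_
  ring

theorem pathEll_smul (c : ℂ) (F : ℕ → ℝ → ℂ) :
    pathEll n τ β γ e (c • F) = c • pathEll n τ β γ e F := by
  funext s
  simp only [pathEll, delayTerm, Pi.smul_apply, smul_eq_mul, Finset.mul_sum]
  refine Finset.sum_congr rfl fun l _ => ?_
  have : ∀ t, (Iio e).indicator (c • F l) t = c * (Iio e).indicator (F l) t := by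
    intro t; simp [indicator]
  rw [this, this]; ring

theorem pathEll_congr_ae {F G : ℕ → ℝ → ℂ} (h : ∀ l ≤ n, F l =ᵐ[volume] G l) :
    pathEll n τ β γ e F =ᵐ[volume] pathEll n τ β γ e G := by
  have h0 : ∀ σ : ℝ, ∀ᵐ s : ℝ, ∀ l ≤ n, F l (s - σ) = G l (s - σ) := by
    intro σ
    rw [ae_all_iff]; intro l; rw [ae_all_iff]; intro hl
    exact (measurePreserving_sub_right volume σ).quasiMeasurePreserving.ae (h l hl)
  filter_upwards [h0 0, h0 τ] with s h1 h2
  simp only [pathEll, delayTerm]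
  refine Finset.sum_congr rfl fun l hl => ?_
  have hl' : l ≤ n := Nat.lt_succ_iff.1 (Finset.mem_range.1 hl)
  have hi : ∀ t, F l t = G l t → (Iio e).indicator (F l) t = (Iio e).indicator (G l) t :=
    fun t ht => by by_cases h : t ∈ Iio e <;> simp only [h, indicator_of_mem, ht,
      not_false_eq_true, indicator_of_notMem]
  rw [hi _ (h1 l hl'), hi _ (h2 l hl')]

end PathEllLinear

/-! ### Functions on intervals: translation and extension by zero -/

section Translation

theorem measurePreserving_sub_Ioo (o p q : ℝ) :
    MeasurePreserving (fun s => s - o) (volume.restrict (Ioo (o + p) (o + q)))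
      (volume.restrict (Ioo p q)) := by
  have h := (measurePreserving_sub_right volume o).restrict_preimage
    (measurableSet_Ioo (a := p) (b := q))
  have e : (fun s : ℝ => s - o) ⁻¹' Ioo p q = Ioo (o + p) (o + q) := by
    ext s; simp only [mem_preimage, mem_Ioo]; constructor <;> rintro ⟨h1, h2⟩ <;>
      constructor <;> linarith
  rwa [e] at h

theorem measurePreserving_add_Ioo (o p q : ℝ) :
    MeasurePreserving (fun s => s + o) (volume.restrict (Ioo p q))
      (volume.restrict (Ioo (o + p) (o + q))) := by
  have h := (measurePreserving_add_right volume o).restrict_preimage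
    (measurableSet_Ioo (a := o + p) (b := o + q))
  have e : (fun s : ℝ => s + o) ⁻¹' Ioo (o + p) (o + q) = Ioo p q := by
    ext s; simp only [mem_preimage, mem_Ioo]; constructor <;> rintro ⟨h1, h2⟩ <;>
      constructor <;> linarith
  rwa [e] at h

end Translation

section ZeroExt

/-- Complex-valued square integrable functions on the set `S`. -/
noncomputable abbrev L2 (S : Set ℝ) := Lp ℂ 2 (volume.restrict S)

/-- Extension by zero of a square integrable function on `S`. -/
noncomputable def zeroExt {S : Set ℝ} (u : L2 S) : ℝ → ℂ := S.indicator u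

variable {S : Set ℝ}

theorem memLp_zeroExt (hS : MeasurableSet S) (u : L2 S) : MemLp (zeroExt u) 2 volume :=
  (memLp_indicator_iff_restrict hS).2 (Lp.memLp u)

theorem zeroExt_add (hS : MeasurableSet S) (u v : L2 S) :
    zeroExt (u + v) =ᵐ[volume] zeroExt u + zeroExt v := by
  unfold zeroExt
  rw [← indicator_add']
  exact (ae_eq_restrict_iff_indicator_ae_eq hS).1 (Lp.coeFn_add u v)

theorem zeroExt_smul (hS : MeasurableSet S) (c : ℂ) (u : L2 S) :
    zeroExt (c • u) =ᵐ[volume] c • zeroExt u := by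
  unfold zeroExt
  have e : c • S.indicator u = S.indicator (c • ⇑u) := by
    funext s; by_cases hs : s ∈ S <;> simp [hs]
  rw [e]
  exact (ae_eq_restrict_iff_indicator_ae_eq hS).1 (Lp.coeFn_smul c u)

theorem zeroExt_of_notMem {u : L2 S} {s : ℝ} (hs : s ∉ S) : zeroExt u s = 0 :=
  indicator_of_notMem hs _

theorem zeroExt_of_mem {u : L2 S} {s : ℝ} (hs : s ∈ S) : zeroExt u s = u s :=
  indicator_of_mem hs _

theorem zeroExt_toLp (hS : MeasurableSet S) {f : ℝ → ℂ} (hf : MemLp f 2 (volume.restrict S)) :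
    zeroExt (hf.toLp f) =ᵐ[volume] S.indicator f :=
  (ae_eq_restrict_iff_indicator_ae_eq hS).1 hf.coeFn_toLp

theorem l2Norm_coe (u : L2 S) : l2Norm S u = ‖u‖ := (Lp.norm_def u).symm

theorem l2Norm_smul_zeroExt_le (hS : MeasurableSet S) {S' : Set ℝ} (w : ℝ → ℝ) (u : L2 S)
    (hw : MemLp (fun s => w s • u s) 2 (volume.restrict S)) :
    l2Norm S' (fun s => w s • zeroExt u s) ≤ l2Norm S (fun s => w s • u s) := by
  have e : (fun s => w s • zeroExt u s) = S.indicator (fun s => w s • u s) := by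
    funext s
    by_cases hs : s ∈ S
    · rw [zeroExt_of_mem hs, indicator_of_mem hs]
    · rw [zeroExt_of_notMem hs, indicator_of_notMem hs, smul_zero]
  rw [e]
  unfold l2Norm
  rw [← eLpNorm_indicator_eq_eLpNorm_restrict hS]
  refine ENNReal.toReal_mono ?_ (eLpNorm_mono_measure _ Measure.restrict_le_self)
  rw [eLpNorm_indicator_eq_eLpNorm_restrict hS]
  exact hw.2.ne

theorem l2Norm_expWeight_le {a lam : ℝ} (hl : 0 ≤ lam) (hS : MeasurableSet S) (hSa : S ⊆ Ici a)
    {f : ℝ → ℂ} (hf : MemLp f 2 (volume.restrict S)) :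
    l2Norm S (fun s => expWeight lam a s • f s) ≤ l2Norm S f := by
  have := l2Norm_le_mul (S := S) (f := fun s => expWeight lam a s • f s) zero_le_one hf (by
    filter_upwards [ae_restrict_mem hS] with s hs
    rw [norm_smul, Real.norm_of_nonneg (expWeight_pos _ _ _).le]
    gcongr
    exact expWeight_le_one hl (hSa hs))
  rwa [one_mul] at this

/-- On a set bounded above by `M` the weight is at least `exp(-λ(M - a))`. Once `λ` is fixed,
weighted bounds thus become unweighted ones. -/
theorem of_expWeight_smul {a M lam : ℝ} (hl : 0 ≤ lam) (hS : MeasurableSet S) (hSM : S ⊆ Iic M)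
    {f : ℝ → ℂ} (hf : MemLp (fun s => expWeight lam a s • f s) 2 (volume.restrict S)) :
    MemLp f 2 (volume.restrict S) ∧ l2Norm S f ≤
      Real.exp (lam * (M - a)) * l2Norm S (fun s => expWeight lam a s • f s) := by
  have e : f = fun s => Real.exp (lam * (s - a)) • (expWeight lam a s • f s) := by
    funext s
    rw [smul_smul, expWeight, ← Real.exp_add, add_neg_cancel, Real.exp_zero, one_smul]
  have hb : ∀ᵐ s ∂volume.restrict S, ‖f s‖ ≤
      Real.exp (lam * (M - a)) * ‖expWeight lam a s • f s‖ := by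
    filter_upwards [ae_restrict_mem hS] with s hs
    conv_lhs => rw [e]
    rw [norm_smul, Real.norm_of_nonneg (Real.exp_pos _).le]
    have : s ≤ M := hSM hs
    gcongr
  refine ⟨hf.of_le_mul ?_ hb, l2Norm_le_mul (Real.exp_pos _).le hf hb⟩
  rw [e]
  exact (by fun_prop : Continuous fun s => Real.exp (lam * (s - a))).aestronglyMeasurable.smul hf.1

end ZeroExt

/-! ### The boundary value problem in path coordinates -/

/-- The data of the boundary value problem on the star graph. -/
structure StarProblem (r n : ℕ) where
  τ : ℝ
  T : Fin (r + 1) → ℝ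
  b : Fin (r + 1) → ℕ → ℝ → ℂ
  c : Fin (r + 1) → ℕ → ℝ → ℂ
  hn : 1 ≤ n
  hτ : 0 < τ
  hT : ∀ j, τ < T j
  hbn : ∀ j, MemLp (b j n) ⊤ (volume.restrict (Ioo 0 (T j)))
  hbn_ne : ∀ j, ∀ᵐ t ∂volume.restrict (Ioo 0 (T j)), b j n t ≠ 0
  hbn_inv : ∀ j, MemLp (fun t => 1 / b j n t) ⊤ (volume.restrict (Ioo 0 (T j)))
  hcn : ∀ j, MemLp (c j n) ⊤ (volume.restrict (Ioo 0 (T j)))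
  hb : ∀ j, ∀ k < n, MemLp (b j k) 2 (volume.restrict (Ioo 0 (T j)))
  hc : ∀ j, ∀ k < n, MemLp (c j k) 2 (volume.restrict (Ioo 0 (T j)))

/-- Extension by zero of a vector to a sequence. -/
def finExt {n : ℕ} (x : Fin n → ℂ) (i : ℕ) : ℂ := if h : i < n then x ⟨i, h⟩ else 0

theorem finExt_add {n : ℕ} (x y : Fin n → ℂ) : finExt (x + y) = finExt x + finExt y := by
  funext i
  by_cases h : i < n <;> simp [finExt, h]

theorem finExt_smul {n : ℕ} (c : ℂ) (x : Fin n → ℂ) : finExt (c • x) = c • finExt x := by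
  funext i
  by_cases h : i < n <;> simp [finExt, h]

theorem finExt_zero {n : ℕ} : finExt (0 : Fin n → ℂ) = 0 := by
  funext i
  simp [finExt]

theorem norm_finExt_le {n : ℕ} (x : Fin n → ℂ) (i : ℕ) : ‖finExt x i‖ ≤ ‖x‖ := by
  by_cases h : i < n
  · simpa [finExt, h] using norm_le_pi_norm x ⟨i, h⟩
  · simp [finExt, h]

namespace StarProblem

variable {r n : ℕ} (P : StarProblem r n)

/-- The path time at which the edge `j` begins. -/
def off (j : Fin (r + 1)) : ℝ := if j = 0 then 0 else P.T 0

/-- The path time up to which the equation on the edge `j` is posed. -/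
def tip (j : Fin (r + 1)) : ℝ := P.off j + eqEnd P.τ P.T j

/-- The edge `j` in path time. -/
def edge (j : Fin (r + 1)) : Set ℝ := Ioo (P.off j) (P.off j + P.T j)

/-- The part of the edge `j`, in path time, on which the equation is posed. -/
def act (j : Fin (r + 1)) : Set ℝ := Ioo (P.off j) (P.tip j)

/-- The coefficients `b` in path time, indexed by the codegree. -/
def β (j : Fin (r + 1)) (l : ℕ) (s : ℝ) : ℂ := P.b j (n - l) (s - P.off j)

/-- The coefficients `c` in path time, indexed by the codegree. -/
def γ (j : Fin (r + 1)) (l : ℕ) (s : ℝ) : ℂ := P.c j (n - l) (s - P.off j)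

@[simp] theorem off_zero : P.off 0 = 0 := by simp [off]

@[simp] theorem off_succ (ν : Fin r) : P.off ν.succ = P.T 0 := by simp [off, Fin.succ_ne_zero]

@[simp] theorem tip_zero : P.tip 0 = P.T 0 := by simp [tip, eqEnd]

@[simp] theorem tip_succ (ν : Fin r) : P.tip ν.succ = P.T 0 + (P.T ν.succ - P.τ) := by
  simp [tip, eqEnd, Fin.succ_ne_zero]

theorem T_pos (j : Fin (r + 1)) : 0 < P.T j := P.hτ.trans (P.hT j)

theorem off_nonneg (j : Fin (r + 1)) : 0 ≤ P.off j := by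
  have := P.T_pos 0
  unfold off; split_ifs <;> linarith

theorem tip_le (j : Fin (r + 1)) : P.tip j ≤ P.off j + P.T j := by
  have := P.hτ
  unfold tip eqEnd
  split_ifs with h
  · rw [h]
  · linarith

theorem off_lt_tip (j : Fin (r + 1)) : P.off j < P.tip j := by
  have := P.hT j
  have := P.T_pos j
  unfold tip eqEnd
  split_ifs with h
  · subst h; linarith
  · linarith

theorem act_subset (j : Fin (r + 1)) : P.act j ⊆ P.edge j := Ioo_subset_Ioo_right (P.tip_le j)

theorem measurableSet_edge (j : Fin (r + 1)) : MeasurableSet (P.edge j) := measurableSet_Ioo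

theorem measurableSet_act (j : Fin (r + 1)) : MeasurableSet (P.act j) := measurableSet_Ioo

theorem measurePreserving_edge (j : Fin (r + 1)) :
    MeasurePreserving (fun s => s - P.off j) (volume.restrict (P.edge j))
      (volume.restrict (Ioo 0 (P.T j))) := by
  have := measurePreserving_sub_Ioo (P.off j) 0 (P.T j)
  rwa [add_zero] at this

theorem isCoeff_β (j : Fin (r + 1)) : IsCoeff n (P.β j) (P.edge j) where
  top := (P.hbn j).comp_measurePreserving (P.measurePreserving_edge j)
  two l hl := (P.hb j (n - (l + 1)) (by omega)).comp_measurePreserving (P.measurePreserving_edge j)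

theorem isCoeff_γ (j : Fin (r + 1)) : IsCoeff n (P.γ j) (P.edge j) where
  top := (P.hcn j).comp_measurePreserving (P.measurePreserving_edge j)
  two l hl := (P.hc j (n - (l + 1)) (by omega)).comp_measurePreserving (P.measurePreserving_edge j)

theorem β_inv (j : Fin (r + 1)) :
    MemLp (fun s => 1 / P.β j 0 s) ⊤ (volume.restrict (P.edge j)) :=
  (P.hbn_inv j).comp_measurePreserving (P.measurePreserving_edge j)

theorem β_ne (j : Fin (r + 1)) : ∀ᵐ s ∂volume.restrict (P.edge j), P.β j 0 s ≠ 0 :=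
  (P.measurePreserving_edge j).quasiMeasurePreserving.ae (P.hbn_ne j)

theorem edge_gt {j : Fin (r + 1)} {s : ℝ} (hs : s ∈ P.edge j) : -P.τ < s - P.τ := by
  have := P.off_nonneg j
  linarith [hs.1]

/-! ### Spaces of data, the operators `A` and `E`, and coercivity -/

/-- The prehistories: the derivatives of orders `n - 1, …, 0` at `-τ` and the derivative of
order `n`. -/
abbrev Pre := (Fin n → ℂ) × L2 (Ioo (-P.τ) 0)

/-- The derivatives of order `n` on the edges. -/
abbrev Ctl := (j : Fin (r + 1)) → L2 (P.act j)

/-- The derivative of order `n` along the path through the edge `j`. -/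
noncomputable def top (w : P.Pre × P.Ctl) (j : Fin (r + 1)) : ℝ → ℂ :=
  zeroExt w.1.2 + (zeroExt (w.2 0) + if j = 0 then 0 else zeroExt (w.2 j))

/-- The derivatives along the path through the edge `j`. -/
noncomputable def path (w : P.Pre × P.Ctl) (j : Fin (r + 1)) : ℕ → ℝ → ℂ :=
  jet (-P.τ) (finExt w.1.1) (P.top w j)

theorem memLp_top (w : P.Pre × P.Ctl) (j : Fin (r + 1)) : MemLp (P.top w j) 2 volume := by
  refine (memLp_zeroExt measurableSet_Ioo _).add
    ((memLp_zeroExt (P.measurableSet_act 0) _).add ?_)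
  split_ifs
  · exact MemLp.zero
  · exact memLp_zeroExt (P.measurableSet_act j) _

theorem locallyIntegrable_top (w : P.Pre × P.Ctl) (j : Fin (r + 1)) :
    LocallyIntegrable (P.top w j) := (P.memLp_top w j).locallyIntegrable one_le_two

theorem top_add (w w' : P.Pre × P.Ctl) (j : Fin (r + 1)) :
    P.top (w + w') j =ᵐ[volume] P.top w j + P.top w' j := by
  have h1 := zeroExt_add measurableSet_Ioo w.1.2 w'.1.2
  have h2 := zeroExt_add (P.measurableSet_act 0) (w.2 0) (w'.2 0)
  have h3 := zeroExt_add (P.measurableSet_act j) (w.2 j) (w'.2 j)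
  filter_upwards [h1, h2, h3] with s h1 h2 h3
  simp only [top, Prod.fst_add, Prod.snd_add, Pi.add_apply] at h1 h2 h3 ⊢
  rw [h1, h2]
  split_ifs
  · simp only [Pi.zero_apply]; ring
  · rw [h3]; ring

theorem top_smul (c : ℂ) (w : P.Pre × P.Ctl) (j : Fin (r + 1)) :
    P.top (c • w) j =ᵐ[volume] c • P.top w j := by
  have h1 := zeroExt_smul measurableSet_Ioo c w.1.2
  have h2 := zeroExt_smul (P.measurableSet_act 0) c (w.2 0)
  have h3 := zeroExt_smul (P.measurableSet_act j) c (w.2 j)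
  filter_upwards [h1, h2, h3] with s h1 h2 h3
  simp only [top, Prod.smul_fst, Prod.smul_snd, Pi.add_apply, Pi.smul_apply, smul_eq_mul]
    at h1 h2 h3 ⊢
  rw [h1, h2]
  split_ifs
  · simp only [Pi.zero_apply]; ring
  · rw [h3]; ring

theorem path_add_ae (w w' : P.Pre × P.Ctl) (j : Fin (r + 1)) (l : ℕ) :
    P.path (w + w') j l =ᵐ[volume] (P.path w j + P.path w' j) l := by
  have h := jet_ae_eq (a := -P.τ) (x := finExt (w + w').1.1) (P.top_add w w' j) l
  have e : finExt (w + w').1.1 = finExt w.1.1 + finExt w'.1.1 := finExt_add _ _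
  rw [e, jet_add (P.locallyIntegrable_top w j) (P.locallyIntegrable_top w' j)] at h
  unfold path
  rw [e]; exact h

theorem path_smul_ae (c : ℂ) (w : P.Pre × P.Ctl) (j : Fin (r + 1)) (l : ℕ) :
    P.path (c • w) j l =ᵐ[volume] (c • P.path w j) l := by
  have h := jet_ae_eq (a := -P.τ) (x := finExt (c • w).1.1) (P.top_smul c w j) l
  have e : finExt (c • w).1.1 = c • finExt w.1.1 := finExt_smul _ _
  rw [e, jet_smul] at h
  unfold path
  rw [e]; exact h

/-- From codegree one on, a path consists of integrals and does not see null sets, so additivity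
holds at every point. This makes terminal values well-defined linear functionals of the data. -/
theorem path_add (w w' : P.Pre × P.Ctl) (j : Fin (r + 1)) (l : ℕ) :
    P.path (w + w') j (l + 1) = P.path w j (l + 1) + P.path w' j (l + 1) := by
  have e : finExt (w + w').1.1 = finExt w.1.1 + finExt w'.1.1 := finExt_add _ _
  unfold path
  rw [e, jet_congr_ae (P.top_add w w' j),
    jet_add (P.locallyIntegrable_top w j) (P.locallyIntegrable_top w' j)]

theorem path_smul (c : ℂ) (w : P.Pre × P.Ctl) (j : Fin (r + 1)) (l : ℕ) :
    P.path (c • w) j (l + 1) = c • P.path w j (l + 1) := by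
  have e : finExt (c • w).1.1 = c • finExt w.1.1 := finExt_smul _ _
  unfold path
  rw [e, jet_congr_ae (P.top_smul c w j), jet_smul]

theorem l2Norm_weighted_top_le {lam : ℝ} (hl : 0 ≤ lam) (w : P.Pre × P.Ctl) (j : Fin (r + 1)) :
    l2Norm (Ioi (-P.τ)) (fun s => expWeight lam (-P.τ) s • P.top w j s) ≤
      ‖w.1.2‖ + (l2Norm (P.act 0) (fun s => expWeight lam (-P.τ) s • w.2 0 s) +
        l2Norm (P.act j) (fun s => expWeight lam (-P.τ) s • w.2 j s)) := by
  have hτ := P.hτ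
  have hsub : ∀ i, P.act i ⊆ Ici (-P.τ) := fun i s hs => by
    have := P.off_nonneg i
    exact mem_Ici.2 (by linarith [hs.1])
  have hsub' : Ioo (-P.τ) 0 ⊆ Ici (-P.τ) := fun s hs => hs.1.le
  have hm : ∀ {S : Set ℝ} (u : L2 S), MeasurableSet S → MemLp
      (fun s => expWeight lam (-P.τ) s • zeroExt u s) 2 (volume.restrict (Ioi (-P.τ))) :=
    fun u hS => memLp_expWeight_smul hl measurableSet_Ioi Ioi_subset_Ici_self
      ((memLp_zeroExt hS u).mono_measure Measure.restrict_le_self)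
  have b1 : l2Norm (Ioi (-P.τ)) (fun s => expWeight lam (-P.τ) s • zeroExt w.1.2 s) ≤ ‖w.1.2‖ := by
    refine (l2Norm_smul_zeroExt_le measurableSet_Ioo _ _
      (memLp_expWeight_smul hl measurableSet_Ioo hsub' (Lp.memLp _))).trans ?_
    rw [← l2Norm_coe]
    exact l2Norm_expWeight_le hl measurableSet_Ioo hsub' (Lp.memLp _)
  have b2 : ∀ i, l2Norm (Ioi (-P.τ)) (fun s => expWeight lam (-P.τ) s • zeroExt (w.2 i) s) ≤
      l2Norm (P.act i) (fun s => expWeight lam (-P.τ) s • w.2 i s) := fun i =>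
    l2Norm_smul_zeroExt_le (P.measurableSet_act i) _ _
      (memLp_expWeight_smul hl (P.measurableSet_act i) (hsub i) (Lp.memLp _))
  have m1 := hm w.1.2 measurableSet_Ioo
  have m2 := fun i => hm (w.2 i) (P.measurableSet_act i)
  by_cases hj : j = 0
  · have e : (fun s => expWeight lam (-P.τ) s • P.top w j s) = fun s =>
        expWeight lam (-P.τ) s • zeroExt w.1.2 s + expWeight lam (-P.τ) s • zeroExt (w.2 0) s := by
      funext s
      simp only [top, hj, if_true, add_zero, Pi.add_apply, smul_add]
    rw [e]
    refine (l2Norm_add_le m1 (m2 0)).trans (add_le_add b1 ((b2 0).trans ?_))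
    exact le_add_of_nonneg_right (l2Norm_nonneg _ _)
  · have e : (fun s => expWeight lam (-P.τ) s • P.top w j s) = fun s =>
        expWeight lam (-P.τ) s • zeroExt w.1.2 s + (expWeight lam (-P.τ) s • zeroExt (w.2 0) s +
          expWeight lam (-P.τ) s • zeroExt (w.2 j) s) := by
      funext s
      simp only [top, hj, if_false, Pi.add_apply, smul_add]
    rw [e]
    exact (l2Norm_add_le m1 ((m2 0).add (m2 j))).trans (add_le_add b1
      ((l2Norm_add_le (m2 0) (m2 j)).trans (add_le_add (b2 0) (b2 j))))

/-- The three pieces of the top derivative, over the prehistory, the entering edge and the edge `j`,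
contribute at most `‖w‖` each. -/
theorem l2Norm_weighted_top_le_norm (w : P.Pre × P.Ctl) (j : Fin (r + 1)) :
    l2Norm (Ioi (-P.τ)) (fun s => expWeight 1 (-P.τ) s • P.top w j s) ≤ 3 * ‖w‖ := by
  have hτ := P.hτ
  have hsub : ∀ i, P.act i ⊆ Ici (-P.τ) := fun i s hs => by
    have := P.off_nonneg i
    exact mem_Ici.2 (by linarith [hs.1])
  have hb : ∀ i, l2Norm (P.act i) (fun s => expWeight 1 (-P.τ) s • w.2 i s) ≤ ‖w‖ := fun i =>
    (l2Norm_expWeight_le zero_le_one (P.measurableSet_act i) (hsub i) (Lp.memLp _)).trans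
      ((l2Norm_coe _).trans_le ((norm_le_pi_norm w.2 i).trans (norm_snd_le w)))
  have h1 : ‖w.1.2‖ ≤ ‖w‖ := (norm_snd_le w.1).trans (norm_fst_le w)
  refine (P.l2Norm_weighted_top_le zero_le_one w j).trans ?_
  linarith [hb 0, hb j]

theorem exists_pathEll_bound (j : Fin (r + 1)) :
    ∃ K, 0 ≤ K ∧ ∀ w, MemLp (pathEll n P.τ (P.β j) (P.γ j) (P.tip j) (P.path w j)) 2
        (volume.restrict (P.edge j)) ∧
      l2Norm (P.edge j) (pathEll n P.τ (P.β j) (P.γ j) (P.tip j) (P.path w j)) ≤ K * ‖w‖ := by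
  obtain ⟨K, hK, H⟩ := pathEll_jet_weighted (a := -P.τ) (e := P.tip j) P.hτ.le
    (P.measurableSet_edge j) (fun s hs => P.edge_gt hs) (P.isCoeff_β j) (P.isCoeff_γ j)
  set M := P.off j + P.T j
  -- The exponential removes the weight up to the end of the edge, and `4 = 1 + 3` counts the
  -- initial values and the three pieces of the top derivative.
  refine ⟨Real.exp (1 * (M - -P.τ)) * (K * 4), by positivity, fun w => ?_⟩
  obtain ⟨h1, h2⟩ := H (finExt w.1.1) (P.top w j) ‖w.1.1‖ (norm_nonneg _) (P.memLp_top w j)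
    fun k _ => norm_finExt_le _ _
  obtain ⟨h3, h4⟩ := of_expWeight_smul (M := M) zero_le_one (P.measurableSet_edge j)
    (fun s hs => hs.2.le) h1
  refine ⟨h3, h4.trans ?_⟩
  rw [mul_assoc]
  refine mul_le_mul_of_nonneg_left (h2.trans ?_) (Real.exp_pos _).le
  rw [mul_assoc]
  refine mul_le_mul_of_nonneg_left ?_ hK
  have : ‖w.1.1‖ ≤ ‖w‖ := (norm_fst_le w.1).trans (norm_fst_le w)
  linarith [P.l2Norm_weighted_top_le_norm w j]

/-- The differential expression on the edge `j` as a function of the data. -/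
noncomputable def ellFun (w : P.Pre × P.Ctl) (j : Fin (r + 1)) : ℝ → ℂ :=
  pathEll n P.τ (P.β j) (P.γ j) (P.tip j) (P.path w j)

theorem memLp_ellFun (w : P.Pre × P.Ctl) (j : Fin (r + 1)) :
    MemLp (P.ellFun w j) 2 (volume.restrict (P.edge j)) :=
  ((P.exists_pathEll_bound j).choose_spec.2 w).1

/-- The differential expression on the edge `j` as a bounded operator. -/
noncomputable def ellOp (j : Fin (r + 1)) : P.Pre × P.Ctl →L[ℂ] L2 (P.edge j) :=
  LinearMap.mkContinuous
    { toFun := fun w => (P.memLp_ellFun w j).toLp _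
      map_add' := fun w w' => by
        rw [← MemLp.toLp_add]
        refine MemLp.toLp_congr _ _ ?_
        unfold ellFun
        rw [← pathEll_add]
        exact ae_restrict_of_ae (pathEll_congr_ae fun l _ => P.path_add_ae w w' j l)
      map_smul' := fun c w => by
        rw [RingHom.id_apply, ← MemLp.toLp_const_smul]
        refine MemLp.toLp_congr _ _ ?_
        unfold ellFun
        rw [← pathEll_smul]
        exact ae_restrict_of_ae (pathEll_congr_ae fun l _ => P.path_smul_ae c w j l) }
    (P.exists_pathEll_bound j).choose
    (fun w => by
      change ‖(P.memLp_ellFun w j).toLp _‖ ≤ _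
      rw [Lp.norm_toLp]
      exact ((P.exists_pathEll_bound j).choose_spec.2 w).2)

theorem ellOp_ae (w : P.Pre × P.Ctl) (j : Fin (r + 1)) :
    P.ellOp j w =ᵐ[volume.restrict (P.edge j)] P.ellFun w j := by
  change (P.memLp_ellFun w j).toLp _ =ᵐ[volume.restrict (P.edge j)] P.ellFun w j
  exact (P.memLp_ellFun w j).coeFn_toLp

/-- The Hilbert space of the values of the differential expressions on the edges. -/
abbrev Val := PiLp 2 fun j => L2 (P.edge j)

/-- The differential expressions on all edges as a bounded operator. -/
noncomputable def ellAll : P.Pre × P.Ctl →L[ℂ] P.Val :=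
  ((PiLp.continuousLinearEquiv 2 ℂ fun j => L2 (P.edge j)).symm :
    ((j : Fin (r + 1)) → L2 (P.edge j)) →L[ℂ] P.Val).comp (ContinuousLinearMap.pi P.ellOp)

@[simp] theorem ellAll_apply (w : P.Pre × P.Ctl) (j : Fin (r + 1)) :
    P.ellAll w j = P.ellOp j w := rfl

theorem norm_path_succ_le (w : P.Pre × P.Ctl) (j : Fin (r + 1)) (i : ℕ) {s : ℝ}
    (hs : -P.τ ≤ s) :
    ‖P.path w j (i + 1) s‖ ≤ Real.exp (1 * (s - -P.τ)) * (i + 1 + 3) * ‖w‖ := by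
  have h := norm_weighted_jet_succ_le (lam := 1) (a := -P.τ) (x := finExt w.1.1) le_rfl
    (norm_nonneg w.1.1) (P.memLp_top w j) i (fun k _ => norm_finExt_le _ _) hs
  rw [Real.sqrt_one, div_one] at h
  have h1 := P.l2Norm_weighted_top_le_norm w j
  have h2 : ‖w.1.1‖ ≤ ‖w‖ := (norm_fst_le w.1).trans (norm_fst_le w)
  have h3 : expWeight 1 (-P.τ) s * ‖P.path w j (i + 1) s‖ ≤ (i + 1 + 3) * ‖w‖ := by
    refine h.trans ?_
    have : (i + 1 : ℝ) * ‖w.1.1‖ ≤ (i + 1) * ‖w‖ := by gcongr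
    linarith
  calc ‖P.path w j (i + 1) s‖ = Real.exp (1 * (s - -P.τ)) *
        (expWeight 1 (-P.τ) s * ‖P.path w j (i + 1) s‖) := by
        rw [← mul_assoc, expWeight, ← Real.exp_add, add_neg_cancel, Real.exp_zero, one_mul]
    _ ≤ _ := by rw [mul_assoc]; gcongr

theorem neg_τ_le_tip (j : Fin (r + 1)) : -P.τ ≤ P.tip j := by
  linarith [P.off_nonneg j, P.off_lt_tip j, P.hτ]

/-- The derivative of codegree `i + 1` at the end of the path through the edge `j`. -/
noncomputable def endOp (j : Fin (r + 1)) (i : Fin n) : P.Pre × P.Ctl →L[ℂ] ℂ :=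
  LinearMap.mkContinuous
    { toFun := fun w => P.path w j (i + 1) (P.tip j)
      map_add' := fun w w' => by rw [path_add]; rfl
      map_smul' := fun c w => by rw [path_smul]; rfl }
    (Real.exp (1 * (P.tip j - -P.τ)) * (i + 1 + 3))
    (fun w => P.norm_path_succ_le w j i (P.neg_τ_le_tip j))

/-- The derivatives of orders below `n` at the ends of the outgoing edges. -/
noncomputable def endAll : P.Pre × P.Ctl →L[ℂ] (Fin r × Fin n → ℂ) :=
  ContinuousLinearMap.pi fun p => P.endOp p.1.succ p.2

@[simp] theorem endAll_apply (w : P.Pre × P.Ctl) (p : Fin r × Fin n) :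
    P.endAll w p = P.path w p.1.succ (p.2 + 1) (P.tip p.1.succ) := rfl

/-- The operator of the differential expressions for functions with zero prehistory. -/
noncomputable def A : P.Ctl →L[ℂ] P.Val := P.ellAll.comp (ContinuousLinearMap.inr ℂ P.Pre P.Ctl)

/-- The terminal values of functions with zero prehistory. -/
noncomputable def E : P.Ctl →L[ℂ] (Fin r × Fin n → ℂ) :=
  P.endAll.comp (ContinuousLinearMap.inr ℂ P.Pre P.Ctl)

theorem top_eq_of_mem_act (w : P.Pre × P.Ctl) {j : Fin (r + 1)} {s : ℝ} (hs : s ∈ P.act j) :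
    P.top w j s = w.2 j s := by
  have h0 : s ∉ Ioo (-P.τ) 0 := fun h => by linarith [h.2, hs.1, P.off_nonneg j]
  simp only [top, Pi.add_apply]
  rw [zeroExt_of_notMem h0, zero_add]
  by_cases hj : j = 0
  · subst hj; rw [if_pos rfl, Pi.zero_apply, add_zero, zeroExt_of_mem hs]
  · have h1 : s ∉ P.act 0 := fun h => by
      have h2 := h.2
      have h3 := hs.1
      rw [tip_zero] at h2
      simp only [off, hj, if_false] at h3
      linarith
    rw [if_neg hj, zeroExt_of_notMem h1, zero_add, zeroExt_of_mem hs]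

/-- The path estimate gives `nn j ≤ K j * ‖A u‖ + ε (nn 0 + nn j)` on every edge, because the path
through `j` involves only the controls on the entering edge and on `j`. Summation over the edges and
absorption of the `ε`-terms bound the weighted norms of the controls. -/
theorem A_coercive : ∃ K, 0 ≤ K ∧ ∀ u : P.Ctl, ‖u‖ ≤ K * ‖P.A u‖ := by
  have hact_gt : ∀ j, ∀ s ∈ P.act j, -P.τ < s - P.τ := fun j s hs => P.edge_gt (P.act_subset j hs)
  have hmono : ∀ j, volume.restrict (P.act j) ≤ volume.restrict (P.edge j) := fun j =>
    Measure.restrict_mono (P.act_subset j) le_rfl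
  have H := fun j => pathEll_jet_coercive (n := n) (a := -P.τ) (e := P.tip j) P.hτ
    (P.measurableSet_act j) (fun s hs => hs.2) (hact_gt j)
    ((P.isCoeff_β j).mono (P.act_subset j)) ((P.isCoeff_γ j).mono (P.act_subset j))
    (ae_mono (hmono j) (P.β_ne j)) ((P.β_inv j).mono_measure (hmono j))
  choose K hK HK using H
  -- Summed over the `r + 1` edges, the terms `nn 0 + nn j` amount to at most `(r + 2) * N`; this
  -- `ε` turns them into `N / 2`.
  set ε : ℝ := 1 / (2 * (r + 2)) with hε
  have hε0 : 0 < ε := by positivity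
  have hev := (Filter.eventually_all.2 fun j => HK j ε hε0).and (Filter.eventually_ge_atTop 1)
  obtain ⟨lam, hlam, hl1⟩ := hev.exists
  have hl0 : 0 ≤ lam := by linarith
  set M : ℝ := ∑ j, |P.tip j| with hM
  have hjM : ∀ j, P.tip j ≤ M := fun j => (le_abs_self _).trans
    (Finset.single_le_sum (f := fun j => |P.tip j|) (fun _ _ => abs_nonneg _) (Finset.mem_univ j))
  have hKs : 0 ≤ ∑ j, K j := Finset.sum_nonneg fun j _ => hK j
  refine ⟨Real.exp (lam * (M - -P.τ)) * (2 * ∑ j, K j), by positivity, fun u => ?_⟩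
  have hsub : ∀ i, P.act i ⊆ Ici (-P.τ) := fun i s hs => by
    have := P.off_nonneg i
    exact mem_Ici.2 (by linarith [hs.1, P.hτ])
  set nn : Fin (r + 1) → ℝ := fun j =>
    l2Norm (P.act j) (fun s => expWeight lam (-P.τ) s • u j s) with hnn
  have hnn0 : ∀ j, 0 ≤ nn j := fun j => l2Norm_nonneg _ _
  have hj : ∀ j, nn j ≤ K j * ‖P.A u‖ + ε * (nn 0 + nn j) := by
    intro j
    have h1 := hlam j (P.top (0, u) j) (P.memLp_top _ j)
    have e1 : nn j = l2Norm (P.act j) (fun s => expWeight lam (-P.τ) s • P.top (0, u) j s) := by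
      refine l2Norm_congr ?_
      filter_upwards [ae_restrict_mem (P.measurableSet_act j)] with s hs
      rw [P.top_eq_of_mem_act _ hs]
    have h2 := P.l2Norm_weighted_top_le hl0 (0, u) j
    have e2 : ‖((0 : P.Pre), u).1.2‖ = 0 := by simp
    rw [e2, zero_add] at h2
    have h3 : l2Norm (P.act j) (fun s => expWeight lam (-P.τ) s •
        pathEll n P.τ (P.β j) (P.γ j) (P.tip j) (jet (-P.τ) 0 (P.top (0, u) j)) s) ≤
        ‖P.A u‖ := by
      have e3 : pathEll n P.τ (P.β j) (P.γ j) (P.tip j) (jet (-P.τ) 0 (P.top (0, u) j)) =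
          P.ellFun (0, u) j := by
        unfold ellFun path
        rw [show ((0 : P.Pre), u).1.1 = 0 from rfl, finExt_zero]
      rw [e3]
      have hm := P.memLp_ellFun (0, u) j
      refine (l2Norm_expWeight_le hl0 (P.measurableSet_act j) (hsub j)
        (hm.mono_measure (hmono j))).trans ?_
      refine (l2Norm_mono_set (P.act_subset j) hm).trans ?_
      rw [← l2Norm_congr (P.ellOp_ae (0, u) j), l2Norm_coe]
      exact PiLp.norm_apply_le (P.A u) j
    rw [← e1] at h1
    refine h1.trans ?_
    exact add_le_add (mul_le_mul_of_nonneg_left h3 (hK j)) (mul_le_mul_of_nonneg_left h2 hε0.le)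
  set N := ∑ j, nn j with hN
  have hjN : ∀ j, nn j ≤ N := fun j =>
    Finset.single_le_sum (f := nn) (fun j _ => hnn0 j) (Finset.mem_univ j)
  have hNle : N ≤ 2 * (∑ j, K j) * ‖P.A u‖ := by
    have h1 : N ≤ ∑ j, (K j * ‖P.A u‖ + ε * (nn 0 + nn j)) :=
      Finset.sum_le_sum fun j _ => hj j
    rw [Finset.sum_add_distrib, ← Finset.sum_mul, ← Finset.mul_sum, Finset.sum_add_distrib,
      Finset.sum_const, Finset.card_univ, Fintype.card_fin, nsmul_eq_mul] at h1
    have h2 : ε * (((r + 1 : ℕ) : ℝ) * nn 0 + N) ≤ N / 2 := by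
      have : ((r + 1 : ℕ) : ℝ) * nn 0 + N ≤ (r + 2) * N := by
        push_cast
        have := mul_le_mul_of_nonneg_left (hjN 0) (show (0 : ℝ) ≤ r + 1 by positivity)
        linarith
      calc _ ≤ ε * ((r + 2) * N) := by gcongr
        _ = N / 2 := by rw [hε]; field_simp
    linarith
  refine (pi_norm_le_iff_of_nonneg (by positivity)).2 fun j => ?_
  have hw := memLp_expWeight_smul hl0 (P.measurableSet_act j) (hsub j) (Lp.memLp (u j))
  have h1 := (of_expWeight_smul (M := M) hl0 (P.measurableSet_act j)
    (fun s hs => hs.2.le.trans (hjM j)) hw).2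
  rw [l2Norm_coe] at h1
  rw [mul_assoc]
  exact h1.trans (mul_le_mul_of_nonneg_left ((hjN j).trans hNle) (Real.exp_pos _).le)

end StarProblem

/-! ### Chains of quasi-derivatives with given terminal values -/

section Chain

/-- The triangular system `(R l)' = G (l + 1) - R (l + 1)` is solved from `R n = 0` towards `R 0`,
with the value `m l` at `e`. The induction solves the shifted system and prepends one more integral.
-/
theorem exists_chain (n : ℕ) (G : ℕ → ℝ → ℂ) (hG : ∀ l < n, LocallyIntegrable (G (l + 1)))
    (m : ℕ → ℂ) (e : ℝ) :
    ∃ R : ℕ → ℝ → ℂ, R n = 0 ∧ (∀ l, Continuous (R l)) ∧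
      ∀ l < n, ∀ s, R l s = m l + ∫ t in e..s, (G (l + 1) t - R (l + 1) t) := by
  induction n generalizing G m with
  | zero => exact ⟨0, rfl, fun l => continuous_const, fun l hl => absurd hl (by omega)⟩
  | succ n ih =>
    obtain ⟨R', h0, hc, hR⟩ := ih (fun l => G (l + 1)) (fun l hl => hG (l + 1) (by omega))
      (fun l => m (l + 1))
    have hi : ∀ s t, IntervalIntegrable (fun t => G 1 t - R' 0 t) volume s t := fun s t =>
      ((hG 0 (by omega)).integrableOn_isCompact isCompact_uIcc).intervalIntegrable.sub
        ((hc 0).intervalIntegrable s t)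
    refine ⟨fun l => Nat.casesOn l (fun s => m 0 + ∫ t in e..s, (G 1 t - R' 0 t)) R', h0,
      fun l => ?_, fun l hl s => ?_⟩
    · cases l with
      | zero => exact continuous_const.add (intervalIntegral.continuous_primitive hi e)
      | succ l => exact hc l
    · cases l with
      | zero => rfl
      | succ l => exact hR l (by omega) s

variable {n : ℕ} {G R : ℕ → ℝ → ℂ} {m : ℕ → ℂ} {e : ℝ}

theorem chain_locallyIntegrable (hG : ∀ l < n, LocallyIntegrable (G (l + 1)))
    (hc : ∀ l, Continuous (R l)) {l : ℕ} (hl : l < n) :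
    LocallyIntegrable (fun t => G (l + 1) t - R (l + 1) t) :=
  (hG l hl).sub (hc (l + 1)).locallyIntegrable

theorem chain_absCont (hG : ∀ l < n, LocallyIntegrable (G (l + 1)))
    (hc : ∀ l, Continuous (R l))
    (hR : ∀ l < n, ∀ s, R l s = m l + ∫ t in e..s, (G (l + 1) t - R (l + 1) t))
    {l : ℕ} (hl : l < n) (p q : ℝ) : AbsolutelyContinuousOnInterval (R l) p q := by
  have hloc := chain_locallyIntegrable hG hc hl
  have h : ∀ p q, IntervalIntegrable (fun t => G (l + 1) t - R (l + 1) t) volume p q :=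
    fun p q => (hloc.integrableOn_isCompact isCompact_uIcc).intervalIntegrable
  refine ((h p q).absolutelyContinuousOnInterval_complex (left_mem_uIcc)).of_dist_le
    fun s _ t _ => ?_
  have e1 : ∀ s, R l s = (m l + ∫ t in e..p, (G (l + 1) t - R (l + 1) t)) +
      ∫ t in p..s, (G (l + 1) t - R (l + 1) t) := fun s => by
    rw [hR l hl s, add_assoc, intervalIntegral.integral_add_adjacent_intervals (h e p) (h p s)]
  rw [e1 s, e1 t, dist_add_left]

theorem chain_hasDerivAt (hG : ∀ l < n, LocallyIntegrable (G (l + 1)))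
    (hc : ∀ l, Continuous (R l))
    (hR : ∀ l < n, ∀ s, R l s = m l + ∫ t in e..s, (G (l + 1) t - R (l + 1) t))
    {l : ℕ} (hl : l < n) :
    ∀ᵐ s : ℝ, HasDerivAt (R l) (G (l + 1) s - R (l + 1) s) s := by
  filter_upwards [_root_.LocallyIntegrable.ae_hasDerivAt_integral (chain_locallyIntegrable hG hc hl)] with s hs
  exact ((hs e).const_add (m l)).congr_of_eventuallyEq (Filter.Eventually.of_forall (hR l hl))

/-- A chain without right-hand sides which begins with zero on an interval vanishes there. -/
theorem chain_eq_zero {p : ℝ} (hpe : p < e)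
    (hc : ∀ l, Continuous (R l))
    (hR : ∀ l < n, ∀ s, R l s = m l + ∫ t in e..s, (0 - R (l + 1) t))
    (h0 : ∀ s ∈ Icc p e, R 0 s = 0) : ∀ l < n, m l = 0 := by
  have key : ∀ l ≤ n, ∀ s ∈ Icc p e, R l s = 0 := by
    intro l
    induction l with
    | zero => exact fun _ => h0
    | succ l ih =>
      intro hl
      have ih' := ih (by omega)
      -- If `R l` vanishes on the interval, so does its derivative, which equals `-R (l + 1)`; the
      -- end points follow by continuity.
      have hopen : ∀ s ∈ Ioo p e, R (l + 1) s = 0 := by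
        intro s hs
        have h1 : HasDerivAt (R l) (0 - R (l + 1) s) s := by
          have hcont : Continuous fun t => 0 - R (l + 1) t := continuous_const.sub (hc (l + 1))
          have := (intervalIntegral.integral_hasDerivAt_right (hcont.intervalIntegrable e s)
            (hcont.stronglyMeasurableAtFilter _ _) hcont.continuousAt).const_add (m l)
          exact this.congr_of_eventuallyEq
            (Filter.Eventually.of_forall (hR l (by omega)))
        have h2 : HasDerivAt (R l) 0 s := by
          refine (hasDerivAt_const s (0 : ℂ)).congr_of_eventuallyEq ?_
          filter_upwards [Ioo_mem_nhds hs.1 hs.2] with t ht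
          exact ih' t (Ioo_subset_Icc_self ht)
        have := h1.unique h2
        simpa using this
      intro s hs
      have hcl : closure (Ioo p e) ⊆ {s | R (l + 1) s = 0} :=
        closure_minimal hopen (isClosed_eq (hc _) continuous_const)
      rw [closure_Ioo hpe.ne] at hcl
      exact hcl hs
  intro l hl
  have := hR l hl e
  rw [intervalIntegral.integral_same, add_zero] at this
  rw [← this]
  exact key l hl.le e (right_mem_Icc.2 hpe.le)

end Chain

/-! ### The adjoint expressions -/

namespace StarProblem

variable {r n : ℕ} (P : StarProblem r n)

/-- The contribution of the edge `j` to the adjoint expressions, in path time. -/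
noncomputable def adj (z : P.Val) (j : Fin (r + 1)) (l : ℕ) (s : ℝ) : ℂ :=
  conj (P.β j l s) * zeroExt (z j) s + conj (P.γ j l (s + P.τ)) * zeroExt (z j) (s + P.τ)

theorem memLp_conj {κ : ℝ → ℂ} {p : ENNReal} {μ : Measure ℝ} (h : MemLp κ p μ) :
    MemLp (fun s => conj (κ s)) p μ := h.star

theorem integrable_conj_mul_zeroExt {S : Set ℝ} (hS : MeasurableSet S) {κ : ℝ → ℂ}
    (hκ : MemLp κ 2 (volume.restrict S)) (z : L2 S) :
    Integrable (fun s => conj (κ s) * zeroExt z s) := by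
  have e : (fun s => conj (κ s) * zeroExt z s) = S.indicator (fun s => conj (κ s) * z s) := by
    funext s
    by_cases hs : s ∈ S
    · rw [zeroExt_of_mem hs, indicator_of_mem hs]
    · rw [zeroExt_of_notMem hs, indicator_of_notMem hs, mul_zero]
  rw [e, integrable_indicator_iff hS]
  exact (memLp_conj hκ).integrable_mul (Lp.memLp z)

theorem memLp_conj_mul_zeroExt {S : Set ℝ} (hS : MeasurableSet S) {κ : ℝ → ℂ}
    (hκ : MemLp κ ⊤ (volume.restrict S)) (z : L2 S) :
    MemLp (fun s => conj (κ s) * zeroExt z s) 2 := by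
  have e : (fun s => conj (κ s) * zeroExt z s) = S.indicator (fun s => conj (κ s) * z s) := by
    funext s
    by_cases hs : s ∈ S
    · rw [zeroExt_of_mem hs, indicator_of_mem hs]
    · rw [zeroExt_of_notMem hs, indicator_of_notMem hs, mul_zero]
  rw [e, memLp_indicator_iff_restrict hS]
  exact MemLp.mul (p := ⊤) (q := 2) (r := 2) (Lp.memLp z) (memLp_conj hκ)

theorem integrable_adj (z : P.Val) (j : Fin (r + 1)) {l : ℕ} (hl : l < n) :
    Integrable (P.adj z j (l + 1)) := by
  have h1 := integrable_conj_mul_zeroExt (P.measurableSet_edge j) ((P.isCoeff_β j).two l hl) (z j)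
  have h2 := integrable_conj_mul_zeroExt (P.measurableSet_edge j) ((P.isCoeff_γ j).two l hl) (z j)
  exact h1.add (h2.comp_add_right P.τ)

/-- Boundedness of the coefficients of order `n` keeps this entry in `L²`, as is needed for using it
in a test control. The entries of positive codegree are merely integrable. -/
theorem memLp_adj_zero (z : P.Val) (j : Fin (r + 1)) : MemLp (P.adj z j 0) 2 := by
  have h1 := memLp_conj_mul_zeroExt (P.measurableSet_edge j) (P.isCoeff_β j).top (z j)
  have h2 := memLp_conj_mul_zeroExt (P.measurableSet_edge j) (P.isCoeff_γ j).top (z j)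
  exact h1.add (h2.comp_measurePreserving (measurePreserving_add_right volume P.τ))

theorem locallyIntegrable_adj (z : P.Val) (j : Fin (r + 1)) :
    ∀ l < n, LocallyIntegrable (P.adj z j (l + 1)) :=
  fun _ hl => (P.integrable_adj z j hl).locallyIntegrable

theorem adj_of_le (z : P.Val) (j : Fin (r + 1)) (l : ℕ) {s : ℝ} (hs : s ≤ -P.τ) :
    P.adj z j l s = 0 := by
  have h0 := P.off_nonneg j
  have hτ := P.hτ
  have h1 : s ∉ P.edge j := fun h => by linarith [h.1]
  have h2 : s + P.τ ∉ P.edge j := fun h => by linarith [h.1]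
  rw [adj, zeroExt_of_notMem h1, zeroExt_of_notMem h2, mul_zero, mul_zero, add_zero]

theorem memLp_delayTerm_path (w : P.Pre × P.Ctl) (j : Fin (r + 1)) {κ : ℕ → ℝ → ℂ}
    (hκ : IsCoeff n κ (P.edge j)) {σ : ℝ} (hσ : 0 ≤ σ) (hστ : σ ≤ P.τ) {l : ℕ} (hl : l ≤ n) :
    MemLp (delayTerm (κ l) (P.tip j) σ (P.path w j l)) 2 (volume.restrict (P.edge j)) := by
  have hgt : ∀ s ∈ P.edge j, -P.τ < s - σ := fun s hs => by linarith [P.edge_gt hs]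
  have hM : P.edge j ⊆ Iic (P.off j + P.T j) := fun s hs => hs.2.le
  cases l with
  | zero =>
    exact (of_expWeight_smul zero_le_one (P.measurableSet_edge j) hM
      (memLp_delayTerm_weighted (a := -P.τ) (lam := 1) zero_le_one hgt hκ.top
        (P.memLp_top w j)).1).1
  | succ l =>
    exact (of_expWeight_smul zero_le_one (P.measurableSet_edge j) hM
      (memLp_delayTerm_jet_succ_weighted (a := -P.τ) (lam := 1) le_rfl hσ (P.measurableSet_edge j)
        (fun s hs => (hgt s hs).le) (hκ.two l (by omega)) (norm_nonneg w.1.1) (P.memLp_top w j) l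
        (fun k _ => norm_finExt_le _ _)).1).1

/-- The adjoint expressions applied to a path. -/
noncomputable def pairing (z : P.Val) (w : P.Pre × P.Ctl) (j : Fin (r + 1)) (s : ℝ) : ℂ :=
  ∑ l ∈ Finset.range (n + 1), P.adj z j l s * conj (P.path w j l s)

/-- Translating the delayed terms by `τ` moves all coefficients onto `z`. The support of `z` in the
edge limits the integral to times after `-τ`, and the cut-off of the path limits it to times before
the tip. -/
theorem inner_ellOp (z : P.Val) (w : P.Pre × P.Ctl) (j : Fin (r + 1)) :
    inner ℂ (P.ellOp j w) (z j) = ∫ s in (-P.τ)..P.tip j, P.pairing z w j s := by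
  have hle : -P.τ ≤ P.tip j := by linarith [P.off_nonneg j, P.off_lt_tip j, P.hτ]
  set t1 : ℕ → ℝ → ℂ := fun l s =>
    conj (delayTerm (P.β j l) (P.tip j) 0 (P.path w j l) s) * zeroExt (z j) s
  set t2 : ℕ → ℝ → ℂ := fun l s =>
    conj (delayTerm (P.γ j l) (P.tip j) P.τ (P.path w j l) s) * zeroExt (z j) s
  have h1 : ∀ l ∈ Finset.range (n + 1), Integrable (t1 l) := fun l hl =>
    integrable_conj_mul_zeroExt (P.measurableSet_edge j) (P.memLp_delayTerm_path w j
      (P.isCoeff_β j) le_rfl P.hτ.le (Nat.lt_succ_iff.1 (Finset.mem_range.1 hl))) (z j)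
  have h2 : ∀ l ∈ Finset.range (n + 1), Integrable (t2 l) := fun l hl =>
    integrable_conj_mul_zeroExt (P.measurableSet_edge j) (P.memLp_delayTerm_path w j
      (P.isCoeff_γ j) P.hτ.le le_rfl (Nat.lt_succ_iff.1 (Finset.mem_range.1 hl))) (z j)
  have e1 : inner ℂ (P.ellOp j w) (z j) =
      ∫ s, ∑ l ∈ Finset.range (n + 1), (t1 l s + t2 l s) := by
    rw [L2.inner_def]
    have e2 : (fun s => ∑ l ∈ Finset.range (n + 1), (t1 l s + t2 l s)) =
        (P.edge j).indicator (fun s => conj (P.ellFun w j s) * z j s) := by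
      funext s
      by_cases hs : s ∈ P.edge j
      · rw [indicator_of_mem hs, ellFun, pathEll, map_sum, Finset.sum_mul]
        refine Finset.sum_congr rfl fun l _ => ?_
        simp only [t1, t2, zeroExt_of_mem hs, map_add]; ring
      · rw [indicator_of_notMem hs]
        refine Finset.sum_eq_zero fun l _ => ?_
        simp only [t1, t2, zeroExt_of_notMem hs, mul_zero, add_zero]
    rw [e2, integral_indicator (P.measurableSet_edge j)]
    refine integral_congr_ae ?_
    filter_upwards [P.ellOp_ae w j] with s hs
    rw [hs]
    exact mul_comm _ _
  have e3 : ∫ s, ∑ l ∈ Finset.range (n + 1), (t1 l s + t2 l s) =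
      ∫ s, ∑ l ∈ Finset.range (n + 1), (t1 l s + t2 l (s + P.τ)) := by
    rw [integral_finsetSum (f := fun l s => t1 l s + t2 l s) _ fun l hl => (h1 l hl).add (h2 l hl),
      integral_finsetSum (f := fun l s => t1 l s + t2 l (s + P.τ)) _ fun l hl =>
        (h1 l hl).add ((h2 l hl).comp_add_right P.τ)]
    refine Finset.sum_congr rfl fun l hl => ?_
    rw [integral_add (h1 l hl) (h2 l hl),
      integral_add (h1 l hl) ((h2 l hl).comp_add_right P.τ),
      integral_add_right_eq_self (t2 l)]
  have e4 : (fun s => ∑ l ∈ Finset.range (n + 1), (t1 l s + t2 l (s + P.τ))) =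
      (Ioo (-P.τ) (P.tip j)).indicator (P.pairing z w j) := by
    funext s
    have e5 : ∀ l, t1 l s + t2 l (s + P.τ) =
        P.adj z j l s * conj ((Iio (P.tip j)).indicator (P.path w j l) s) := fun l => by
      simp only [t1, t2, delayTerm, sub_zero, add_sub_cancel_right, map_mul, adj]; ring
    simp only [e5]
    by_cases hs : s ∈ Ioo (-P.τ) (P.tip j)
    · rw [indicator_of_mem hs, pairing]
      refine Finset.sum_congr rfl fun l _ => ?_
      rw [indicator_of_mem (show s ∈ Iio (P.tip j) from hs.2)]
    · rw [indicator_of_notMem hs]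
      refine Finset.sum_eq_zero fun l _ => ?_
      by_cases hs' : s < P.tip j
      · have : s ≤ -P.τ := not_lt.1 fun h => hs ⟨h, hs'⟩
        rw [P.adj_of_le z j l this, zero_mul]
      · rw [indicator_of_notMem (show s ∉ Iio (P.tip j) from hs'), map_zero, mul_zero]
  rw [e1, e3, e4, integral_indicator measurableSet_Ioo, intervalIntegral.integral_of_le hle,
    integral_Ioc_eq_integral_Ioo]

theorem inner_ellAll (z : P.Val) (w : P.Pre × P.Ctl) :
    inner ℂ (P.ellAll w) z = ∑ j, ∫ s in (-P.τ)..P.tip j, P.pairing z w j s := by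
  rw [PiLp.inner_apply]
  exact Finset.sum_congr rfl fun j _ => P.inner_ellOp z w j

theorem intervalIntegrable_pairing (z : P.Val) (w : P.Pre × P.Ctl) (j : Fin (r + 1)) (p q : ℝ) :
    IntervalIntegrable (P.pairing z w j) volume p q := by
  have : P.pairing z w j = fun s => ∑ l ∈ Finset.range n,
      P.adj z j (l + 1) s * conj (P.path w j (l + 1) s) +
      P.adj z j 0 s * conj (P.path w j 0 s) := by
    funext s; rw [pairing, Finset.sum_range_succ']
  rw [this]
  refine IntervalIntegrable.add ?_ ?_
  · have h := IntervalIntegrable.sum (μ := volume) (a := p) (b := q) (Finset.range n)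
      (f := fun l s => P.adj z j (l + 1) s * conj (P.path w j (l + 1) s)) fun l hl =>
      ((P.integrable_adj z j (Finset.mem_range.1 hl)).intervalIntegrable).mul_continuousOn
        ((Complex.continuous_conj.comp (continuous_jet_succ (P.locallyIntegrable_top w j) _ _
          l)).continuousOn)
    have e : (fun s => ∑ l ∈ Finset.range n, P.adj z j (l + 1) s *
        conj (P.path w j (l + 1) s)) = ∑ l ∈ Finset.range n, fun s => P.adj z j (l + 1) s *
        conj (P.path w j (l + 1) s) := by funext s; simp
    rw [e]; exact h
  · exact ((P.memLp_adj_zero z j).integrable_mul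
      (memLp_conj (P.memLp_top w j))).intervalIntegrable

/-! ### Paths with zero prehistory -/

theorem isJet_path (w : P.Pre × P.Ctl) (j : Fin (r + 1)) (p : ℝ) :
    IsJet n (P.path w j) (-P.τ) p :=
  isJet_jet ((P.locallyIntegrable_top w j).integrableOn_isCompact
    isCompact_uIcc).intervalIntegrable n

theorem top_zero_of_neg (u : P.Ctl) (j : Fin (r + 1)) {s : ℝ} (hs : s ∈ Ioo (-P.τ) 0) :
    P.top (0, u) j s = zeroExt (0 : L2 (Ioo (-P.τ) 0)) s := by
  have h : ∀ i, s ∉ P.act i := fun i hi => by linarith [hi.1, hs.2, P.off_nonneg i]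
  simp only [top, Pi.add_apply]
  rw [zeroExt_of_notMem (h 0)]
  split_ifs
  · simp
  · rw [zeroExt_of_notMem (h j)]; simp

theorem top_ae_zero_of_neg (u : P.Ctl) (j : Fin (r + 1)) :
    ∀ᵐ s : ℝ, s ∈ Ioo (-P.τ) 0 → P.top (0, u) j s = 0 := by
  have h : (((0 : L2 (Ioo (-P.τ) 0)) : ℝ → ℂ)) =ᵐ[volume.restrict (Ioo (-P.τ) 0)] 0 :=
    Lp.coeFn_zero _ _ _
  rw [Filter.EventuallyEq, ae_restrict_iff' measurableSet_Ioo] at h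
  filter_upwards [h] with s h hs
  rw [P.top_zero_of_neg u j hs, zeroExt_of_mem hs, h hs]; rfl

theorem path_zero_of_nonpos (u : P.Ctl) (j : Fin (r + 1)) {l : ℕ} (hl : l < n) {s : ℝ}
    (hs : s ∈ Icc (-P.τ) 0) : P.path (0, u) j (l + 1) s = 0 := by
  have h0 : IsJet n (fun _ _ => (0 : ℂ)) (-P.τ) 0 :=
    ⟨intervalIntegrable_const, fun i _ t _ => by simp⟩
  have := h0.eqOn (P.isJet_path (0, u) j 0) (P.top_ae_zero_of_neg u j) (fun i _ => by
    unfold path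
    rw [jet_succ_self, show ((0 : P.Pre), u).1.1 = 0 from rfl, finExt_zero]; rfl) hl hs
  exact this

theorem top_eq_of_lt (w : P.Pre × P.Ctl) (j : Fin (r + 1)) {s : ℝ} (hs : s ≤ P.T 0) :
    P.top w j s = P.top w 0 s := by
  simp only [top, Pi.add_apply]
  by_cases hj : j = 0
  · simp [hj]
  · have h : s ∉ P.act j := fun h => by
      have := h.1
      simp only [off, hj, if_false] at this
      linarith
    rw [if_neg hj, zeroExt_of_notMem h]; simp

/-- All paths share the prehistory and the entering edge, so uniqueness of jets identifies them up
to the vertex. -/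
theorem path_eq_of_le (w : P.Pre × P.Ctl) (j : Fin (r + 1)) (l : ℕ) {s : ℝ}
    (hs : s ∈ Icc (-P.τ) (P.T 0)) : P.path w j l s = P.path w 0 l s := by
  cases l with
  | zero => exact P.top_eq_of_lt w j hs.2
  | succ l =>
    have h := fun i => isJet_jet (a := -P.τ) (b := P.T 0) (x := finExt w.1.1)
      ((P.locallyIntegrable_top w i).integrableOn_isCompact isCompact_uIcc).intervalIntegrable
      (l + 1)
    exact (h 0).eqOn (h j) (ae_of_all _ fun t ht => P.top_eq_of_lt w j ht.2.le)
      (fun i _ => by rw [jet_succ_self, jet_succ_self]) (Nat.lt_succ_self l) hs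

/-- Splitting of the integrals over the paths into integrals over the edges. -/
theorem sum_integral_paths {h : Fin (r + 1) → ℝ → ℂ}
    (hi : ∀ j p q, IntervalIntegrable (h j) volume p q)
    (h0 : ∀ j, ∀ᵐ s : ℝ, s ∈ Ioo (-P.τ) 0 → h j s = 0) :
    ∑ j, ∫ s in (-P.τ)..P.tip j, h j s = (∫ s in P.off 0..P.tip 0, ∑ j, h j s) +
      ∑ ν : Fin r, ∫ s in P.off ν.succ..P.tip ν.succ, h ν.succ s := by
  have hz : ∀ j, ∫ s in (-P.τ)..0, h j s = 0 := fun j => by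
    rw [intervalIntegral.integral_of_le (by linarith [P.hτ]), integral_Ioc_eq_integral_Ioo,
      setIntegral_congr_ae measurableSet_Ioo (g := fun _ => 0) (h0 j)]
    simp
  have h1 : ∀ j, ∫ s in (-P.τ)..P.tip j, h j s = ∫ s in (0 : ℝ)..P.tip j, h j s := fun j => by
    rw [← intervalIntegral.integral_add_adjacent_intervals (hi j (-P.τ) 0) (hi j 0 (P.tip j)),
      hz j, zero_add]
  simp only [h1]
  rw [Fin.sum_univ_succ, off_zero, intervalIntegral.integral_finsetSum fun j _ => hi j _ _,
    Fin.sum_univ_succ, add_assoc, ← Finset.sum_add_distrib]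
  congr 1
  refine Finset.sum_congr rfl fun ν _ => ?_
  rw [off_succ, tip_zero, intervalIntegral.integral_add_adjacent_intervals (hi _ _ _) (hi _ _ _)]

/-- The adjoint expressions in path time. -/
noncomputable def adjAll (z : P.Val) (j : Fin (r + 1)) (l : ℕ) (s : ℝ) : ℂ :=
  if j = 0 then ∑ i, P.adj z i l s else P.adj z j l s

theorem pairing_ae_zero (z : P.Val) (u : P.Ctl) (j : Fin (r + 1)) :
    ∀ᵐ s : ℝ, s ∈ Ioo (-P.τ) 0 → P.pairing z (0, u) j s = 0 := by
  filter_upwards [P.top_ae_zero_of_neg u j] with s hs hm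
  refine Finset.sum_eq_zero fun l hl => ?_
  cases l with
  | zero =>
    have : P.path (0, u) j 0 s = 0 := hs hm
    rw [this, map_zero, mul_zero]
  | succ l =>
    rw [P.path_zero_of_nonpos u j (by have := Finset.mem_range.1 hl; omega)
      (Ioo_subset_Icc_self hm), map_zero, mul_zero]

/-- The quadratic form as a sum of integrals over the edges. -/
theorem inner_A (z : P.Val) (u : P.Ctl) :
    inner ℂ (P.A u) z = ∑ j, ∫ s in P.off j..P.tip j,
      ∑ l ∈ Finset.range (n + 1), P.adjAll z j l s * conj (P.path (0, u) j l s) := by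
  have h : P.A u = P.ellAll (0, u) := rfl
  rw [h, inner_ellAll, P.sum_integral_paths (P.intervalIntegrable_pairing z (0, u))
    (P.pairing_ae_zero z u), Fin.sum_univ_succ]
  have hτ := P.hτ
  have hT := P.T_pos 0
  congr 1
  · refine intervalIntegral.integral_congr fun s hs => ?_
    rw [off_zero, tip_zero, uIcc_of_le hT.le] at hs
    have e : ∀ j, P.pairing z (0, u) j s =
        ∑ l ∈ Finset.range (n + 1), P.adj z j l s * conj (P.path (0, u) 0 l s) := fun j =>
      Finset.sum_congr rfl fun l _ => by
        rw [P.path_eq_of_le (0, u) j l ⟨by linarith [hs.1], hs.2⟩]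
    simp only [e]
    rw [Finset.sum_comm]
    refine Finset.sum_congr rfl fun l _ => ?_
    rw [adjAll, if_pos rfl, Finset.sum_mul]

end StarProblem

/-! ### Weak solutions and chains of quasi-derivatives -/

namespace StarProblem

variable {r n : ℕ} (P : StarProblem r n)

/-- The variation vanishes at time `0`. At the vertex all paths have the same value, so the
Kirchhoff-type conditions cancel the entering edge against the outgoing ones, and only the tips
remain. -/
theorem boundary_sum (u : P.Ctl) {q : Fin (r + 1) → ℕ → ℝ → ℂ}
    (hq : ∀ l < n, q 0 l (P.tip 0) = ∑ ν : Fin r, q ν.succ l (P.off ν.succ)) :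
    ∑ j, ∑ l ∈ Finset.range n,
      (q j l (P.tip j) * conj (P.path (0, u) j (l + 1) (P.tip j)) -
        q j l (P.off j) * conj (P.path (0, u) j (l + 1) (P.off j))) =
      ∑ ν : Fin r, ∑ l ∈ Finset.range n,
        q ν.succ l (P.tip ν.succ) * conj (P.path (0, u) ν.succ (l + 1) (P.tip ν.succ)) := by
  have hτ := P.hτ
  have hT := P.T_pos 0
  have e0 : ∑ l ∈ Finset.range n,
      (q 0 l (P.tip 0) * conj (P.path (0, u) 0 (l + 1) (P.tip 0)) -
        q 0 l (P.off 0) * conj (P.path (0, u) 0 (l + 1) (P.off 0))) =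
      ∑ ν : Fin r, ∑ l ∈ Finset.range n,
        q ν.succ l (P.off ν.succ) * conj (P.path (0, u) ν.succ (l + 1) (P.off ν.succ)) := by
    rw [Finset.sum_comm]
    refine Finset.sum_congr rfl fun l hl => ?_
    have hl' := Finset.mem_range.1 hl
    rw [off_zero, P.path_zero_of_nonpos u 0 hl' ⟨by linarith, le_rfl⟩, map_zero, mul_zero,
      sub_zero, hq l hl', Finset.sum_mul]
    refine Finset.sum_congr rfl fun ν _ => ?_
    rw [tip_zero, off_succ, P.path_eq_of_le (0, u) ν.succ (l + 1) ⟨by linarith, le_rfl⟩]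
  rw [Fin.sum_univ_succ, e0, ← Finset.sum_add_distrib]
  refine Finset.sum_congr rfl fun ν _ => ?_
  rw [← Finset.sum_add_distrib]
  refine Finset.sum_congr rfl fun l _ => ?_
  ring

theorem isJet_path_conj (u : P.Ctl) (j : Fin (r + 1)) :
    IsJet n (fun l s => conj (P.path (0, u) j l s)) (P.off j) (P.tip j) :=
  ((P.isJet_path (0, u) j (P.tip j)).mono_left (by linarith [P.off_nonneg j, P.hτ])
    (P.off_lt_tip j).le).conjugate

/-- A chain of quasi-derivatives which satisfies the conditions at the vertex yields the
orthogonality relations. -/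
theorem inner_A_eq_zero_of_chain (z : P.Val) {q : Fin (r + 1) → ℕ → ℝ → ℂ}
    (hac : ∀ j, ∀ l < n, AbsolutelyContinuousOnInterval (q j l) (P.off j) (P.tip j))
    (h0 : ∀ j, ∀ᵐ s : ℝ, s ∈ Ioo (P.off j) (P.tip j) → P.adjAll z j 0 s = q j 0 s)
    (hs : ∀ j, ∀ l < n, ∀ᵐ s : ℝ, s ∈ Ioo (P.off j) (P.tip j) →
      P.adjAll z j (l + 1) s = q j (l + 1) s + deriv (q j l) s)
    (hn : ∀ j, ∀ᵐ s : ℝ, s ∈ Ioo (P.off j) (P.tip j) → q j n s = 0)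
    (hq : ∀ l < n, q 0 l (P.tip 0) = ∑ ν : Fin r, q ν.succ l (P.off ν.succ))
    {u : P.Ctl} (hu : P.E u = 0) : inner ℂ (P.A u) z = 0 := by
  rw [P.inner_A]
  have e : ∀ j, ∫ s in P.off j..P.tip j,
      ∑ l ∈ Finset.range (n + 1), P.adjAll z j l s * conj (P.path (0, u) j l s) = _ := fun j =>
    (P.isJet_path_conj u j).integral_sum_mul (P.off_lt_tip j).le (hac j) (h0 j) (hs j) (hn j)
  rw [Finset.sum_congr rfl fun j _ => e j, P.boundary_sum u hq]
  refine Finset.sum_eq_zero fun ν _ => Finset.sum_eq_zero fun l hl => ?_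
  have := congrFun hu (ν, ⟨l, Finset.mem_range.1 hl⟩)
  change P.path (0, u) ν.succ (l + 1) (P.tip ν.succ) = 0 at this
  rw [this, map_zero, mul_zero]

theorem locallyIntegrable_adjAll (z : P.Val) (j : Fin (r + 1)) :
    ∀ l < n, LocallyIntegrable (P.adjAll z j (l + 1)) := fun l hl => by
  by_cases hj : j = 0
  · have e : P.adjAll z j (l + 1) = fun s => ∑ i, P.adj z i (l + 1) s := by
      funext s; rw [adjAll, if_pos hj]
    rw [e]
    exact (integrable_finsetSum _ fun i _ => P.integrable_adj z i hl).locallyIntegrable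
  · have e : P.adjAll z j (l + 1) = P.adj z j (l + 1) := by
      funext s; rw [adjAll, if_neg hj]
    rw [e]
    exact P.locallyIntegrable_adj z j l hl

theorem memLp_adjAll_zero (z : P.Val) (j : Fin (r + 1)) : MemLp (P.adjAll z j 0) 2 := by
  by_cases hj : j = 0
  · have e : P.adjAll z j 0 = fun s => ∑ i, P.adj z i 0 s := by
      funext s; rw [adjAll, if_pos hj]
    rw [e]
    exact memLp_finsetSum _ fun i _ => P.memLp_adj_zero z i
  · have e : P.adjAll z j 0 = P.adj z j 0 := by
      funext s; rw [adjAll, if_neg hj]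
    rw [e]
    exact P.memLp_adj_zero z j

/-! ### Chains on the graph and the du Bois-Reymond argument -/

/-- A chain of quasi-derivatives with prescribed values at the ends of the outgoing edges. -/
structure IsChain (z : P.Val) (m : Fin r → ℕ → ℂ) (R : Fin (r + 1) → ℕ → ℝ → ℂ) : Prop where
  last : ∀ j, R j n = 0
  cont : ∀ j l, Continuous (R j l)
  primitive : ∀ j, ∃ v : ℕ → ℂ, ∀ l < n, ∀ s, R j l s = v l +
    ∫ t in P.tip j..s, (P.adjAll z j (l + 1) t - R j (l + 1) t)
  vertex : ∀ l < n, R 0 l (P.tip 0) = ∑ ν : Fin r, R ν.succ l (P.off ν.succ)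
  terminal : ∀ ν, ∀ l < n, R ν.succ l (P.tip ν.succ) = m ν l

/-- The outgoing edges are integrated backwards from their tips; their sum at the vertex then
provides the terminal values for the entering edge. -/
theorem exists_isChain (z : P.Val) (m : Fin r → ℕ → ℂ) : ∃ R, P.IsChain z m R := by
  have H := fun ν : Fin r => exists_chain n (P.adjAll z ν.succ)
    (P.locallyIntegrable_adjAll z ν.succ) (m ν) (P.tip ν.succ)
  choose R h0 hc hR using H
  obtain ⟨R0, h0', hc', hR'⟩ := exists_chain n (P.adjAll z 0) (P.locallyIntegrable_adjAll z 0)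
    (fun l => ∑ ν : Fin r, R ν l (P.off ν.succ)) (P.tip 0)
  refine ⟨Fin.cons R0 R, ?_, ?_, ?_, ?_, ?_⟩
  · intro j
    refine Fin.cases ?_ (fun ν => ?_) j
    · simpa using h0'
    · simpa using h0 ν
  · intro j
    refine Fin.cases ?_ (fun ν => ?_) j
    · simpa using hc'
    · simpa using hc ν
  · intro j
    refine Fin.cases ?_ (fun ν => ?_) j
    · exact ⟨_, by simpa using hR'⟩
    · exact ⟨m ν, by simpa using hR ν⟩
  · intro l hl
    simp only [Fin.cons_zero, Fin.cons_succ]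
    rw [hR' l hl, intervalIntegral.integral_same, add_zero]
  · intro ν l hl
    simp only [Fin.cons_succ]
    rw [hR ν l hl, intervalIntegral.integral_same, add_zero]

variable {P}

theorem IsChain.absCont {z : P.Val} {m : Fin r → ℕ → ℂ} {R : Fin (r + 1) → ℕ → ℝ → ℂ}
    (h : P.IsChain z m R) (j : Fin (r + 1)) {l : ℕ} (hl : l < n) (p q : ℝ) :
    AbsolutelyContinuousOnInterval (R j l) p q := by
  obtain ⟨v, hv⟩ := h.primitive j
  exact chain_absCont (P.locallyIntegrable_adjAll z j) (h.cont j) hv hl p q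

theorem IsChain.ae_eq {z : P.Val} {m : Fin r → ℕ → ℂ} {R : Fin (r + 1) → ℕ → ℝ → ℂ}
    (h : P.IsChain z m R) (j : Fin (r + 1)) {l : ℕ} (hl : l < n) :
    ∀ᵐ s : ℝ, P.adjAll z j (l + 1) s = R j (l + 1) s + deriv (R j l) s := by
  obtain ⟨v, hv⟩ := h.primitive j
  filter_upwards [chain_hasDerivAt (P.locallyIntegrable_adjAll z j) (h.cont j) hv hl] with s hs
  rw [hs.deriv]; ring

theorem IsChain.memLp_sub {z : P.Val} {m : Fin r → ℕ → ℂ} {R : Fin (r + 1) → ℕ → ℝ → ℂ}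
    (h : P.IsChain z m R) (j : Fin (r + 1)) :
    MemLp (fun s => P.adjAll z j 0 s - R j 0 s) 2 (volume.restrict (P.act j)) := by
  refine ((P.memLp_adjAll_zero z j).mono_measure Measure.restrict_le_self).sub ?_
  obtain ⟨C, hC⟩ := (isCompact_Icc (a := P.off j) (b := P.tip j)).exists_bound_of_continuousOn
    (h.cont j 0).continuousOn
  have : IsFiniteMeasure (volume.restrict (P.act j)) :=
    ⟨by rw [Measure.restrict_apply_univ]; exact measure_Ioo_lt_top⟩
  refine MemLp.of_bound (h.cont j 0).aestronglyMeasurable C ?_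
  filter_upwards [ae_restrict_mem (P.measurableSet_act j)] with s hs
  exact hC s (Ioo_subset_Icc_self hs)

/-- A chain satisfies every relation between the quasi-derivatives and the adjoint expressions
except the one in codegree zero. Integration by parts therefore leaves the tip terms and the pairing
of this defect with the control. -/
theorem IsChain.inner_A {z : P.Val} {m : Fin r → ℕ → ℂ} {R : Fin (r + 1) → ℕ → ℝ → ℂ}
    (h : P.IsChain z m R) (u : P.Ctl) :
    inner ℂ (P.A u) z = ∑ ν : Fin r, ∑ l ∈ Finset.range n,
        m ν l * conj (P.path (0, u) ν.succ (l + 1) (P.tip ν.succ)) +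
      ∑ j, ∫ s in P.act j, (P.adjAll z j 0 s - R j 0 s) * conj (u j s) := by
  -- The adjoint expressions with the entry of codegree zero replaced by `R j 0`, so that
  -- integration by parts applies exactly.
  set g : Fin (r + 1) → ℕ → ℝ → ℂ := fun j l => Nat.casesOn l (R j 0) fun l => P.adjAll z j (l + 1)
  have e1 : ∀ j, ∫ s in P.off j..P.tip j, ∑ l ∈ Finset.range (n + 1),
      g j l s * conj (P.path (0, u) j l s) = _ := fun j =>
    (P.isJet_path_conj u j).integral_sum_mul (P.off_lt_tip j).le (q := R j) (g := g j)
      (fun l hl => h.absCont j hl _ _) (ae_of_all _ fun s _ => rfl)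
      (fun l hl => (h.ae_eq j hl).mono fun s hs _ => hs)
      (ae_of_all _ fun s _ => by rw [h.last j]; rfl)
  have hw : ∀ j, AEStronglyMeasurable (fun s => conj (P.path (0, u) j 0 s)) :=
    fun j => (memLp_conj (P.memLp_top (0, u) j)).1
  have i1 : ∀ j, IntervalIntegrable (fun s => (P.adjAll z j 0 s - R j 0 s) *
      conj (P.path (0, u) j 0 s)) volume (P.off j) (P.tip j) := fun j => by
    rw [intervalIntegrable_iff_integrableOn_Ioo_of_le (P.off_lt_tip j).le]
    exact (h.memLp_sub j).integrable_mul
      ((memLp_conj (P.memLp_top (0, u) j)).mono_measure Measure.restrict_le_self)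
  have i2 : ∀ j, IntervalIntegrable (fun s => ∑ l ∈ Finset.range (n + 1),
      g j l s * conj (P.path (0, u) j l s)) volume (P.off j) (P.tip j) := fun j => by
    have e : (fun s => ∑ l ∈ Finset.range (n + 1), g j l s * conj (P.path (0, u) j l s)) =
        (∑ l ∈ Finset.range n, fun s =>
          P.adjAll z j (l + 1) s * conj (P.path (0, u) j (l + 1) s)) +
          fun s => R j 0 s * conj (P.path (0, u) j 0 s) := by
      funext s; rw [Finset.sum_range_succ']; simp [g]
    rw [e]
    refine IntervalIntegrable.add (IntervalIntegrable.sum _ fun l hl => ?_) ?_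
    · exact (((P.locallyIntegrable_adjAll z j l (Finset.mem_range.1 hl)).integrableOn_isCompact
        isCompact_uIcc).intervalIntegrable).mul_continuousOn
        ((Complex.continuous_conj.comp (continuous_jet_succ (P.locallyIntegrable_top (0, u) j) _ _
          l)).continuousOn)
    · have hl : LocallyIntegrable (fun s => conj (P.path (0, u) j 0 s)) :=
        (memLp_conj (P.memLp_top (0, u) j)).locallyIntegrable one_le_two
      exact ((hl.integrableOn_isCompact isCompact_uIcc).intervalIntegrable).continuousOn_mul
        (h.cont j 0).continuousOn
  have e2 : ∀ j, ∫ s in P.off j..P.tip j, ∑ l ∈ Finset.range (n + 1),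
      P.adjAll z j l s * conj (P.path (0, u) j l s) =
      (∫ s in P.off j..P.tip j, ∑ l ∈ Finset.range (n + 1),
        g j l s * conj (P.path (0, u) j l s)) +
      ∫ s in P.act j, (P.adjAll z j 0 s - R j 0 s) * conj (u j s) := fun j => by
    have e3 : ∫ s in P.act j, (P.adjAll z j 0 s - R j 0 s) * conj (u j s) =
        ∫ s in P.off j..P.tip j, (P.adjAll z j 0 s - R j 0 s) *
          conj (P.path (0, u) j 0 s) := by
      rw [intervalIntegral.integral_of_le (P.off_lt_tip j).le, integral_Ioc_eq_integral_Ioo]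
      refine setIntegral_congr_fun measurableSet_Ioo fun s hs => ?_
      have := P.top_eq_of_mem_act (0, u) hs
      rw [show P.path (0, u) j 0 s = u j s from this]
    rw [e3, ← intervalIntegral.integral_add (i2 j) (i1 j)]
    refine intervalIntegral.integral_congr fun s _ => ?_
    rw [Finset.sum_range_succ', Finset.sum_range_succ']
    have gs : ∀ l, g j (l + 1) = P.adjAll z j (l + 1) := fun _ => rfl
    simp only [gs, show g j 0 = R j 0 from rfl]
    ring
  rw [P.inner_A, Finset.sum_congr rfl fun j _ => e2 j, Finset.sum_add_distrib,
    Finset.sum_congr rfl fun j _ => e1 j, P.boundary_sum u h.vertex]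
  congr 1
  refine Finset.sum_congr rfl fun ν _ => Finset.sum_congr rfl fun l hl => ?_
  rw [h.terminal ν l (Finset.mem_range.1 hl)]

/-- Du Bois-Reymond: when the tip terms alone account for the form, the defect is orthogonal to all
controls. The control equal to the defect on the edge `j` and to zero elsewhere shows that the
defect vanishes. -/
theorem IsChain.ae_eq_zero {z : P.Val} {m : Fin r → ℕ → ℂ} {R : Fin (r + 1) → ℕ → ℝ → ℂ}
    (h : P.IsChain z m R)
    (hm : ∀ u, inner ℂ (P.A u) z = ∑ ν : Fin r, ∑ l ∈ Finset.range n,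
        m ν l * conj (P.path (0, u) ν.succ (l + 1) (P.tip ν.succ))) (j : Fin (r + 1)) :
    ∀ᵐ s : ℝ, s ∈ Ioo (P.off j) (P.tip j) → P.adjAll z j 0 s = R j 0 s := by
  have h1 := h.inner_A (Pi.single j ((h.memLp_sub j).toLp _))
  rw [hm, left_eq_add, Finset.sum_eq_single j] at h1
  · rw [Pi.single_eq_same] at h1
    set d := (h.memLp_sub j).toLp _
    have h2 : inner ℂ d d = 0 := by
      rw [L2.inner_def, ← h1]
      refine integral_congr_ae ?_
      filter_upwards [(h.memLp_sub j).coeFn_toLp] with s hs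
      change inner ℂ (d s) (d s) = _
      rw [← hs]; rfl
    have h3 := (h.memLp_sub j).coeFn_toLp
    have h4 : (h.memLp_sub j).toLp _ = 0 := inner_self_eq_zero.1 h2
    rw [h4] at h3
    have h5 := h3.symm.trans (Lp.coeFn_zero _ _ _)
    rw [Filter.EventuallyEq, ae_restrict_iff' (P.measurableSet_act j)] at h5
    filter_upwards [h5] with s hs hm
    exact sub_eq_zero.1 (hs hm)
  · intro i _ hi
    rw [Pi.single_eq_of_ne hi]
    have : ((0 : L2 (P.act i)) : ℝ → ℂ) =ᵐ[volume.restrict (P.act i)] 0 := Lp.coeFn_zero _ _ _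
    rw [integral_congr_ae (g := fun _ => 0)]
    · simp
    · filter_upwards [this] with s hs
      rw [hs]; simp
  · simp

/-! ### Surjectivity of `E` and Lagrange multipliers -/

variable (P)

theorem adjAll_zero_ae (j : Fin (r + 1)) (l : ℕ) : ∀ᵐ s : ℝ, P.adjAll 0 j l s = 0 := by
  have h1 : ∀ i, ∀ᵐ s : ℝ, zeroExt ((0 : P.Val) i) s = 0 := fun i => by
    have h : (((0 : L2 (P.edge i)) : ℝ → ℂ)) =ᵐ[volume.restrict (P.edge i)] 0 :=
      Lp.coeFn_zero _ _ _
    have h2 := (ae_eq_restrict_iff_indicator_ae_eq (P.measurableSet_edge i)).1 h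
    filter_upwards [h2] with s hs
    refine Eq.trans hs ?_
    simp
  have h2 : ∀ i, ∀ᵐ s : ℝ, zeroExt ((0 : P.Val) i) (s + P.τ) = 0 := fun i =>
    (measurePreserving_add_right volume P.τ).quasiMeasurePreserving.ae (h1 i)
  filter_upwards [ae_all_iff.2 h1, ae_all_iff.2 h2] with s h1 h2
  have h3 : ∀ i, P.adj 0 i l s = 0 := fun i => by
    rw [adj, h1, h2, mul_zero, mul_zero, add_zero]
  rw [adjAll]
  split_ifs
  · exact Finset.sum_eq_zero fun i _ => h3 i
  · exact h3 j

/-- The values at the ends of the outgoing edges can be prescribed. -/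
theorem E_surjective : Function.Surjective P.E := by
  rw [← ContinuousLinearMap.coe_coe, ← LinearMap.range_eq_top]
  by_contra hne
  -- Otherwise a nonzero functional annihilates the range of `E`. Its conjugated coefficients are
  -- taken as terminal values of a chain for `z = 0`.
  obtain ⟨f, hf, hle⟩ := Submodule.exists_le_ker_of_lt_top _ (lt_top_iff_ne_top.2 hne)
  set m : Fin r → ℕ → ℂ := fun ν => finExt fun i => conj (f (Pi.single (ν, i) 1)) with hm
  have hfm : ∀ v, f v = ∑ ν : Fin r, ∑ i : Fin n, v (ν, i) * f (Pi.single (ν, i) 1) := by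
    intro v
    have hv : v = ∑ p, v p • Pi.single p (1 : ℂ) := by
      funext q; simp [Finset.sum_apply, Pi.single_apply]
    conv_lhs => rw [hv, map_sum]
    rw [Fintype.sum_prod_type]
    simp only [map_smul, smul_eq_mul]
  obtain ⟨R, hR⟩ := P.exists_isChain 0 m
  -- For `z = 0` the required identity says that the tip terms vanish, which is the conjugate of `f
  -- (E u) = 0`.
  have hchain := hR.ae_eq_zero (fun u => by
    rw [inner_zero_right]
    have h1 : f (P.E u) = 0 := hle (LinearMap.mem_range_self _ u)
    rw [hfm] at h1
    have h2 := congrArg conj h1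
    rw [map_zero, map_sum] at h2
    rw [← h2]
    refine Finset.sum_congr rfl fun ν _ => ?_
    rw [map_sum, ← Fin.sum_univ_eq_sum_range (fun l =>
      m ν l * conj (P.path (0, u) ν.succ (l + 1) (P.tip ν.succ))) n]
    refine Finset.sum_congr rfl fun i _ => ?_
    rw [map_mul, mul_comm, hm]
    simp only [finExt, i.2, dif_pos]
    rfl)
  have hm0 : ∀ ν : Fin r, ∀ l < n, m ν l = 0 := by
    intro ν
    obtain ⟨v, hv⟩ := hR.primitive ν.succ
    have hvm : ∀ l < n, v l = m ν l := fun l hl => by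
      rw [← hR.terminal ν l hl, hv l hl, intervalIntegral.integral_same, add_zero]
    have hlt := P.off_lt_tip ν.succ
    -- The chain has no right-hand sides, and its entry of index `0` vanishes almost everywhere,
    -- hence by continuity everywhere up to the tip. So all its terminal values vanish,
    -- contradicting `f ≠ 0`.
    have h0 := chain_eq_zero (n := n) (m := v) hlt (hR.cont ν.succ) (fun l hl s => by
      rw [hv l hl s]
      congr 1
      refine intervalIntegral.integral_congr_ae ?_
      filter_upwards [P.adjAll_zero_ae ν.succ (l + 1)] with t ht _
      rw [ht]) (by
      refine Measure.eqOn_Icc_of_ae_eq (μ := volume) hlt.ne ?_ (hR.cont ν.succ 0).continuousOn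
        continuousOn_const
      rw [← restrict_Ioo_eq_restrict_Icc, Filter.EventuallyEq, ae_restrict_iff' measurableSet_Ioo]
      filter_upwards [hchain ν.succ, P.adjAll_zero_ae ν.succ 0] with s h1 h2 hs
      rw [← h1 hs, h2])
    exact fun l hl => (hvm l hl).symm.trans (h0 l hl)
  refine hf (LinearMap.ext fun v => ?_)
  rw [hfm]
  refine Finset.sum_eq_zero fun ν _ => Finset.sum_eq_zero fun i _ => ?_
  have h1 := hm0 ν i i.2
  simp only [hm, finExt, i.2, dif_pos, Fin.eta] at h1
  rw [(map_eq_zero _).1 h1, mul_zero]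

/-- An element orthogonal to the values of the differential expressions for all admissible
variations possesses a chain of quasi-derivatives. -/
theorem exists_chain_of_orthogonal (z : P.Val)
    (hz : ∀ w, P.E w = 0 → inner ℂ z (P.A w) = 0) :
    ∃ m R, P.IsChain z m R ∧
      ∀ j, ∀ᵐ s : ℝ, s ∈ Ioo (P.off j) (P.tip j) → P.adjAll z j 0 s = R j 0 s := by
  -- The functional `u ↦ ⟨z, A u⟩` vanishes on the common kernel of finitely many coordinates of
  -- `E`, so it is a combination of them. The coefficients are Lagrange multipliers, and their
  -- conjugates become the terminal values of the chain.
  have h1 : (((innerSL ℂ z).comp P.A : P.Ctl →L[ℂ] ℂ) : P.Ctl →ₗ[ℂ] ℂ) ∈ Submodule.span ℂ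
      (range fun p : Fin r × Fin n => LinearMap.proj p ∘ₗ (P.E : P.Ctl →ₗ[ℂ] Fin r × Fin n → ℂ)) := by
    refine mem_span_of_iInf_ker_le_ker fun w hw => ?_
    refine hz w (funext fun p => ?_)
    rw [Submodule.mem_iInf] at hw
    exact hw p
  obtain ⟨κ, hκ⟩ := (Submodule.mem_span_range_iff_exists_fun ℂ).1 h1
  obtain ⟨R, hR⟩ := P.exists_isChain z fun ν => finExt fun i => conj (κ (ν, i))
  refine ⟨_, R, hR, hR.ae_eq_zero fun u => ?_⟩
  have h2 := LinearMap.congr_fun hκ u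
  have h3 : inner ℂ z (P.A u) = ∑ p : Fin r × Fin n, κ p * P.E u p := by
    rw [show inner ℂ z (P.A u) = (((innerSL ℂ z).comp P.A : P.Ctl →L[ℂ] ℂ) :
      P.Ctl →ₗ[ℂ] ℂ) u from rfl, ← h2]
    simp
  rw [← inner_conj_symm, h3, map_sum, Fintype.sum_prod_type]
  refine Finset.sum_congr rfl fun ν _ => ?_
  rw [← Fin.sum_univ_eq_sum_range (fun l => finExt (fun i => conj (κ (ν, i))) l *
    conj (P.path (0, u) ν.succ (l + 1) (P.tip ν.succ))) n]
  refine Finset.sum_congr rfl fun i _ => ?_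
  rw [map_mul]
  simp only [finExt, i.2, dif_pos]
  rfl

end StarProblem

/-! ### Sobolev norms and jets -/

theorem AbsolutelyContinuousOnInterval.comp_add_right {f : ℝ → ℂ} {a b : ℝ}
    (hf : AbsolutelyContinuousOnInterval f a b) (hab : a ≤ b) (d : ℝ) :
    AbsolutelyContinuousOnInterval (fun t => f (t + d)) (a - d) (b - d) := by
  have h := (hf.intervalIntegrable_deriv_complex.comp_add_right d
    ).absolutelyContinuousOnInterval_complex (c := a - d) left_mem_uIcc
  refine h.of_dist_le fun s hs t ht => ?_
  have e : ∀ s ∈ uIcc (a - d) (b - d), f (s + d) = f a + ∫ x in (a - d)..s, deriv f (x + d) := by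
    intro s hs
    rw [uIcc_of_le (by linarith)] at hs
    have h1 := (hf.mono (c := a) (d := s + d) (by
      rw [uIcc_of_le hab, uIcc_of_le (by linarith [hs.1])]
      exact Icc_subset_Icc_right (by linarith [hs.2]))).integral_deriv_complex
    rw [intervalIntegral.integral_comp_add_right (deriv f), sub_add_cancel, h1]
    ring
  rw [e s hs, e t ht, dist_add_left]

theorem integral_norm_le_l2Norm {a b : ℝ} (hab : a ≤ b) {f : ℝ → ℂ}
    (hf : MemLp f 2 (volume.restrict (Ioo a b))) :
    ∫ t in Ioo a b, ‖f t‖ ≤ Real.sqrt (b - a) * l2Norm (Ioo a b) f := by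
  have hCS := integral_mul_le_Lp_mul_Lq_of_nonneg (μ := volume.restrict (Ioo a b))
    (p := 2) (q := 2) Real.HolderConjugate.two_two
    (f := fun _ => (1 : ℝ)) (g := fun s => ‖f s‖)
    (ae_of_all _ fun s => zero_le_one) (ae_of_all _ fun s => norm_nonneg _)
    (memLp_const _) (by simpa using hf.norm)
  have hsq := l2Norm_sq hf
  simp only [one_mul, Real.rpow_ofNat, ← hsq] at hCS
  refine hCS.trans_eq ?_
  rw [← Real.sqrt_eq_rpow, ← Real.sqrt_eq_rpow, Real.sqrt_sq (l2Norm_nonneg _ _)]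
  congr 2
  simp [hab]

theorem l2Norm_le_normW2 {n : ℕ} {f : ℝ → ℂ} {a b : ℝ} {k : ℕ} (hk : k ≤ n)
    (hf : MemLp (derivOn k f a b) 2 (volume.restrict (Ioo a b))) :
    l2Norm (Ioo a b) (derivOn k f a b) ≤ normW2 n f a b := by
  refine Real.le_sqrt_of_sq_le ?_
  rw [l2Norm_sq hf]
  exact Finset.single_le_sum (f := fun k => ∫ t in Ioo a b, ‖derivOn k f a b t‖ ^ 2)
    (fun k _ => setIntegral_nonneg measurableSet_Ioo fun t _ => by positivity)
    (Finset.mem_range.2 (Nat.lt_succ_of_le hk))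

theorem MemW2.memLp {n : ℕ} {f : ℝ → ℂ} {a b : ℝ} (hab : a ≤ b) (hf : MemW2 n f a b) {k : ℕ}
    (hk : k ≤ n) : MemLp (derivOn k f a b) 2 (volume.restrict (Ioo a b)) := by
  rcases hk.eq_or_lt with rfl | hk
  · exact hf.2
  · have hc := (hf.1 k hk).continuousOn
    rw [uIcc_of_le hab] at hc
    obtain ⟨C, hC⟩ := isCompact_Icc.exists_bound_of_continuousOn hc
    refine MemLp.of_bound ((hc.mono Ioo_subset_Icc_self).aestronglyMeasurable measurableSet_Ioo)
      C ?_
    filter_upwards [ae_restrict_mem measurableSet_Ioo] with s hs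
    exact hC s (Ioo_subset_Icc_self hs)

/-- Bound of the values of the lower derivatives at the left end point. -/
theorem MemW2.norm_derivOn_left_le {n : ℕ} {f : ℝ → ℂ} {a b : ℝ} (hab : a < b)
    (hf : MemW2 n f a b) {i : ℕ} (hi : i < n) :
    ‖derivOn (n - (i + 1)) f a b a‖ ≤
      (1 / Real.sqrt (b - a) + Real.sqrt (b - a)) * normW2 n f a b := by
  have hJ := IsJet.of_memW2 hf hab
  set F : ℕ → ℝ → ℂ := fun i => derivOn (n - i) f a b
  have hm : ∀ i, MemLp (F i) 2 (volume.restrict (Ioo a b)) := fun i => hf.memLp hab.le (by omega)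
  have hI : ∀ i, Integrable (fun t => ‖F i t‖) (volume.restrict (Ioo a b)) := fun i =>
    ((hm i).integrable one_le_two).norm
  have hb : ∀ i, ∫ t in Ioo a b, ‖F i t‖ ≤ Real.sqrt (b - a) * normW2 n f a b := fun i =>
    (integral_norm_le_l2Norm hab.le (hm i)).trans (mul_le_mul_of_nonneg_left
      (l2Norm_le_normW2 (by omega) (hm i)) (Real.sqrt_nonneg _))
  have hpt : ∀ t ∈ Ioo a b, ‖F (i + 1) a‖ ≤ ‖F (i + 1) t‖ + ∫ s in Ioo a b, ‖F i s‖ := by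
    intro t ht
    have h1 := hJ.primitive i hi t (Ioo_subset_Icc_self ht)
    have h2 : F (i + 1) a = F (i + 1) t - ∫ s in a..t, F i s := by rw [h1]; ring
    have h3 : ‖∫ s in a..t, F i s‖ ≤ ∫ s in Ioo a b, ‖F i s‖ := by
      refine (intervalIntegral.norm_integral_le_integral_norm ht.1.le).trans ?_
      rw [intervalIntegral.integral_of_le ht.1.le, integral_Ioc_eq_integral_Ioo]
      exact setIntegral_mono_set (hI i) (ae_of_all _ fun s => norm_nonneg _)
        (Ioo_subset_Ioo_right ht.2.le).eventuallyLE
    rw [h2]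
    exact (norm_sub_le _ _).trans (add_le_add le_rfl h3)
  -- The bound of the end value by the value at `t` is averaged over `t`; together with
  -- Cauchy–Schwarz this gives both terms of the constant.
  have hint : ∫ _ in Ioo a b, ‖F (i + 1) a‖ ≤
      ∫ t in Ioo a b, (‖F (i + 1) t‖ + ∫ s in Ioo a b, ‖F i s‖) :=
    setIntegral_mono_on (integrable_const _) ((hI _).add (integrable_const _)) measurableSet_Ioo hpt
  rw [integral_add (hI _) (integrable_const _)] at hint
  simp only [setIntegral_const, Real.volume_real_Ioo_of_le hab.le, smul_eq_mul] at hint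
  have hd : 0 < b - a := sub_pos.2 hab
  have hs : 0 < Real.sqrt (b - a) := Real.sqrt_pos.2 hd
  have hss : Real.sqrt (b - a) * Real.sqrt (b - a) = b - a := Real.mul_self_sqrt hd.le
  have h4 : (b - a) * ‖F (i + 1) a‖ ≤ Real.sqrt (b - a) * normW2 n f a b +
      (b - a) * (Real.sqrt (b - a) * normW2 n f a b) :=
    hint.trans (add_le_add (hb _) (mul_le_mul_of_nonneg_left (hb _) hd.le))
  have h5 : (b - a) * ((1 / Real.sqrt (b - a) + Real.sqrt (b - a)) * normW2 n f a b) =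
      Real.sqrt (b - a) * normW2 n f a b + (b - a) * (Real.sqrt (b - a) * normW2 n f a b) := by
    have : (b - a) * (1 / Real.sqrt (b - a)) = Real.sqrt (b - a) := by
      rw [mul_one_div, div_eq_iff hs.ne', hss]
    rw [← mul_assoc, mul_add, this]; ring
  rw [← h5] at h4
  exact le_of_mul_le_mul_left h4 hd

/-- There are `n + 1` squared norms; the one of order `n` is at most `M ^ 2`, each of the others at
most `(b - a) * M ^ 2`. -/
theorem IsJet.normW2_le {n : ℕ} {F : ℕ → ℝ → ℂ} {a b M : ℝ} (h : IsJet n F a b) (hab : a < b)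
    {f : ℝ → ℂ} (hf : EqOn f (F n) (Icc a b)) (hM : 0 ≤ M)
    (hF : MemLp (F 0) 2 (volume.restrict (Ioo a b)))
    (h0 : l2Norm (Ioo a b) (F 0) ≤ M) (hs : ∀ l < n, ∀ t ∈ Ioo a b, ‖F (l + 1) t‖ ≤ M) :
    normW2 n f a b ≤ Real.sqrt ((n + 1) * (1 + (b - a))) * M := by
  have hd : 0 < b - a := sub_pos.2 hab
  have hk : ∀ k ∈ Finset.range (n + 1), ∫ t in Ioo a b, ‖derivOn k f a b t‖ ^ 2 ≤
      (1 + (b - a)) * M ^ 2 := by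
    intro k hk
    rcases (Nat.lt_succ_iff.1 (Finset.mem_range.1 hk)).eq_or_lt with rfl | hk
    · have e : ∫ t in Ioo a b, ‖derivOn k f a b t‖ ^ 2 = l2Norm (Ioo a b) (F 0) ^ 2 := by
        rw [l2Norm_sq hF]
        refine setIntegral_congr_ae measurableSet_Ioo ?_
        filter_upwards [h.derivOn_top_ae hab hf] with t ht hm
        rw [ht hm]
      rw [e]
      have := pow_le_pow_left₀ (l2Norm_nonneg _ _) h0 2
      nlinarith [sq_nonneg M]
    · obtain ⟨l, hl⟩ : ∃ l, n - k = l + 1 := ⟨n - k - 1, by omega⟩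
      have e : ∫ t in Ioo a b, ‖derivOn k f a b t‖ ^ 2 ≤ ∫ t in Ioo a b, M ^ 2 := by
        refine integral_mono_of_nonneg (ae_of_all _ fun t => by positivity)
          (integrable_const _) ?_
        filter_upwards [ae_restrict_mem measurableSet_Ioo] with t ht
        rw [h.derivOn_eq hab hf hk (Ioo_subset_Icc_self ht), hl]
        exact pow_le_pow_left₀ (norm_nonneg _) (hs l (by omega) t ht) 2
      refine e.trans ?_
      rw [setIntegral_const, Real.volume_real_Ioo_of_le hab.le, smul_eq_mul]
      nlinarith [sq_nonneg M]
  have hsum := Finset.sum_le_sum hk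
  rw [Finset.sum_const, Finset.card_range, nsmul_eq_mul] at hsum
  refine (Real.sqrt_le_sqrt hsum).trans_eq ?_
  push_cast
  rw [← mul_assoc, Real.sqrt_mul (by positivity), Real.sqrt_sq hM]

theorem IsJet.eq_zero_of_eqOn_zero {n : ℕ} {F : ℕ → ℝ → ℂ} {a b : ℝ} (h : IsJet n F a b)
    (hab : a < b) (hF : EqOn (F n) 0 (Icc a b)) :
    (∀ l < n, EqOn (F (l + 1)) 0 (Icc a b)) ∧ ∀ᵐ t : ℝ, t ∈ Ioo a b → F 0 t = 0 := by
  have hz : ∀ k, derivOn k (0 : ℝ → ℂ) a b = 0 := fun k => by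
    unfold derivOn
    induction k with
    | zero => funext t; simp
    | succ k ih => funext t; rw [iteratedDerivWithin_succ, ih]; simp
  refine ⟨fun l hl t ht => ?_, ?_⟩
  · have := h.derivOn_eq hab hF.symm (k := n - (l + 1)) (by omega) ht
    rw [hz, show n - (n - (l + 1)) = l + 1 by omega] at this
    exact this.symm
  · filter_upwards [h.derivOn_top_ae hab hF.symm] with t ht hm
    rw [← ht hm, hz]; rfl

/-! ### Functions on the graph and path coordinates -/

namespace StarProblem

variable {r n : ℕ} (P : StarProblem r n)

theorem edgeStart_succ {τ : ℝ} (ν : Fin r) : edgeStart τ ν.succ = 0 := by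
  simp [edgeStart, Fin.succ_ne_zero]

theorem edgeStart_zero {τ : ℝ} : edgeStart τ (0 : Fin (r + 1)) = -τ := by simp [edgeStart]

/-- The components of `y` and their derivatives are given by the data `w`. -/
structure Rep (y : Fin (r + 1) → ℝ → ℂ) (w : P.Pre × P.Ctl) : Prop where
  lower : ∀ j, ∀ l < n, ∀ s ∈ Icc (-P.τ) (P.off j + P.T j),
    edgeDeriv P.τ P.T y j (n - (l + 1)) (s - P.off j) = P.path w j (l + 1) s
  upper : ∀ j, ∀ᵐ s : ℝ, s ∈ Ioo (-P.τ) (P.off j + P.T j) →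
    edgeDeriv P.τ P.T y j n (s - P.off j) = P.path w j 0 s
  terminal : P.endAll w = 0

theorem top_of_ge (w : P.Pre × P.Ctl) (ν : Fin r) {s : ℝ} (hs : P.tip ν.succ ≤ s) :
    P.top w ν.succ s = 0 := by
  have hle := P.off_lt_tip ν.succ
  rw [off_succ] at hle
  have hT := P.T_pos 0
  have h1 : s ∉ Ioo (-P.τ) 0 := fun h => by linarith [h.2]
  have h2 : s ∉ P.act 0 := fun h => by
    have := h.2
    rw [tip_zero] at this; linarith
  have h3 : s ∉ P.act ν.succ := fun h => by linarith [h.2]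
  simp [top, zeroExt_of_notMem h1, zeroExt_of_notMem h2, zeroExt_of_notMem h3]

theorem path_of_ge {w : P.Pre × P.Ctl} (hw : P.endAll w = 0) (ν : Fin r) {l : ℕ} (hl : l ≤ n)
    {s : ℝ} (hs : P.tip ν.succ ≤ s) : P.path w ν.succ l s = 0 := by
  cases l with
  | zero => exact P.top_of_ge w ν hs
  | succ l =>
    have h1 := (P.isJet_path w ν.succ s).mono_left (P.neg_τ_le_tip ν.succ) hs
    have h0 : IsJet n (fun _ _ => (0 : ℂ)) (P.tip ν.succ) s :=
      ⟨intervalIntegrable_const, fun i _ t _ => by simp⟩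
    exact h0.eqOn h1 (ae_of_all _ fun t ht => P.top_of_ge w ν ht.1.le)
      (fun i hi => congrFun hw (ν, ⟨i, hi⟩)) (by omega) ⟨hs, le_rfl⟩

/-- Past the tip a path with zero terminal values has zero top derivative, so it vanishes
identically and the cut-off changes nothing. The cut-off acts only on data that violate the terminal
conditions. -/
theorem indicator_path {w : P.Pre × P.Ctl} (hw : P.endAll w = 0) (j : Fin (r + 1)) {l : ℕ}
    (hl : l ≤ n) {s : ℝ} (hs : s < P.off j + P.T j) :
    (Iio (P.tip j)).indicator (P.path w j l) s = P.path w j l s := by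
  by_cases h : s < P.tip j
  · exact indicator_of_mem (show s ∈ Iio (P.tip j) from h) _
  · rw [indicator_of_notMem (show s ∉ Iio (P.tip j) from h)]
    revert hs h
    refine Fin.cases ?_ (fun ν => ?_) j
    · intro hs h
      rw [off_zero, zero_add] at hs
      rw [tip_zero] at h
      exact absurd hs h
    · intro _ h
      exact (P.path_of_ge hw ν hl (not_lt.1 h)).symm

theorem ae_edge_of_ae {p : ℝ → Prop} (h : ∀ᵐ s : ℝ, p s) (d : ℝ) : ∀ᵐ s : ℝ, p (s + d) :=
  (measurePreserving_add_right volume d).quasiMeasurePreserving.ae h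

variable {P}

theorem Rep.edgeDeriv_ae {y : Fin (r + 1) → ℝ → ℂ} {w : P.Pre × P.Ctl} (h : P.Rep y w)
    (j : Fin (r + 1)) : ∀ᵐ s : ℝ, s ∈ Ioo (-P.τ) (P.off j + P.T j) → ∀ l ≤ n,
      edgeDeriv P.τ P.T y j (n - l) (s - P.off j) = P.path w j l s := by
  filter_upwards [h.upper j] with s hs hm l hl
  cases l with
  | zero => exact hs hm
  | succ l => exact h.lower j l hl s (Ioo_subset_Icc_self hm)

theorem Rep.ell_ae {y : Fin (r + 1) → ℝ → ℂ} {w : P.Pre × P.Ctl} (h : P.Rep y w)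
    (j : Fin (r + 1)) : ∀ᵐ s : ℝ, s ∈ P.edge j →
      ell n P.τ P.T P.b P.c y j (s - P.off j) = P.ellFun w j s := by
  have h1 := ae_edge_of_ae (h.edgeDeriv_ae j) (-P.τ)
  filter_upwards [h.edgeDeriv_ae j, h1] with s h1 h2 hs
  have hτ := P.hτ
  have ho := P.off_nonneg j
  have h1' := h1 ⟨by linarith [hs.1], hs.2⟩
  have h2' := h2 ⟨by linarith [hs.1], by linarith [hs.2]⟩
  -- Reversing the sum passes from orders to codegrees.
  rw [ell, ← Finset.sum_range_reflect, ellFun, pathEll]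
  refine Finset.sum_congr rfl fun l hl => ?_
  have hl' : l ≤ n := Nat.lt_succ_iff.1 (Finset.mem_range.1 hl)
  rw [show n + 1 - 1 - l = n - l by omega, h1' l hl',
    show s - P.off j - P.τ = s + -P.τ - P.off j by ring, h2' l hl', delayTerm, delayTerm,
    sub_zero, P.indicator_path h.terminal j hl' hs.2,
    P.indicator_path h.terminal j hl' (by linarith [hs.2]), ← sub_eq_add_neg]
  rfl

theorem Rep.zeroExt_ae {y : Fin (r + 1) → ℝ → ℂ} {w : P.Pre × P.Ctl} (h : P.Rep y w)
    (j : Fin (r + 1)) : ∀ᵐ s : ℝ, s ∈ P.edge j →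
      zeroExt (P.ellAll w j) s = ell n P.τ P.T P.b P.c y j (s - P.off j) := by
  have h1 := P.ellOp_ae w j
  rw [Filter.EventuallyEq, ae_restrict_iff' (P.measurableSet_edge j)] at h1
  filter_upwards [h.ell_ae j, h1] with s h2 h3 hs
  rw [h2 hs, zeroExt_of_mem hs, ellAll_apply, h3 hs]

/-- On the entering edge the sum over all paths reproduces the case distinction in `ellAdj`: before
`T 0 - τ` the shifted point `s + τ` still lies on the entering edge, afterwards on every outgoing
edge, and the extensions by zero select the surviving terms. -/
theorem Rep.ellAdj_ae {y : Fin (r + 1) → ℝ → ℂ} {w : P.Pre × P.Ctl} (h : P.Rep y w)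
    (j : Fin (r + 1)) : ∀ᵐ s : ℝ, s ∈ Ioo (P.off j) (P.tip j) → ∀ l ≤ n,
      ellAdj n P.τ P.T P.b P.c y (n - l) j (s - P.off j) = P.adjAll (P.ellAll w) j l s := by
  have hZ := ae_all_iff.2 h.zeroExt_ae
  -- At this time the shifted point is the vertex itself, which belongs to none of the open edges.
  have hne : ∀ᵐ s : ℝ, s ≠ P.T 0 - P.τ := by
    rw [ae_iff]; simp
  filter_upwards [hZ, ae_edge_of_ae hZ P.τ, hne] with s h1 h2 hne hs l hl
  have hτ := P.hτ
  have hedge := P.act_subset j hs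
  revert hs hedge
  refine Fin.cases ?_ (fun ν => ?_) j
  · intro hs hedge
    rw [adjAll, if_pos rfl, Fin.sum_univ_succ, adj, h1 0 hedge]
    have hs0 : 0 < s := by simpa using hs.1
    have hsT : s < P.T 0 := by simpa using hs.2
    have hz : ∀ ν : Fin r, zeroExt (P.ellAll w ν.succ) s = 0 := fun ν =>
      zeroExt_of_notMem fun h => by
        have := h.1
        rw [off_succ] at this; linarith
    simp only [ellAdj, off_zero, sub_zero, true_and]
    by_cases hlt : P.T 0 - P.τ < s
    · rw [if_pos hlt]
      have hz0 : zeroExt (P.ellAll w 0) (s + P.τ) = 0 := zeroExt_of_notMem fun h => by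
        have := h.2
        rw [off_zero] at this; linarith
      rw [hz0, mul_zero, add_zero]
      congr 1
      · simp [β]
      refine Finset.sum_congr rfl fun ν _ => ?_
      have hT := P.hT ν.succ
      rw [adj, hz ν, mul_zero, zero_add, h2 ν.succ]
      · simp [γ]
      · exact ⟨by rw [off_succ]; linarith, by rw [off_succ]; linarith⟩
    · rw [if_neg hlt]
      have hlt' : s < P.T 0 - P.τ := lt_of_le_of_ne (not_lt.1 hlt) hne
      rw [Finset.sum_eq_zero, add_zero, h2 0]
      · simp [β, γ]
      · exact ⟨by rw [off_zero]; linarith, by rw [off_zero]; linarith⟩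
      · intro ν _
        have hz' : zeroExt (P.ellAll w ν.succ) (s + P.τ) = 0 := zeroExt_of_notMem fun h => by
          have := h.1
          rw [off_succ] at this; linarith
        rw [adj, hz ν, hz', mul_zero, mul_zero, add_zero]
  · intro hs hedge
    have hs2 := hs.2
    rw [tip_succ] at hs2
    have hs1 := hs.1
    rw [off_succ] at hs1
    rw [adjAll, if_neg (Fin.succ_ne_zero ν), adj, h1 ν.succ hedge, h2 ν.succ
      ⟨by rw [off_succ]; linarith, by rw [off_succ]; linarith⟩, ellAdj,
      if_neg (by simp [Fin.succ_ne_zero])]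
    simp only [β, γ, show s - P.off ν.succ + P.τ = s + P.τ - P.off ν.succ by ring]

variable (P)

/-! ### From data to functions on the graph -/

/-- The functions on the edges determined by the data. -/
noncomputable def comp (w : P.Pre × P.Ctl) (j : Fin (r + 1)) (t : ℝ) : ℂ :=
  P.path w j n (t + P.off j)

theorem isJet_shift (w : P.Pre × P.Ctl) (j : Fin (r + 1)) {p q : ℝ} (hp : edgeStart P.τ j ≤ p)
    (hpq : p ≤ q) : IsJet n (fun l t => P.path w j l (t + P.off j)) p q := by
  have hτ := P.hτ
  have hT := P.T_pos 0
  have h0 : -P.τ ≤ p + P.off j := by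
    revert hp
    refine Fin.cases ?_ (fun ν => ?_) j
    · rw [edgeStart_zero, off_zero]; intro h; linarith
    · rw [edgeStart_succ, off_succ]; intro h; linarith
  have h := ((P.isJet_path w j (q + P.off j)).mono_left h0 (by linarith)).comp_add (P.off j)
  rwa [add_sub_cancel_right, add_sub_cancel_right] at h

theorem edgeStart_lt (j : Fin (r + 1)) : edgeStart P.τ j < P.T j := by
  have := P.T_pos j
  have := P.hτ
  unfold edgeStart; split_ifs <;> linarith

theorem memLp_shift (w : P.Pre × P.Ctl) (j : Fin (r + 1)) (p q : ℝ) :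
    MemLp (fun t => P.path w j 0 (t + P.off j)) 2 (volume.restrict (Ioo p q)) :=
  ((P.memLp_top w j).comp_measurePreserving
    (measurePreserving_add_right volume (P.off j))).mono_measure Measure.restrict_le_self

theorem memW2_comp (w : P.Pre × P.Ctl) (j : Fin (r + 1)) :
    MemW2 n (P.comp w j) (edgeStart P.τ j) (P.T j) :=
  (P.isJet_shift w j le_rfl (P.edgeStart_lt j).le).memW2 (P.edgeStart_lt j)
    (fun _ _ => rfl) (P.memLp_shift w j _ _)

theorem derivOn_comp (w : P.Pre × P.Ctl) (j : Fin (r + 1)) {l : ℕ} (hl : l < n) {t : ℝ}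
    (ht : t ∈ Icc (edgeStart P.τ j) (P.T j)) :
    derivOn (n - (l + 1)) (P.comp w j) (edgeStart P.τ j) (P.T j) t =
      P.path w j (l + 1) (t + P.off j) := by
  have := (P.isJet_shift w j le_rfl (P.edgeStart_lt j).le).derivOn_eq (P.edgeStart_lt j)
    (f := P.comp w j) (fun _ _ => rfl) (k := n - (l + 1)) (by omega) ht
  rwa [show n - (n - (l + 1)) = l + 1 by omega] at this

theorem derivOn_comp_top (w : P.Pre × P.Ctl) (j : Fin (r + 1)) : ∀ᵐ t : ℝ,
    t ∈ Ioo (edgeStart P.τ j) (P.T j) →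
    derivOn n (P.comp w j) (edgeStart P.τ j) (P.T j) t = P.path w j 0 (t + P.off j) :=
  (P.isJet_shift w j le_rfl (P.edgeStart_lt j).le).derivOn_top_ae (P.edgeStart_lt j)
    (f := P.comp w j) (fun _ _ => rfl)

theorem rep_comp {w : P.Pre × P.Ctl} (hw : P.endAll w = 0) : P.Rep (P.comp w) w where
  terminal := hw
  lower j l hl s hs := by
    have hT := P.T_pos 0
    unfold edgeDeriv
    split_ifs with h
    · have ho : P.off j = P.T 0 := by simp [off, h.1]
      have h2 := h.2
      have hm : s ∈ Icc (edgeStart P.τ (0 : Fin (r + 1))) (P.T 0) :=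
        ⟨by rw [edgeStart_zero]; exact hs.1, by rw [ho] at h2; linarith⟩
      have := P.derivOn_comp w 0 hl hm
      rw [edgeStart_zero] at this hm
      rw [ho, sub_add_cancel, this, off_zero, add_zero]
      exact (P.path_eq_of_le w j (l + 1) hm).symm
    · have hm : s - P.off j ∈ Icc (edgeStart P.τ j) (P.T j) := by
        refine ⟨?_, by linarith [hs.2]⟩
        by_cases hj : j = 0
        · subst hj; rw [edgeStart_zero, off_zero, sub_zero]; exact hs.1
        · have : ¬ s - P.off j < 0 := fun h' => h ⟨hj, h'⟩
          simpa [edgeStart, hj] using this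
      rw [P.derivOn_comp w j hl hm, sub_add_cancel]
  upper j := by
    have h1 := ae_edge_of_ae (P.derivOn_comp_top w j) (-P.off j)
    have hne : ∀ᵐ s : ℝ, s ≠ P.off j := by rw [ae_iff]; simp
    filter_upwards [P.derivOn_comp_top w 0, h1, hne] with s h0 h1 hne hs
    have hT := P.T_pos 0
    unfold edgeDeriv
    split_ifs with h
    · have ho : P.off j = P.T 0 := by simp [off, h.1]
      have h2 := h.2
      have hm : s ∈ Ioo (edgeStart P.τ (0 : Fin (r + 1))) (P.T 0) :=
        ⟨by rw [edgeStart_zero]; exact hs.1, by rw [ho] at h2; linarith⟩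
      have := h0 hm
      rw [edgeStart_zero] at this hm
      rw [ho, sub_add_cancel, this, off_zero, add_zero]
      exact (P.path_eq_of_le w j 0 (Ioo_subset_Icc_self hm)).symm
    · rw [← sub_eq_add_neg] at h1
      rw [h1 ⟨?_, by linarith [hs.2]⟩, sub_add_cancel]
      by_cases hj : j = 0
      · subst hj; rw [edgeStart_zero, off_zero, sub_zero]; exact hs.1
      · have : ¬ s - P.off j < 0 := fun h' => h ⟨hj, h'⟩
        have h3 : s - P.off j ≠ 0 := sub_ne_zero.2 hne
        simpa [edgeStart, hj] using lt_of_le_of_ne (not_lt.1 this) h3.symm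

/-- The prehistory data of a function on `[-τ, 0]`. -/
noncomputable def pre {φ : ℝ → ℂ} (hφ : MemW2 n φ (-P.τ) 0) : P.Pre :=
  (fun i => derivOn (n - (i + 1)) φ (-P.τ) 0 (-P.τ), hφ.2.toLp _)

theorem pre_top_ae {φ : ℝ → ℂ} (hφ : MemW2 n φ (-P.τ) 0) (u : P.Ctl) (j : Fin (r + 1)) :
    ∀ᵐ s : ℝ, s ∈ Ioo (-P.τ) 0 → P.top (P.pre hφ, u) j s = derivOn n φ (-P.τ) 0 s := by
  have h := zeroExt_toLp measurableSet_Ioo hφ.2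
  filter_upwards [h] with s h hs
  have h1 : ∀ i, s ∉ P.act i := fun i hi => by linarith [hi.1, hs.2, P.off_nonneg i]
  rw [indicator_of_mem hs] at h
  rw [← h]
  simp only [top, Pi.add_apply, pre]
  rw [zeroExt_of_notMem (h1 0)]
  split_ifs
  · simp
  · rw [zeroExt_of_notMem (h1 j)]; simp

theorem path_pre {φ : ℝ → ℂ} (hφ : MemW2 n φ (-P.τ) 0) (u : P.Ctl) (j : Fin (r + 1)) {l : ℕ}
    (hl : l < n) {s : ℝ} (hs : s ∈ Icc (-P.τ) 0) :
    P.path (P.pre hφ, u) j (l + 1) s = derivOn (n - (l + 1)) φ (-P.τ) 0 s := by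
  have hJ := IsJet.of_memW2 hφ (by linarith [P.hτ])
  exact hJ.eqOn (P.isJet_path (P.pre hφ, u) j 0) (P.pre_top_ae hφ u j) (fun i hi => by
    unfold path
    rw [jet_succ_self]
    simp [pre, finExt, hi]) hl hs

/-- The functions determined by the data satisfy all conditions except for the equations. -/
theorem isSolution_comp {φ : ℝ → ℂ} (hφ : MemW2 n φ (-P.τ) 0) {u : P.Ctl}
    (hw : P.endAll (P.pre hφ, u) = 0)
    (heq : ∃ q : Fin (r + 1) → ℕ → ℝ → ℂ,
      IsQuasiDeriv n P.τ P.T P.b P.c (P.comp (P.pre hφ, u)) q ∧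
      (∀ j, ∀ᵐ t ∂volume.restrict (Ioo 0 (eqEnd P.τ P.T j)), q j n t = 0) ∧
      ∀ l < n, q 0 l (P.T 0) = ∑ ν : Fin r, q ν.succ l 0) :
    IsSolution n P.τ P.T P.b P.c φ (P.comp (P.pre hφ, u)) where
  memW2 j := P.memW2_comp _ j
  prehistory t ht := by
    have hn := P.hn
    have := P.path_pre hφ u 0 (l := n - 1) (by omega) (Ioo_subset_Icc_self ht)
    rw [show n - 1 + 1 = n by omega, Nat.sub_self] at this
    rw [comp, off_zero, add_zero, this]
    simp [derivOn]
  initial k hk := by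
    have hτ := P.hτ
    have hT := P.T_pos 0
    have h1 := P.derivOn_comp (P.pre hφ, u) 0 (l := n - k - 1) (by omega) (t := 0)
      ⟨by rw [edgeStart_zero]; linarith, hT.le⟩
    rw [show n - (n - k - 1 + 1) = k by omega, edgeStart_zero, off_zero, add_zero,
      P.path_pre hφ u 0 (by omega) ⟨by linarith, le_rfl⟩,
      show n - (n - k - 1 + 1) = k by omega] at h1
    exact h1
  continuity ν k hk := by
    have hτ := P.hτ
    have hT := P.T_pos 0
    have h1 := P.derivOn_comp (P.pre hφ, u) ν.succ (l := n - k - 1) (by omega) (t := 0)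
      ⟨by rw [edgeStart_succ], (P.T_pos _).le⟩
    have h2 := P.derivOn_comp (P.pre hφ, u) 0 (l := n - k - 1) (by omega) (t := P.T 0)
      ⟨by rw [edgeStart_zero]; linarith, le_rfl⟩
    rw [show n - (n - k - 1 + 1) = k by omega, edgeStart_succ, off_succ, zero_add] at h1
    rw [show n - (n - k - 1 + 1) = k by omega, edgeStart_zero, off_zero, add_zero] at h2
    rw [h1, h2, P.path_eq_of_le _ _ _ ⟨by linarith, le_rfl⟩]
  equilibrium ν t ht := P.path_of_ge hw ν le_rfl (by
    rw [tip_succ, off_succ]; linarith [ht.1])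
  equation := heq

end StarProblem

/-! ### The equations as an orthogonality condition -/

namespace StarProblem

variable {r n : ℕ} (P : StarProblem r n)

theorem tip_eq (j : Fin (r + 1)) : P.tip j = P.off j + eqEnd P.τ P.T j := rfl

theorem ae_edge_of_ae_path (j : Fin (r + 1)) {p : ℝ → Prop}
    (h : ∀ᵐ s : ℝ, s ∈ Ioo (P.off j) (P.tip j) → p s) :
    ∀ᵐ t ∂volume.restrict (Ioo 0 (eqEnd P.τ P.T j)), p (t + P.off j) := by
  rw [← ae_restrict_iff' measurableSet_Ioo] at h
  have hm := measurePreserving_add_Ioo (P.off j) 0 (eqEnd P.τ P.T j)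
  rw [add_zero, ← tip_eq] at hm
  exact hm.quasiMeasurePreserving.ae h

theorem ae_path_of_ae_edge (j : Fin (r + 1)) {p : ℝ → Prop}
    (h : ∀ᵐ t ∂volume.restrict (Ioo 0 (eqEnd P.τ P.T j)), p t) :
    ∀ᵐ s : ℝ, s ∈ Ioo (P.off j) (P.tip j) → p (s - P.off j) := by
  rw [← ae_restrict_iff' measurableSet_Ioo]
  have hm := measurePreserving_sub_Ioo (P.off j) 0 (eqEnd P.τ P.T j)
  rw [add_zero, ← tip_eq] at hm
  exact hm.quasiMeasurePreserving.ae h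

variable {P}

/-- The quasi-derivatives are the chain furnished by the Lagrange multipliers, moved back to edge
time; the Kirchhoff-type conditions are its vertex relation. -/
theorem Rep.exists_isQuasiDeriv {y : Fin (r + 1) → ℝ → ℂ} {w : P.Pre × P.Ctl} (h : P.Rep y w)
    (hw : ∀ u, P.E u = 0 → inner ℂ (P.ellAll w) (P.A u) = 0) :
    ∃ q : Fin (r + 1) → ℕ → ℝ → ℂ, IsQuasiDeriv n P.τ P.T P.b P.c y q ∧
      (∀ j, ∀ᵐ t ∂volume.restrict (Ioo 0 (eqEnd P.τ P.T j)), q j n t = 0) ∧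
      ∀ l < n, q 0 l (P.T 0) = ∑ ν : Fin r, q ν.succ l 0 := by
  obtain ⟨m, R, hR, hR0⟩ := P.exists_chain_of_orthogonal _ hw
  have hadj : ∀ j, ∀ᵐ t ∂volume.restrict (Ioo 0 (eqEnd P.τ P.T j)), ∀ l ≤ n,
      ellAdj n P.τ P.T P.b P.c y (n - l) j t = P.adjAll (P.ellAll w) j l (t + P.off j) := by
    intro j
    filter_upwards [P.ae_edge_of_ae_path j (h.ellAdj_ae j)] with t ht
    simpa using ht
  refine ⟨fun j l t => R j l (t + P.off j), ⟨fun j => ?_, fun j l hl => ?_, fun j l hl => ?_⟩,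
    fun j => ae_of_all _ fun t => congrFun (hR.last j) _, fun l hl => ?_⟩
  · filter_upwards [hadj j, P.ae_edge_of_ae_path j (hR0 j)] with t h1 h2
    rw [← h2, ← h1 0 (Nat.zero_le n), Nat.sub_zero]
  · filter_upwards [hadj j, P.ae_edge_of_ae_path j
      ((hR.ae_eq j hl).mono fun s hs _ => hs)] with t h1 h2
    rw [h1 (l + 1) hl, h2, deriv_comp_add_const]
    ring
  · have h1 := (hR.absCont j hl (P.off j) (P.tip j)).comp_add_right
      (P.off_lt_tip j).le (P.off j)
    rwa [sub_self, tip_eq, add_sub_cancel_left] at h1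
  · have := hR.vertex l hl
    rw [tip_zero] at this
    simp only [off_zero, add_zero, off_succ, zero_add] at this ⊢
    exact this

/-- The converse direction: the quasi-derivatives in path time form a chain, and integration by
parts leaves only tip terms, which vanish because `E u = 0`. -/
theorem Rep.orthogonal {y : Fin (r + 1) → ℝ → ℂ} {w : P.Pre × P.Ctl} (h : P.Rep y w)
    {q : Fin (r + 1) → ℕ → ℝ → ℂ} (hq : IsQuasiDeriv n P.τ P.T P.b P.c y q)
    (hn : ∀ j, ∀ᵐ t ∂volume.restrict (Ioo 0 (eqEnd P.τ P.T j)), q j n t = 0)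
    (hv : ∀ l < n, q 0 l (P.T 0) = ∑ ν : Fin r, q ν.succ l 0)
    {u : P.Ctl} (hu : P.E u = 0) : inner ℂ (P.ellAll w) (P.A u) = 0 := by
  rw [← inner_conj_symm, P.inner_A_eq_zero_of_chain (P.ellAll w)
    (q := fun j l s => q j l (s - P.off j)) ?_ ?_ ?_ ?_ ?_ hu, map_zero]
  · intro j l hl
    have h1 := AbsolutelyContinuousOnInterval.comp_add_right (hq.absCont j l hl)
      (by have := P.off_lt_tip j; rw [tip_eq] at this; linarith) (-P.off j)
    rwa [zero_sub, neg_neg, sub_neg_eq_add, add_comm (eqEnd _ _ _), ← tip_eq] at h1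
  · intro j
    filter_upwards [h.ellAdj_ae j, P.ae_path_of_ae_edge j (hq.first j)] with s h1 h2 hs
    rw [h2 hs, ← h1 hs 0 (Nat.zero_le n), Nat.sub_zero]
  · intro j l hl
    filter_upwards [h.ellAdj_ae j, P.ae_path_of_ae_edge j (hq.next j l hl)] with s h1 h2 hs
    rw [h2 hs, ← h1 hs (l + 1) hl, deriv_comp_sub_const]
    ring
  · intro j
    exact P.ae_path_of_ae_edge j (hn j)
  · intro l hl
    simpa [tip_zero] using hv l hl

/-! ### From functions on the graph to data -/

variable (P)

/-- The jets on the entering and the outgoing edge are glued at the vertex. The continuity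
conditions serve to replace the value at the joint, which `edgeDeriv` takes from the outgoing edge.
-/
theorem isJet_edgeDeriv {y : Fin (r + 1) → ℝ → ℂ}
    (hy : ∀ j, MemW2 n (y j) (edgeStart P.τ j) (P.T j))
    (hc : ∀ ν : Fin r, ∀ k < n,
      derivOn k (y ν.succ) 0 (P.T ν.succ) 0 = derivOn k (y 0) (-P.τ) (P.T 0) (P.T 0))
    (j : Fin (r + 1)) :
    IsJet n (fun l s => edgeDeriv P.τ P.T y j (n - l) (s - P.off j)) (-P.τ)
      (P.off j + P.T j) := by
  have hJ := fun j => IsJet.of_memW2 (hy j) (P.edgeStart_lt j)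
  have hτ := P.hτ
  have hT := P.T_pos 0
  have h0 := hJ 0
  rw [edgeStart_zero] at h0
  refine Fin.cases ?_ (fun ν => ?_) j
  · rw [off_zero, zero_add]
    simpa [edgeDeriv, edgeStart_zero] using h0
  · have hTν := P.T_pos ν.succ
    rw [off_succ]
    refine IsJet.glue (c := P.T 0) (h0.congr (by linarith) (ae_of_all _ fun s hs => ?_)
      fun i hi s hs => ?_) ?_ (by linarith) (by linarith)
    · have : s - P.T 0 < 0 := by linarith [hs.2]
      simp [edgeDeriv, Fin.succ_ne_zero, this]
    · rcases hs.2.eq_or_lt with rfl | hlt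
      · simpa [edgeDeriv, edgeStart_succ] using hc ν (n - (i + 1)) (by omega)
      · have : s - P.T 0 < 0 := by linarith
        simp [edgeDeriv, Fin.succ_ne_zero, this]
    · have h1 := (hJ ν.succ).comp_add (-P.T 0)
      rw [edgeStart_succ, zero_sub, neg_neg, sub_neg_eq_add, add_comm (P.T ν.succ)] at h1
      have hne : ∀ i, ∀ s, P.T 0 ≤ s → edgeDeriv P.τ P.T y ν.succ (n - i) (s - P.T 0) =
          derivOn (n - i) (y ν.succ) 0 (P.T ν.succ) (s + -P.T 0) := fun i s hs => by
        rw [edgeDeriv, if_neg fun h => by linarith [h.2], edgeStart_succ, sub_eq_add_neg]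
      exact h1.congr (by linarith) (ae_of_all _ fun s hs => hne 0 s hs.1.le)
        fun i _ s hs => hne _ s hs.1

theorem edgeDeriv_of_le {y : Fin (r + 1) → ℝ → ℂ} (j : Fin (r + 1)) (k : ℕ) {s : ℝ}
    (hs : s < P.T 0) :
    edgeDeriv P.τ P.T y j k (s - P.off j) = derivOn k (y 0) (-P.τ) (P.T 0) s := by
  refine Fin.cases ?_ (fun ν => ?_) j
  · simp [edgeDeriv, edgeStart_zero]
  · have : s - P.T 0 < 0 := by linarith
    simp [edgeDeriv, Fin.succ_ne_zero, this]

theorem edgeDeriv_of_gt {y : Fin (r + 1) → ℝ → ℂ} (j : Fin (r + 1)) (k : ℕ) {s : ℝ}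
    (hs : P.off j ≤ s) :
    edgeDeriv P.τ P.T y j k (s - P.off j) =
      derivOn k (y j) (edgeStart P.τ j) (P.T j) (s - P.off j) := by
  rw [edgeDeriv, if_neg fun h => by linarith [h.2]]

theorem memLp_derivOn_top {y : Fin (r + 1) → ℝ → ℂ}
    (hy : ∀ j, MemW2 n (y j) (edgeStart P.τ j) (P.T j)) (j : Fin (r + 1)) :
    MemLp (fun s => derivOn n (y j) (edgeStart P.τ j) (P.T j) (s - P.off j)) 2
      (volume.restrict (P.act j)) := by
  have hle : edgeStart P.τ j ≤ 0 := by
    have := P.hτ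
    unfold edgeStart; split_ifs <;> linarith
  exact (((hy j).2.mono_measure (Measure.restrict_mono (Ioo_subset_Ioo_left hle) le_rfl)
    ).comp_measurePreserving (P.measurePreserving_edge j)).mono_measure
    (Measure.restrict_mono (P.act_subset j) le_rfl)

variable {P}

/-- The condition is given on the open interval; since `n ≥ 1`, both functions are continuous and
the equality extends to the end points. -/
theorem eqOn_prehistory {φ : ℝ → ℂ} (hφ : MemW2 n φ (-P.τ) 0) {y : Fin (r + 1) → ℝ → ℂ}
    (h : IsSolution n P.τ P.T P.b P.c φ y) : EqOn φ (y 0) (Icc (-P.τ) 0) := by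
  have hn := P.hn
  have hτ := P.hτ
  have hT := P.T_pos 0
  have e : ∀ f : ℝ → ℂ, ∀ a b, derivOn 0 f a b = f := fun f a b => by
    funext t; simp [derivOn]
  have h1 := (hφ.1 0 (by omega)).continuousOn
  have h2 := ((h.memW2 0).1 0 (by omega)).continuousOn
  rw [e, uIcc_of_le (by linarith)] at h1
  rw [e, edgeStart_zero, uIcc_of_le (by linarith)] at h2
  refine EqOn.of_subset_closure (s := Ioo (-P.τ) 0) (fun t ht => (h.prehistory t ht).symm) h1
    (h2.mono (Icc_subset_Icc_right hT.le)) Ioo_subset_Icc_self ?_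
  rw [closure_Ioo (by linarith)]

/-- A solution is determined by its data. -/
theorem exists_rep {φ : ℝ → ℂ} (hφ : MemW2 n φ (-P.τ) 0) {y : Fin (r + 1) → ℝ → ℂ}
    (h : IsSolution n P.τ P.T P.b P.c φ y) : ∃ u, P.Rep y (P.pre hφ, u) := by
  have hτ := P.hτ
  have hT := P.T_pos 0
  set u : P.Ctl := fun j => (P.memLp_derivOn_top h.memW2 j).toLp _ with hu
  have hua : ∀ j, ∀ᵐ s : ℝ, s ∈ P.act j →
      u j s = derivOn n (y j) (edgeStart P.τ j) (P.T j) (s - P.off j) := fun j => by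
    rw [← ae_restrict_iff' (P.measurableSet_act j)]
    exact (P.memLp_derivOn_top h.memW2 j).coeFn_toLp
  have hJ := P.isJet_edgeDeriv h.memW2 h.continuity
  have hJ0 := IsJet.of_memW2 (h.memW2 0) (P.edgeStart_lt 0)
  rw [edgeStart_zero] at hJ0
  have hJφ := hJ0.mono_right (c := 0) (by linarith) hT.le
  have hφy : EqOn φ ((fun i => derivOn (n - i) (y 0) (-P.τ) (P.T 0)) n) (Icc (-P.τ) 0) := by
    intro t ht
    simpa [derivOn] using eqOn_prehistory hφ h ht
  -- A function that vanishes on the final stretch of length `τ` has vanishing derivatives there, in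
  -- particular at the tip: the equilibrium condition becomes the terminal constraint.
  have hend : ∀ ν : Fin r,
      (∀ l < n, derivOn (n - (l + 1)) (y ν.succ) 0 (P.T ν.succ) (P.T ν.succ - P.τ) = 0) ∧
      ∀ᵐ t : ℝ, t ∈ Ioo (P.T ν.succ - P.τ) (P.T ν.succ) →
        derivOn n (y ν.succ) 0 (P.T ν.succ) t = 0 := by
    intro ν
    have h1 := IsJet.of_memW2 (h.memW2 ν.succ) (P.edgeStart_lt ν.succ)
    rw [edgeStart_succ] at h1
    have h2 := (h1.mono_left (c := P.T ν.succ - P.τ) (by linarith [P.hT ν.succ])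
      (by linarith)).eq_zero_of_eqOn_zero (by linarith) (fun t ht => by
        simpa [derivOn] using h.equilibrium ν t ht)
    exact ⟨fun l hl => h2.1 l hl ⟨le_rfl, by linarith⟩, h2.2⟩
  -- Four stretches of a path are compared: the prehistory, the entering edge, the outgoing edge
  -- before its tip, and the part past the tip. The derivatives of lower order then follow by
  -- uniqueness of jets.
  have hup : ∀ j, ∀ᵐ s : ℝ, s ∈ Ioo (-P.τ) (P.off j + P.T j) →
      edgeDeriv P.τ P.T y j n (s - P.off j) = P.path (P.pre hφ, u) j 0 s := by
    intro j
    have hne : ∀ᵐ s : ℝ, s ≠ 0 ∧ s ≠ P.T 0 := by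
      refine Filter.Eventually.and ?_ ?_ <;> (rw [ae_iff]; simp)
    have h3 : ∀ᵐ s : ℝ, P.tip j ≤ s → s < P.off j + P.T j →
        edgeDeriv P.τ P.T y j n (s - P.off j) = P.path (P.pre hφ, u) j 0 s := by
      refine Fin.cases ?_ (fun ν => ?_) j
      · refine ae_of_all _ fun s h1 h2 => ?_
        rw [tip_zero] at h1
        rw [off_zero] at h2
        linarith
      · have hst : ∀ᵐ s : ℝ, s ≠ P.tip ν.succ := by rw [ae_iff]; simp
        filter_upwards [ae_edge_of_ae (hend ν).2 (-P.T 0), hst] with s hs hst h1 h2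
        have h1' := lt_of_le_of_ne h1 (Ne.symm hst)
        rw [tip_succ] at h1'
        rw [P.edgeDeriv_of_gt _ _ ((P.off_lt_tip _).le.trans h1), edgeStart_succ, off_succ,
          sub_eq_add_neg, hs ⟨by linarith, by rw [off_succ] at h2; linarith⟩]
        exact (P.top_of_ge _ ν h1).symm
    filter_upwards [hua 0, hua j, hne, h3, P.pre_top_ae hφ u j,
      hJφ.derivOn_top_ae (by linarith) hφy] with s h0 hj hne h3 hpre hφs hs
    rcases lt_or_gt_of_ne hne.1 with hs0 | hs0
    · rw [P.edgeDeriv_of_le j n (by linarith)]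
      refine Eq.trans ?_ (hpre ⟨hs.1, hs0⟩).symm
      rw [hφs ⟨hs.1, hs0⟩, Nat.sub_zero]
    rcases lt_or_gt_of_ne hne.2 with hsT | hsT
    · have hact : s ∈ P.act 0 := ⟨by rw [off_zero]; exact hs0, by rw [tip_zero]; exact hsT⟩
      rw [P.edgeDeriv_of_le j n hsT]
      refine Eq.trans ?_ ((P.top_eq_of_lt (P.pre hφ, u) j hsT.le).trans
        (P.top_eq_of_mem_act _ hact)).symm
      rw [h0 hact, off_zero, sub_zero, edgeStart_zero]
    · rcases lt_or_ge s (P.tip j) with hst | hst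
      · have hoff : P.off j < s := by
          unfold off; split_ifs <;> linarith
        rw [P.edgeDeriv_of_gt j n hoff.le]
        refine Eq.trans ?_ (P.top_eq_of_mem_act (P.pre hφ, u) ⟨hoff, hst⟩).symm
        rw [hj ⟨hoff, hst⟩]
      · exact h3 hst hs.2
  have hlow : ∀ j, ∀ l < n, ∀ s ∈ Icc (-P.τ) (P.off j + P.T j),
      edgeDeriv P.τ P.T y j (n - (l + 1)) (s - P.off j) =
        P.path (P.pre hφ, u) j (l + 1) s := by
    intro j l hl s hs
    refine (P.isJet_path (P.pre hφ, u) j _).eqOn (hJ j) ?_ ?_ hl hs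
    · simpa using hup j
    · intro i hi
      rw [P.edgeDeriv_of_le j _ (by linarith), P.path_pre hφ u j hi ⟨le_rfl, by linarith⟩,
        hJφ.derivOn_eq (by linarith) hφy (by omega) ⟨le_rfl, by linarith⟩,
        show n - (n - (n - (i + 1))) = n - (i + 1) by omega]
  refine ⟨u, hlow, hup, funext fun ⟨ν, i⟩ => ?_⟩
  have hle := P.tip_le ν.succ
  have := hlow ν.succ i i.2 (P.tip ν.succ) ⟨P.neg_τ_le_tip _, hle⟩
  rw [P.edgeDeriv_of_gt _ _ (P.off_lt_tip _).le, edgeStart_succ, tip_succ, off_succ,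
    show ∀ x y : ℝ, y + x - y = x from fun x y => by ring] at this
  rw [endAll_apply, tip_succ]
  rw [← this]
  exact (hend ν).1 i i.2

end StarProblem

/-! ### Bounds in terms of the data and the main result -/

namespace StarProblem

variable {r n : ℕ} (P : StarProblem r n)

theorem exists_norm_pre_le : ∃ K, 0 ≤ K ∧ ∀ {φ : ℝ → ℂ} (hφ : MemW2 n φ (-P.τ) 0),
    ‖P.pre hφ‖ ≤ K * normW2 n φ (-P.τ) 0 := by
  have hτ := P.hτ
  refine ⟨1 / Real.sqrt (0 - -P.τ) + Real.sqrt (0 - -P.τ) + 1, by positivity, fun {φ} hφ => ?_⟩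
  have hW : 0 ≤ normW2 n φ (-P.τ) 0 := Real.sqrt_nonneg _
  refine norm_prod_le_iff.2 ⟨(pi_norm_le_iff_of_nonneg (by positivity)).2 fun i => ?_, ?_⟩
  · refine (hφ.norm_derivOn_left_le (by linarith) i.2).trans ?_
    exact mul_le_mul_of_nonneg_right (by linarith) hW
  · have h1 : ‖hφ.2.toLp _‖ = l2Norm (Ioo (-P.τ) 0) (derivOn n φ (-P.τ) 0) := by
      rw [← l2Norm_coe]
      exact l2Norm_congr hφ.2.coeFn_toLp
    refine h1.trans_le ((l2Norm_le_normW2 le_rfl hφ.2).trans (le_mul_of_one_le_left hW ?_))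
    have : 0 ≤ 1 / Real.sqrt (0 - -P.τ) + Real.sqrt (0 - -P.τ) := by positivity
    linarith

theorem l2Norm_top_le (w : P.Pre × P.Ctl) (j : Fin (r + 1)) {p q : ℝ} (hp : -P.τ ≤ p) :
    l2Norm (Ioo p q) (P.top w j) ≤ Real.exp (1 * (q - -P.τ)) * (3 * ‖w‖) := by
  have hS : Ioo p q ⊆ Ici (-P.τ) := fun s hs => hp.trans hs.1.le
  have hm : MemLp (P.top w j) 2 (volume.restrict (Ioi (-P.τ))) :=
    (P.memLp_top w j).mono_measure Measure.restrict_le_self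
  have hmw := memLp_expWeight_smul (a := -P.τ) zero_le_one measurableSet_Ioi
    Ioi_subset_Ici_self hm
  have h := (of_expWeight_smul (a := -P.τ) zero_le_one measurableSet_Ioo
    (fun s (hs : s ∈ Ioo p q) => hs.2.le) (f := P.top w j)
    (memLp_expWeight_smul zero_le_one measurableSet_Ioo hS
      ((P.memLp_top w j).mono_measure Measure.restrict_le_self))).2
  refine h.trans ?_
  gcongr
  exact (l2Norm_mono_set (fun s hs => hp.trans_lt hs.1) hmw).trans
    (P.l2Norm_weighted_top_le_norm w j)

variable {P}

theorem Rep.eqOn_comp {y : Fin (r + 1) → ℝ → ℂ} {w : P.Pre × P.Ctl} (h : P.Rep y w)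
    (j : Fin (r + 1)) : EqOn (y j) (P.comp w j) (Icc (edgeStart P.τ j) (P.T j)) := by
  intro t ht
  have hn := P.hn
  have hT := P.T_pos 0
  have hτ := P.hτ
  have hs : -P.τ ≤ t + P.off j ∧ ¬ (j ≠ 0 ∧ t < 0) := by
    revert ht
    refine Fin.cases ?_ (fun ν => ?_) j
    · rw [edgeStart_zero, off_zero]
      exact fun ht => ⟨by linarith [ht.1], fun h => h.1 rfl⟩
    · rw [edgeStart_succ, off_succ]
      exact fun ht => ⟨by linarith [ht.1], fun h => absurd ht.1 (not_le.2 h.2)⟩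
  have h1 := h.lower j (n - 1) (by omega) (t + P.off j) ⟨hs.1, by linarith [ht.2]⟩
  rw [add_sub_cancel_right, edgeDeriv, if_neg hs.2, show n - 1 + 1 = n by omega,
    Nat.sub_self] at h1
  simpa [derivOn, comp] using h1

variable (P)

/-- The right end `q` is free because the estimate on an outgoing edge stops at `T j - τ`. As
`derivOn` depends on the interval, the jet is taken on the shorter interval. -/
theorem exists_normW2_le (j : Fin (r + 1)) {q : ℝ} (hq : edgeStart P.τ j < q) (hqT : q ≤ P.T j) :
    ∃ K, 0 ≤ K ∧ ∀ (y : Fin (r + 1) → ℝ → ℂ) (w : P.Pre × P.Ctl), P.Rep y w →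
      normW2 n (y j) (edgeStart P.τ j) q ≤ K * ‖w‖ := by
  set a := edgeStart P.τ j
  -- A common bound per unit of `‖w‖`: the derivative of order `n` needs the factor `3`, the one of
  -- codegree `l + 1` needs `l + 1 + 3 ≤ n + 3`.
  set M : ℝ := Real.exp (1 * (P.off j + q - -P.τ)) * (n + 3)
  have ha : -P.τ ≤ P.off j + a := by
    have := P.off_nonneg j
    have := P.hτ
    have : -P.τ ≤ a := by
      simp only [a, edgeStart]; split_ifs <;> linarith
    linarith
  refine ⟨Real.sqrt ((n + 1) * (1 + (q - a))) * M, by positivity, fun y w h => ?_⟩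
  rw [mul_assoc]
  refine (P.isJet_shift w j le_rfl hq.le).normW2_le hq
    ((h.eqOn_comp j).mono (Icc_subset_Icc_right hqT)) (by positivity)
    (P.memLp_shift w j a q) ?_ fun l hl t ht => ?_
  · have h1 : l2Norm (Ioo a q) (fun t => P.path w j 0 (t + P.off j)) =
        l2Norm (Ioo (P.off j + a) (P.off j + q)) (P.top w j) := by
      have hm := measurePreserving_add_Ioo (P.off j) a q
      unfold l2Norm
      rw [← eLpNorm_comp_measurePreserving
        ((P.memLp_top w j).1.mono_measure Measure.restrict_le_self) hm]
      rfl
    refine h1.trans_le ((P.l2Norm_top_le w j ha).trans ?_)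
    rw [← mul_assoc]
    simp only [M]
    gcongr
    linarith [(Nat.cast_nonneg n : (0 : ℝ) ≤ n)]
  · refine (P.norm_path_succ_le w j l (by linarith [ht.1])).trans ?_
    simp only [M]
    have hl' : (l + 1 : ℝ) ≤ n := by exact_mod_cast hl
    have hexp : t + P.off j - -P.τ ≤ P.off j + q - -P.τ := by linarith [ht.2]
    gcongr

/-! ### Solvability, uniqueness and the a priori estimate -/

theorem ellAll_mk (ξ : P.Pre) (u : P.Ctl) :
    P.ellAll (ξ, u) = P.ellAll.comp (ContinuousLinearMap.inl ℂ P.Pre P.Ctl) ξ + P.A u := by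
  simp only [A, ContinuousLinearMap.comp_apply, ← map_add]
  simp

theorem endAll_mk (ξ : P.Pre) (u : P.Ctl) :
    P.endAll (ξ, u) = P.E u + P.endAll.comp (ContinuousLinearMap.inl ℂ P.Pre P.Ctl) ξ := by
  simp only [E, ContinuousLinearMap.comp_apply, ← map_add]
  simp

/-- For every prehistory there is exactly one control that solves the least squares problem,
and it depends boundedly on the prehistory. -/
theorem exists_control : ∃ C, 0 ≤ C ∧ ∀ ξ : P.Pre, ∃ u : P.Ctl,
    P.endAll (ξ, u) = 0 ∧ (∀ v, P.E v = 0 → inner ℂ (P.ellAll (ξ, u)) (P.A v) = 0) ∧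
    ‖u‖ ≤ C * ‖ξ‖ ∧
    ∀ u', P.endAll (ξ, u') = 0 → (∀ v, P.E v = 0 → inner ℂ (P.ellAll (ξ, u')) (P.A v) = 0) →
      u' = u := by
  obtain ⟨K, hK, hA⟩ := P.A_coercive
  obtain ⟨C, hC, H⟩ := leastSquares_exists P.A hK hA P.E P.E_surjective
    (P.ellAll.comp (ContinuousLinearMap.inl ℂ P.Pre P.Ctl))
    (P.endAll.comp (ContinuousLinearMap.inl ℂ P.Pre P.Ctl))
  refine ⟨C, hC, fun ξ => ?_⟩
  obtain ⟨u, h1, h2, h3⟩ := H ξ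
  refine ⟨u, by rw [endAll_mk, h1], fun v hv => by rw [ellAll_mk]; exact h2 v hv, h3,
    fun u' h1' h2' => ?_⟩
  rw [endAll_mk] at h1'
  exact leastSquares_unique hA h1' (fun v hv => by rw [← ellAll_mk]; exact h2' v hv) h1 h2

/-- The control that solves the least squares problem with the given prehistory. -/
noncomputable def control (ξ : P.Pre) : P.Ctl := (P.exists_control.choose_spec.2 ξ).choose

theorem endAll_control (ξ : P.Pre) : P.endAll (ξ, P.control ξ) = 0 :=
  (P.exists_control.choose_spec.2 ξ).choose_spec.1

theorem inner_control (ξ : P.Pre) (v : P.Ctl) (hv : P.E v = 0) :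
    inner ℂ (P.ellAll (ξ, P.control ξ)) (P.A v) = 0 :=
  (P.exists_control.choose_spec.2 ξ).choose_spec.2.1 v hv

theorem norm_control_le : ∃ C, 0 ≤ C ∧ ∀ ξ, ‖P.control ξ‖ ≤ C * ‖ξ‖ :=
  ⟨_, P.exists_control.choose_spec.1, fun ξ =>
    (P.exists_control.choose_spec.2 ξ).choose_spec.2.2.1⟩

variable {P}

theorem isSolution_control {φ : ℝ → ℂ} (hφ : MemW2 n φ (-P.τ) 0) :
    IsSolution n P.τ P.T P.b P.c φ (P.comp (P.pre hφ, P.control (P.pre hφ))) :=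
  P.isSolution_comp hφ (P.endAll_control _)
    ((P.rep_comp (P.endAll_control _)).exists_isQuasiDeriv (P.inner_control _))

/-- The control of any solution satisfies the least squares conditions, so it is the distinguished
one. Uniqueness and the a priori bound both follow from this representation. -/
theorem rep_control {φ : ℝ → ℂ} (hφ : MemW2 n φ (-P.τ) 0) {y : Fin (r + 1) → ℝ → ℂ}
    (h : IsSolution n P.τ P.T P.b P.c φ y) : P.Rep y (P.pre hφ, P.control (P.pre hφ)) := by
  obtain ⟨u, hu⟩ := exists_rep hφ h
  obtain ⟨q, hq, hn, hv⟩ := h.equation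
  have : u = P.control (P.pre hφ) := (P.exists_control.choose_spec.2 (P.pre hφ)).choose_spec.2.2.2
    u hu.terminal fun v hv' => hu.orthogonal hq hn hv hv'
  rwa [← this]

variable (P)

theorem exists_bound : ∃ C : ℝ, ∀ (φ : ℝ → ℂ) (y : Fin (r + 1) → ℝ → ℂ), MemW2 n φ (-P.τ) 0 →
    IsSolution n P.τ P.T P.b P.c φ y →
      normW2 n (y 0) (-P.τ) (P.T 0) + ∑ ν : Fin r, normW2 n (y ν.succ) 0 (P.T ν.succ - P.τ) ≤
        C * normW2 n φ (-P.τ) 0 := by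
  obtain ⟨K, hK, hpre⟩ := P.exists_norm_pre_le
  obtain ⟨C, hC, hctl⟩ := P.norm_control_le
  obtain ⟨K0, hK0, h0⟩ := P.exists_normW2_le 0 (P.edgeStart_lt 0) le_rfl
  have H := fun ν : Fin r => P.exists_normW2_le ν.succ (q := P.T ν.succ - P.τ)
    (by rw [edgeStart_succ]; linarith [P.hT ν.succ]) (by linarith [P.hτ])
  choose K1 hK1 h1 using H
  rw [edgeStart_zero] at h0
  simp only [edgeStart_succ] at h1
  refine ⟨(K0 + ∑ ν, K1 ν) * ((1 + C) * K), fun φ y hφ hy => ?_⟩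
  have hrep := rep_control hφ hy
  set w := (P.pre hφ, P.control (P.pre hφ))
  have hw : ‖w‖ ≤ (1 + C) * K * normW2 n φ (-P.τ) 0 := by
    have h2 : ‖w‖ ≤ (1 + C) * ‖P.pre hφ‖ := by
      refine norm_prod_le_iff.2 ⟨?_, (hctl _).trans ?_⟩
      · exact le_mul_of_one_le_left (norm_nonneg _) (by linarith)
      · gcongr; linarith
    refine h2.trans ?_
    rw [mul_assoc]
    exact mul_le_mul_of_nonneg_left (hpre hφ) (by linarith)
  calc _ ≤ K0 * ‖w‖ + ∑ ν, K1 ν * ‖w‖ :=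
        add_le_add (h0 y w hrep) (Finset.sum_le_sum fun ν _ => h1 ν y w hrep)
    _ = (K0 + ∑ ν, K1 ν) * ‖w‖ := by rw [add_mul, Finset.sum_mul]
    _ ≤ (K0 + ∑ ν, K1 ν) * ((1 + C) * K * normW2 n φ (-P.τ) 0) := by
        refine mul_le_mul_of_nonneg_left hw (add_nonneg hK0 (Finset.sum_nonneg fun ν _ => hK1 ν))
    _ = _ := by ring

end StarProblem

theorem mainTheorem4 (r n : ℕ) (hr : 1 ≤ r) (hn : 1 ≤ n)
    (τ : ℝ) (hτ : 0 < τ) (T : Fin (r + 1) → ℝ) (hT : ∀ j, τ < T j)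
    (b c : Fin (r + 1) → ℕ → ℝ → ℂ)
    (hbn : ∀ j, MemLp (b j n) ⊤ (volume.restrict (Ioo 0 (T j))))
    (hbn_ne : ∀ j, ∀ᵐ t ∂volume.restrict (Ioo 0 (T j)), b j n t ≠ 0)
    (hbn_inv : ∀ j, MemLp (fun t => 1 / b j n t) ⊤ (volume.restrict (Ioo 0 (T j))))
    (hcn : ∀ j, MemLp (c j n) ⊤ (volume.restrict (Ioo 0 (T j))))
    (hb : ∀ j, ∀ k < n, MemLp (b j k) 2 (volume.restrict (Ioo 0 (T j))))
    (hc : ∀ j, ∀ k < n, MemLp (c j k) 2 (volume.restrict (Ioo 0 (T j)))) :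
    (∀ φ : ℝ → ℂ, MemW2 n φ (-τ) 0 →
      ∃ y : Fin (r + 1) → ℝ → ℂ, IsSolution n τ T b c φ y ∧
        ∀ z : Fin (r + 1) → ℝ → ℂ, IsSolution n τ T b c φ z →
          ∀ j, EqOn (z j) (y j) (Icc (edgeStart τ j) (T j))) ∧
    ∃ C : ℝ, ∀ (φ : ℝ → ℂ) (y : Fin (r + 1) → ℝ → ℂ), MemW2 n φ (-τ) 0 →
      IsSolution n τ T b c φ y →
        normW2 n (y 0) (-τ) (T 0) + ∑ ν : Fin r, normW2 n (y ν.succ) 0 (T ν.succ - τ) ≤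
          C * normW2 n φ (-τ) 0 := by
  let P : StarProblem r n := ⟨τ, T, b, c, hn, hτ, hT, hbn, hbn_ne, hbn_inv, hcn, hb, hc⟩
  refine ⟨fun φ hφ => ⟨_, StarProblem.isSolution_control (P := P) hφ, fun z hz j => ?_⟩,
    P.exists_bound⟩
  exact (StarProblem.rep_control (P := P) hφ hz).eqOn_comp j
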